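/- Let $\mu,\sigma,q>0$ and $0<a<1$. For $r\in\mathbb R$ put $$\theta_{1}(r)=\frac{r-\mu+\sqrt{(r-\mu)^2+2q\sigma^2}}{\sigma^2},\qquad \theta_{2}(r)=\frac{r-\mu-\sqrt{(r-\mu)^2+2q\sigma^2}}{\sigma^2}.$$ **Optimal threshold.** For $c>0$, $b,x\ge 0$ let $$W_0(x,c)=\frac{e^{\theta_1(ac)x}-e^{\theta_2(ac)x}}{\sqrt{(\mu-ac)^2+2q\sigma^2}},\qquad B(c,b)=\frac1q\cdot\frac{ac\,e^{\theta_2(ac)b}(\theta_2(ac)-\theta_2(c))-(1-a)c\,\theta_2(c)}{\partial_xW_0(b,c)-\theta_2(c)W_0(b,c)},$$ $$D(c,b)=B(c,b)e^{-\theta_2(c)b}W_0(b,c)-\frac{ac}{q}e^{(\theta_2(ac)-\theta_2(c))b}-\frac{(1-a)c}{q}e^{-\theta_2(c)b},$$ and let $v(x,c,b)=B(c,b)W_0(x,c)+\frac{ac}{q}(1-e^{\theta_2(ac)x})$ if $x<b$, $v(x,c,b)=\frac cq+D(c,b)e^{\theta_2(c)x}$ if $x\ge b$ (the value, for the surplus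 $x+\mu t+\sigma W_t$ and discount rate $q$, of paying dividends at rate $ac$ below the threshold $b$ and at rate $c$ above it). Let $b^*(c)$ be the maximizer of $b\mapsto v(x,c,b)$ over $b\ge0$. **The function $C_0$.** Fix $y,z,c$ and write $A_i=\theta_i(c)$, $L_i=\theta_i(ac)$, $A_i'=\theta_i'(c)$, $L_i'=\theta_i'(ac)$, $E_i=e^{(z-y)A_i}$, $F_i=e^{yL_i}$ for $i=1,2$, and $\Delta=A_1-A_2$, $P=1+a(F_2-1)$. Let $$d(y,z,c)=E_1\big((F_2-F_1)A_2-F_2L_2+F_1L_1\big)+E_2\big(F_2L_2+(F_1-F_2)A_1-F_1L_1\big),$$ $$b_{01}(y,c)=c\Delta\big(aF_2L_2(L_2-A_2)+(PA_2-aF_2L_2)A_1\big),$$ $$b_{11}(y,c)=-\Delta\big(F_1(L_1-A_1)(L_1-A_2)+F_2(A_2-L_2)(L_2-A_1)\big),$$ $$\begin{aligned}b_{00}(y,z,c)={}&-\Delta^2+\Delta E_1\big[aF_2L_2-PA_2-cPA_2'+a^2cF_2L_2'(1-yA_2+yL_2)-c(z-y)(PA_2-aF_2L_2)A_1'\big]\\&+\Delta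 E_2\big[PA_1-aF_2L_2+cPA_1'-a^2cF_2L_2'(1-yA_1+yL_2)+c(z-y)(PA_1-aF_2L_2)A_2'\big]\\&+c\,(A_1'-A_2')\big[E_1(PA_2-aF_2L_2)-E_2(PA_1-aF_2L_2)\big],\end{aligned}$$ $$\begin{aligned}b_{10}(y,z,c)={}&\Delta E_1\big[(F_1-F_2)A_2'+(z-y)\big((F_1-F_2)A_2-F_1L_1+F_2L_2\big)A_1'-aF_1L_1'(1+yL_1-yA_2)+aF_2L_2'(1+yL_2-yA_2)\big]\\&-\Delta E_2\big[(F_1-F_2)A_1'+(z-y)\big((F_1-F_2)A_1-F_1L_1+F_2L_2\big)A_2'-aF_1L_1'(1+yL_1-yA_1)+aF_2L_2'(1+yL_2-yA_1)\big]\\&+(A_1'-A_2')\big[E_1\big(F_1L_1-F_2L_2-(F_1-F_2)A_2\big)-E_2\big(F_1L_1-F_2L_2-(F_1-F_2)A_1\big)\big],\end{aligned}$$ $$C_0(y,z,c)=b_{11}(y,c)\,\partial_z\!\left(\frac{b_{00}(y,z,c)}{d(y,z,c)}\right)-b_{01}(y,c)\,\partial_z\!\left(\frac{b_{10}(y,z,c)}{d(y,z,c)}\right).$$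 **Proposition.** There is $c_0>q\sigma^2/(2\mu)$ such that for every $\overline c>c_0$ the threshold $b^*(\overline c)$ is well defined (for every $x>0$ the function $b\mapsto v(x,\overline c,b)$ has exactly one maximizer on $[0,\infty)$, and it does not depend on $x$) and the function $C_0(b^*(\overline c),\cdot,\overline c)$ has a unique zero $z^*(\overline c)$ in $(b^*(\overline c),\infty)$. Moreover $$\lim_{\overline c\to\infty}z^*(\overline c)=\frac{\mu}{q}\Big(1+\frac1{\sqrt a}\Big),$$ the function $z^*$ is infinitely differentiable on $(c_0,\infty)$, and, as $\overline c\to\infty$, $$z^*(\overline c)=\frac{\mu}{q}\Big(1+\frac1{\sqrt a}\Big)+\frac{(1-2\sqrt a-3a)\mu^2-3\big(1+\sqrt{a^3}/2\big)q\sigma^2}{3q\sqrt{a^3}}\,\frac1{\overline c}+O\Big(\frac1{\overline c^{2}}\Big).$$ -/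

import Mathlib

open Filter Topology Asymptotics

noncomputable section

namespace DrawdownDividends

/-- Positive root of `(σ² / 2) z² + (μ - r) z - q = 0`, as a function of the dividend rate `r`. -/
def theta1 (μ σ q r : ℝ) : ℝ := (r - μ + Real.sqrt ((r - μ) ^ 2 + 2 * q * σ ^ 2)) / σ ^ 2

/-- Negative root of `(σ² / 2) z² + (μ - r) z - q = 0`, as a function of the dividend rate `r`. -/
def theta2 (μ σ q r : ℝ) : ℝ := (r - μ - Real.sqrt ((r - μ) ^ 2 + 2 * q * σ ^ 2)) / σ ^ 2

/-- The derivative of `theta1` with respect to the dividend rate. -/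
def theta1' (μ σ q r : ℝ) : ℝ := deriv (fun s => theta1 μ σ q s) r

/-- The derivative of `theta2` with respect to the dividend rate. -/
def theta2' (μ σ q r : ℝ) : ℝ := deriv (fun s => theta2 μ σ q s) r

/-! ### The value of a refracting strategy and its optimal threshold

Here `c` is the maximal dividend rate: the refracting strategy with threshold `b` pays at rate
`a * c` while the surplus is below `b` and at rate `c` while it is above `b`. -/

/-- The function `W₀(x, c)`. -/
def W0 (μ σ q a x c : ℝ) : ℝ :=
  (Real.exp (theta1 μ σ q (a * c) * x) - Real.exp (theta2 μ σ q (a * c) * x)) /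
    Real.sqrt ((μ - a * c) ^ 2 + 2 * q * σ ^ 2)

/-- The coefficient `B(c, b)`. -/
def coeffB (μ σ q a c b : ℝ) : ℝ :=
  (1 / q) *
    ((a * c * Real.exp (theta2 μ σ q (a * c) * b) * (theta2 μ σ q (a * c) - theta2 μ σ q c)
        - (1 - a) * c * theta2 μ σ q c) /
      (deriv (fun x => W0 μ σ q a x c) b - theta2 μ σ q c * W0 μ σ q a b c))

/-- The coefficient `D(c, b)`. -/
def coeffD (μ σ q a c b : ℝ) : ℝ :=
  coeffB μ σ q a c b * Real.exp (-(theta2 μ σ q c * b)) * W0 μ σ q a b c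
    - a * c / q * Real.exp ((theta2 μ σ q (a * c) - theta2 μ σ q c) * b)
    - (1 - a) * c / q * Real.exp (-(theta2 μ σ q c * b))

/-- The value `v(x, c, b)` of the refracting strategy with threshold `b` and maximal rate `c`,
started from surplus `x`. -/
def refractingValue (μ σ q a x c b : ℝ) : ℝ :=
  if x < b then
    coeffB μ σ q a c b * W0 μ σ q a x c
      + a * c / q * (1 - Real.exp (theta2 μ σ q (a * c) * x))
  else
    c / q + coeffD μ σ q a c b * Real.exp (theta2 μ σ q c * x)

/-- `arg max_{b ≥ 0} v(x, c, b)`, the set of all maximizers. -/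
def argmaxThreshold (μ σ q a x c : ℝ) : Set ℝ :=
  {b | 0 ≤ b ∧ ∀ b' : ℝ, 0 ≤ b' → refractingValue μ σ q a x c b' ≤ refractingValue μ σ q a x c b}

/-! ### The function `C₀`

In the next definitions `A₁, A₂` stand for `θ₁(c), θ₂(c)`, `L₁, L₂` for `θ₁(a c), θ₂(a c)`, and
the primed letters for `θ₁'(c), θ₂'(c), θ₁'(a c), θ₂'(a c)`; `E₁, E₂` stand for
`exp ((z - y) θ₁(c)), exp ((z - y) θ₂(c))` and `F₁, F₂` for
`exp (y θ₁(a c)), exp (y θ₂(a c))`. -/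

/-- The function `d(y, z, c)`. -/
def dFun (μ σ q a y z c : ℝ) : ℝ :=
  let A₁ := theta1 μ σ q c
  let A₂ := theta2 μ σ q c
  let L₁ := theta1 μ σ q (a * c)
  let L₂ := theta2 μ σ q (a * c)
  let E₁ := Real.exp ((z - y) * A₁)
  let E₂ := Real.exp ((z - y) * A₂)
  let F₁ := Real.exp (y * L₁)
  let F₂ := Real.exp (y * L₂)
  F₂ * E₁ * A₂ - E₁ * F₁ * A₂ + E₂ * F₂ * L₂ - F₂ * E₁ * L₂
    + E₂ * (-F₂ + F₁) * A₁ + F₁ * (-E₂ + E₁) * L₁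

/-- The function `b₀₀(y, z, c)`. -/
def b00 (μ σ q a y z c : ℝ) : ℝ :=
  let A₁ := theta1 μ σ q c
  let A₂ := theta2 μ σ q c
  let L₂ := theta2 μ σ q (a * c)
  let A₁' := theta1' μ σ q c
  let A₂' := theta2' μ σ q c
  let L₂' := theta2' μ σ q (a * c)
  let E₁ := Real.exp ((z - y) * A₁)
  let E₂ := Real.exp ((z - y) * A₂)
  let F₂ := Real.exp (y * L₂)
  a * E₂ * F₂ * L₂ * (A₂ - A₁) - E₁ * A₂ * (A₁ - A₂)
    - a * E₁ * (-1 + F₂) * A₂ * (A₁ - A₂)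
    + a * F₂ * E₁ * L₂ * (A₁ - A₂) + E₂ * A₁ * (A₁ - A₂)
    + a * E₂ * (-1 + F₂) * A₁ * (A₁ - A₂)
    - (A₁ - A₂) ^ 2 - E₁ * (c + a * c * (-1 + F₂)) * (A₁ - A₂) * A₂'
    + E₂ * (z - y) * (A₁ - A₂) * (-(a * c * F₂ * L₂) + c * (1 + a * (-1 + F₂)) * A₁) * A₂'
    + a ^ 2 * c * E₂ * F₂ * (A₂ - A₁) * L₂' + a ^ 2 * c * E₂ * F₂ * y * L₂ * (A₂ - A₁) * L₂'
    + a ^ 2 * c * F₂ * E₁ * (A₁ - A₂) * L₂' - a ^ 2 * c * F₂ * E₁ * y * A₂ * (A₁ - A₂) * L₂'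
    + a ^ 2 * c * F₂ * E₁ * y * L₂ * (A₁ - A₂) * L₂'
    + a ^ 2 * c * E₂ * F₂ * y * A₁ * (A₁ - A₂) * L₂'
    + E₂ * (c + a * c * (-1 + F₂)) * (A₁ - A₂) * A₁'
    + c * E₁ * (y - z) * (A₂ + a * (-1 + F₂) * A₂ - a * F₂ * L₂) * (A₁ - A₂) * A₁'
    + E₁ * (c * (1 + a * (-1 + F₂)) * A₂ - a * c * F₂ * L₂) * (-A₂' + A₁')
    + c * E₂ * (a * F₂ * L₂ + (-1 + a - a * F₂) * A₁) * (-A₂' + A₁')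

/-- The function `b₀₁(y, c)`. -/
def b01 (μ σ q a y c : ℝ) : ℝ :=
  let A₁ := theta1 μ σ q c
  let A₂ := theta2 μ σ q c
  let L₂ := theta2 μ σ q (a * c)
  let F₂ := Real.exp (y * L₂)
  c * (A₁ - A₂) *
    (a * F₂ * L₂ * (-A₂ + L₂) + (A₂ + a * (-1 + F₂) * A₂ - a * F₂ * L₂) * A₁)

/-- The function `b₁₀(y, z, c)`. -/
def b10 (μ σ q a y z c : ℝ) : ℝ :=
  let A₁ := theta1 μ σ q c
  let A₂ := theta2 μ σ q c
  let L₁ := theta1 μ σ q (a * c)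
  let L₂ := theta2 μ σ q (a * c)
  let A₁' := theta1' μ σ q c
  let A₂' := theta2' μ σ q c
  let L₁' := theta1' μ σ q (a * c)
  let L₂' := theta2' μ σ q (a * c)
  let E₁ := Real.exp ((z - y) * A₁)
  let E₂ := Real.exp ((z - y) * A₂)
  let F₁ := Real.exp (y * L₁)
  let F₂ := Real.exp (y * L₂)
  E₂ * (F₁ - F₂) * (-A₁ + A₂) * A₁'
    - E₁ * (y - z) * (A₁ - A₂) * (-(F₁ * L₁) + (F₁ - F₂) * A₂ + F₂ * L₂) * A₁'
    - a * E₁ * F₁ * (A₁ - A₂) * L₁' + a * F₁ * E₂ * (A₁ - A₂) * L₁'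
    - a * E₁ * F₁ * y * L₁ * (A₁ - A₂) * L₁'
    + a * F₁ * E₂ * y * L₁ * (A₁ - A₂) * L₁'
    - E₂ * ((-F₁ + F₂) * A₁ + F₁ * L₁ - F₂ * L₂) * (A₁' - A₂')
    + E₁ * (F₁ * L₁ + (-F₁ + F₂) * A₂ - F₂ * L₂) * (A₁' - A₂')
    + E₁ * (F₁ - F₂) * (A₁ - A₂) * A₂'
    + E₂ * (-y + z) * (A₁ - A₂) * ((-F₁ + F₂) * A₁ + F₁ * L₁ - F₂ * L₂) * A₂'
    + a * E₁ * F₂ * (A₁ - A₂) * L₂'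
    + a * E₂ * F₂ * (-A₁ + A₂) * L₂' + a * E₁ * F₂ * y * (A₁ - A₂) * L₂ * L₂'
    + a * E₂ * F₂ * y * (-A₁ + A₂) * L₂ * L₂'
    - a * E₂ * y * A₁ * (A₁ - A₂) * (F₁ * L₁' - F₂ * L₂')
    + a * E₁ * y * (A₁ - A₂) * A₂ * (F₁ * L₁' - F₂ * L₂')

/-- The function `b₁₁(y, c)`. -/
def b11 (μ σ q a y c : ℝ) : ℝ :=
  let A₁ := theta1 μ σ q c
  let A₂ := theta2 μ σ q c
  let L₁ := theta1 μ σ q (a * c)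
  let L₂ := theta2 μ σ q (a * c)
  let F₁ := Real.exp (y * L₁)
  let F₂ := Real.exp (y * L₂)
  (-(A₁ - A₂)) * (F₁ * (L₁ - A₁) * (L₁ - A₂) + F₂ * (A₂ - L₂) * (L₂ - A₁))

/-- The function `C₀(y, z, c) = b₁₁(y, c) ∂_z (b₀₀ / d)(y, z, c) - b₀₁(y, c) ∂_z (b₁₀ / d)(y, z, c)`.
-/
def C0 (μ σ q a y z c : ℝ) : ℝ :=
  b11 μ σ q a y c * deriv (fun u => b00 μ σ q a y u c / dFun μ σ q a y u c) z
    - b01 μ σ q a y c * deriv (fun u => b10 μ σ q a y u c / dFun μ σ q a y u c) z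

end DrawdownDividends

end

/-! Write `A = θ₁(c)`, `w = -θ₂(c)`, `l = θ₁(ac)`, `u = -θ₂(ac)`, `K = μ/q`, `p = 2q/σ²`. Since `A w
= l u = p`, everything is governed by the single small parameter `w`, which behaves like `q/c` as `c
→ ∞`.

Threshold. As a function of `b`, the value is an increasing affine function of `B(c,b)` for `b > x`
and of `D(c,b)` for `b ≤ x`. Both `b`-derivatives are nonnegative multiples of the same strictly
decreasing function `optFun`, so a positive zero of `optFun` is the unique maximizer, whatever `x`
is (`argmaxThreshold_eq`). To leading order `w * optFun` is a positive multiple of `(K - b) w`, so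
such a zero exists for large `c` and tends to `K`.

Zero of `C₀`. Both quotients in `C₀` are ratios of exponential polynomials in `z - y = t`. At the
optimal threshold the coefficient of the dominant term `E₁²` vanishes (`opt_identity`). After
removal of a positive factor (`C0_eq`) what remains is `e^{wt} + κ - λ t + γ e^{-At} (λ' e^{-wt} -
w)`, the `profile`. For large `c`, `λ = w + O(w⁴)` and `κ = -1 - K²w²/(2a) + m₁w³ + O(w⁴)`
(`core_expansions`), while the last term is a boundary layer, exponentially small away from `t = 0`.
Hence the profile is about `w² (t² - K²/a)/2`, with zero near `K/√a`. It is negative up to `δ =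
K/(2√a)`, convex from `δ` on and positive at `2K/√a` (`profile_eventually`), so its zero in `(0, ∞)`
is unique.

Expansion and smoothness. The trial point `approxDist` makes the profile `O(w⁴)`. The profile at `δ`
is at most a negative multiple of `w²`, so convexity places the true zero within `O(w²)` of the
trial point (`existsUnique_zero_of_convexOn`). Adding the expansion of the threshold and using `w =
q/c + O(1/c²)` gives the claim. Smoothness follows from the implicit function theorem, used once for
the threshold and once for the zero; uniqueness identifies the implicit branch with the function at
hand. -/

noncomputable section

namespace DrawdownDividends

/-! ### The characteristic roots: Vieta relations, derivatives, monotonicity. -/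

section Roots

variable {μ σ q : ℝ}

lemma discriminant_pos (hσ : 0 < σ) (hq : 0 < q) (r : ℝ) :
    0 < (r - μ) ^ 2 + 2 * q * σ ^ 2 := by positivity

lemma abs_lt_sqrt_discriminant (hσ : 0 < σ) (hq : 0 < q) (r : ℝ) :
    |r - μ| < Real.sqrt ((r - μ) ^ 2 + 2 * q * σ ^ 2) := by
  rw [← Real.sqrt_sq_eq_abs]
  apply Real.sqrt_lt_sqrt (sq_nonneg _)
  have : 0 < 2 * q * σ ^ 2 := by positivity
  linarith

lemma theta1_pos (hσ : 0 < σ) (hq : 0 < q) (r : ℝ) : 0 < theta1 μ σ q r := by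
  have h := abs_lt_sqrt_discriminant (μ := μ) hσ hq r
  have := neg_abs_le (r - μ)
  unfold theta1
  apply div_pos _ (by positivity)
  linarith

lemma theta2_neg (hσ : 0 < σ) (hq : 0 < q) (r : ℝ) : theta2 μ σ q r < 0 := by
  have h := abs_lt_sqrt_discriminant (μ := μ) hσ hq r
  have := le_abs_self (r - μ)
  unfold theta2
  apply div_neg_of_neg_of_pos _ (by positivity)
  linarith

lemma theta1_add_theta2 (r : ℝ) :
    theta1 μ σ q r + theta2 μ σ q r = 2 / σ ^ 2 * (r - μ) := by
  unfold theta1 theta2; ring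

lemma theta1_sub_theta2 (r : ℝ) :
    theta1 μ σ q r - theta2 μ σ q r
      = 2 / σ ^ 2 * Real.sqrt ((r - μ) ^ 2 + 2 * q * σ ^ 2) := by
  unfold theta1 theta2; ring

/-- The product does not depend on `r`, so each positive root is `p` divided by the modulus of the
negative one, at rate `c` as well as at rate `ac`. -/
lemma theta1_mul_theta2 (hσ : 0 < σ) (hq : 0 < q) (r : ℝ) :
    theta1 μ σ q r * theta2 μ σ q r = -(2 * q / σ ^ 2) := by
  have h := Real.sq_sqrt (discriminant_pos (μ := μ) hσ hq r).le
  unfold theta1 theta2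
  field_simp
  linear_combination -h

lemma contDiff_sqrt_discriminant (hσ : 0 < σ) (hq : 0 < q) {n : WithTop ℕ∞} :
    ContDiff ℝ n (fun r : ℝ => Real.sqrt ((r - μ) ^ 2 + 2 * q * σ ^ 2)) := by
  apply ContDiff.sqrt
  · fun_prop
  · intro r
    exact (discriminant_pos hσ hq r).ne'

lemma contDiff_theta1 (hσ : 0 < σ) (hq : 0 < q) {n : WithTop ℕ∞} :
    ContDiff ℝ n (theta1 μ σ q) := by
  have := contDiff_sqrt_discriminant (μ := μ) hσ hq (n := n)
  unfold theta1
  fun_prop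

lemma contDiff_theta2 (hσ : 0 < σ) (hq : 0 < q) {n : WithTop ℕ∞} :
    ContDiff ℝ n (theta2 μ σ q) := by
  have := contDiff_sqrt_discriminant (μ := μ) hσ hq (n := n)
  unfold theta2
  fun_prop

lemma hasDerivAt_sqrt_discriminant (hσ : 0 < σ) (hq : 0 < q) (r : ℝ) :
    HasDerivAt (fun r : ℝ => Real.sqrt ((r - μ) ^ 2 + 2 * q * σ ^ 2))
      ((r - μ) / Real.sqrt ((r - μ) ^ 2 + 2 * q * σ ^ 2)) r := by
  have h : HasDerivAt (fun r : ℝ => (r - μ) ^ 2 + 2 * q * σ ^ 2) (2 * (r - μ)) r := by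
    have := (((hasDerivAt_id r).sub_const μ).pow 2).add_const (2 * q * σ ^ 2)
    simpa using this
  convert h.sqrt (discriminant_pos hσ hq r).ne' using 1
  rw [mul_div_mul_left _ _ (by norm_num)]

/-- Written through the roots alone, the derivative contains no square root, so the later identities
become rational algebra. -/
lemma theta1'_eq (hσ : 0 < σ) (hq : 0 < q) (r : ℝ) :
    theta1' μ σ q r
      = 2 / σ ^ 2 * theta1 μ σ q r / (theta1 μ σ q r - theta2 μ σ q r) := by
  have h := ((((hasDerivAt_id r).sub_const μ).add
    (hasDerivAt_sqrt_discriminant (μ := μ) hσ hq r)).div_const (σ ^ 2)).deriv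
  have hs := Real.sqrt_pos.2 (discriminant_pos (μ := μ) hσ hq r)
  rw [theta1_sub_theta2, theta1']
  refine h.trans ?_
  simp only [theta1]
  field_simp
  ring

lemma theta2'_eq (hσ : 0 < σ) (hq : 0 < q) (r : ℝ) :
    theta2' μ σ q r
      = -(2 / σ ^ 2 * theta2 μ σ q r / (theta1 μ σ q r - theta2 μ σ q r)) := by
  have h := ((((hasDerivAt_id r).sub_const μ).sub
    (hasDerivAt_sqrt_discriminant (μ := μ) hσ hq r)).div_const (σ ^ 2)).deriv
  have hs := Real.sqrt_pos.2 (discriminant_pos (μ := μ) hσ hq r)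
  rw [theta1_sub_theta2, theta2']
  refine h.trans ?_
  simp only [theta2]
  field_simp
  ring

lemma theta2_lt_theta1 (hσ : 0 < σ) (hq : 0 < q) (r : ℝ) :
    theta2 μ σ q r < theta1 μ σ q r :=
  (theta2_neg hσ hq r).trans (theta1_pos hσ hq r)

lemma theta2_strictMono (hσ : 0 < σ) (hq : 0 < q) : StrictMono (theta2 μ σ q) := by
  apply strictMono_of_deriv_pos
  intro r
  have h : deriv (theta2 μ σ q) r = theta2' μ σ q r := rfl
  rw [h, theta2'_eq hσ hq, ← neg_div]
  have h1 := theta2_neg (μ := μ) hσ hq r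
  have h2 := theta2_lt_theta1 (μ := μ) hσ hq r
  apply div_pos _ (by linarith)
  have : 0 < 2 / σ ^ 2 := by positivity
  nlinarith

lemma theta1_strictMono (hσ : 0 < σ) (hq : 0 < q) : StrictMono (theta1 μ σ q) := by
  apply strictMono_of_deriv_pos
  intro r
  have h : deriv (theta1 μ σ q) r = theta1' μ σ q r := rfl
  rw [h, theta1'_eq hσ hq]
  have h1 := theta1_pos (μ := μ) hσ hq r
  have h2 := theta2_lt_theta1 (μ := μ) hσ hq r
  have : 0 < 2 / σ ^ 2 := by positivity
  exact div_pos (by positivity) (by linarith)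

end Roots

/-! ### Rational identities behind the numerator of `C₀`. -/

section Core

/-! Normalized coefficients. With `A = θ₁(c)`, `w = -θ₂(c)`, `l = θ₁(a c)`, `u = -θ₂(a c)`,
`F = exp (-u y)`, `e = exp (-(l + u) y)` and `C = 2 c / σ²`, the functions below are the
coefficients of `d`, `b₁₁`, `b₀₁` and of the numerator of `C₀`, divided by powers of
`exp (l y)`. -/

def coreAlpha (w l u e : ℝ) : ℝ := l + w + e * (u - w)

def coreBeta (A l u e : ℝ) : ℝ := A - l - e * (A + u)

def coreB11 (A w l u e : ℝ) : ℝ := (A + w) * ((A - l) * (l + w) + e * (u - w) * (u + A))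

def coreB01 (a C A w u F : ℝ) : ℝ :=
  C * (A + w) * (a * F * u * (u + A - w) - (1 - a + a * F) * w * A)

def coreRho (a A u F : ℝ) : ℝ := (1 - a + a * F) * A + a * F * u

def corePi (a w u F : ℝ) : ℝ := -((1 - a + a * F) * w) + a * F * u

def coreEta (a C A w l u e F : ℝ) : ℝ :=
  C * (A + w) * w * (a * F * u * (u + A) * coreBeta A l u e
    + coreRho a A u F * ((A - l) * l + e * (A + u) * u))

def coreX (a l u e F : ℝ) : ℝ := (1 - a + a * F) * (l + e * u) + a * F * u * (1 - e)

/-- Comes from the cross determinant that multiplies `E₁ E₂` in the derivative of `b₁₀ / d`;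
`corePay` plays the same role for `b₀₀ / d`. -/
def coreSlope (a A w l u e y : ℝ) : ℝ :=
  (1 - e) * ((l + e * u) * (A - w) + 2 * A * w * (1 - e))
    - a * (A + w) ^ 2 / (l + u) * (l * (1 - e - y * e * (l + u))
      - e * u * (1 - e - y * (l + u)))

def corePay (a C A w l u e F y : ℝ) : ℝ :=
  -((A + w) ^ 2 * coreX a l u e F)
    - C * (1 - a + a * F) * ((l + e * u) * (A - w) + 2 * A * w * (1 - e))
    + a ^ 2 * C * (A + w) ^ 2 * F * (u / (l + u)) * (1 - e - y * (l + u))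
    + C * (A - w) * coreX a l u e F

def coreKappa (a C A w l u e F y : ℝ) : ℝ :=
  coreEta a C A w l u e F * coreAlpha w l u e
    + (A + w) * (coreB11 A w l u e * corePay a C A w l u e F y
      - coreB01 a C A w u F * coreSlope a A w l u e y)

/-- The optimality condition of the threshold, up to a positive factor. -/
def coreOpt (a w l u e F : ℝ) : ℝ :=
  a * F * u * (u - w) * coreAlpha w l u e + corePi a w u F * ((l + w) * l - e * u * (u - w))

def coreK1 (A w l u e : ℝ) : ℝ := (A + w) ^ 2 * coreB11 A w l u e * A * coreAlpha w l u e

/-- The numerator of `C₀` at `z = y + t`, up to a positive factor. -/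
def coreNum (a C A w l u e F y t : ℝ) : ℝ :=
  coreK1 A w l u e * Real.exp (w * t) + coreKappa a C A w l u e F y
    - (A + w) * coreEta a C A w l u e F * coreAlpha w l u e * t
    + coreBeta A l u e * Real.exp (-(A * t)) *
      (coreEta a C A w l u e F * Real.exp (-(w * t)) - w * (A + w) ^ 2 * coreB11 A w l u e)

variable {a c s A w l u e F F₁ y : ℝ}

lemma slope_identity (hΛ : l + u ≠ 0) (hΔ : A + w ≠ 0) (hF : F = e * F₁) :
    ((A + w) * ((F₁ - F) * (s * w / (A + w)) - a * F₁ * (s * l / (l + u)) * (1 + y * (l + w))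
          + a * F * (s * u / (l + u)) * (1 + y * (w - u)))
        + (s * A / (A + w) - s * w / (A + w)) * (F₁ * coreAlpha w l u e))
        * (F₁ * coreBeta A l u e)
      - (-((A + w) * ((F₁ - F) * (s * A / (A + w))
            - a * F₁ * (s * l / (l + u)) * (1 + y * (l - A))
            + a * F * (s * u / (l + u)) * (1 + y * (-u - A))))
          + (s * A / (A + w) - s * w / (A + w)) * (F₁ * coreBeta A l u e))
        * (F₁ * coreAlpha w l u e)
      = s * F₁ ^ 2 * coreSlope a A w l u e y := by
  subst hF
  unfold coreAlpha coreBeta coreSlope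
  field_simp
  ring

lemma pay_identity (hΛ : l + u ≠ 0) (hΔ : A + w ≠ 0) (hF : F = e * F₁) :
    ((A + w) * (-corePi a w u F - c * (1 - a + a * F) * (s * w / (A + w))
          + a ^ 2 * c * F * (s * u / (l + u)) * (1 + y * (w - u)))
        + c * (s * A / (A + w) - s * w / (A + w)) * corePi a w u F)
        * (F₁ * coreBeta A l u e)
      - ((A + w) * (coreRho a A u F + c * (1 - a + a * F) * (s * A / (A + w))
            - a ^ 2 * c * F * (s * u / (l + u)) * (1 + y * (-u - A)))
          - c * (s * A / (A + w) - s * w / (A + w)) * coreRho a A u F)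
        * (F₁ * coreAlpha w l u e)
      = F₁ * corePay a (c * s) A w l u e F y := by
  unfold coreAlpha coreBeta corePay coreX corePi coreRho
  subst hF
  field_simp
  ring

/-- The left side is the factor left in the coefficient of `E₁²` in the combined numerator once `α`
is taken out. It is a multiple of the optimality condition, which is why `C₀` is evaluated at the
optimal threshold. -/
lemma opt_identity (hF : F = e * F₁) :
    F₁ * coreB11 A w l u e * -(c * (A + w) * corePi a w u F * (s * A / (A + w)))
      - c * (A + w) * (a * F * u * (u + A - w) - (1 - a + a * F) * w * A)
        * -((A + w) * (s * A / (A + w)) * (F₁ * coreAlpha w l u e))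
      = c * (A + w) ^ 2 * (s * A / (A + w)) * F₁ * coreOpt a w l u e F := by
  unfold coreAlpha coreB11 coreOpt corePi coreAlpha
  subst hF
  ring

/-- The same combination for `E₂²`; it does not vanish and supplies the coefficient of the term
linear in `t`. -/
lemma eta_identity (hΔ : A + w ≠ 0) (hF : F = e * F₁) :
    F₁ * coreB11 A w l u e * (c * (A + w) * coreRho a A u F * (s * w / (A + w)))
      - c * (A + w) * (a * F * u * (u + A - w) - (1 - a + a * F) * w * A)
        * -((A + w) * (s * w / (A + w)) * (F₁ * coreBeta A l u e))
      = F₁ * coreEta a (c * s) A w l u e F := by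
  unfold coreB11 coreEta coreRho coreBeta
  subst hF
  field_simp
  ring

lemma hasDerivAt_exp_mul_affine (y B g₀ g₁ z : ℝ) :
    HasDerivAt (fun x => Real.exp ((x - y) * B) * (g₀ + g₁ * (x - y)))
      (Real.exp ((z - y) * B) * (g₁ + B * (g₀ + g₁ * (z - y)))) z := by
  have h0 := (hasDerivAt_id z).sub_const y
  have h1 := (h0.mul_const B).exp
  have h2 := (h0.const_mul g₁).const_add g₀
  have h3 := h1.mul h2
  refine h3.congr_deriv ?_
  simp only [id]
  ring

/-- Derivative of a quotient of exponential polynomials with two exponents. -/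
lemma hasDerivAt_expPoly_div (y A₁ A₂ k p₀ p₁ r₀ r₁ α β z : ℝ)
    (hd : Real.exp ((z - y) * A₁) * α + Real.exp ((z - y) * A₂) * β ≠ 0) :
    HasDerivAt (fun x => (k + Real.exp ((x - y) * A₁) * (p₀ + p₁ * (x - y))
        + Real.exp ((x - y) * A₂) * (r₀ + r₁ * (x - y))) /
        (Real.exp ((x - y) * A₁) * α + Real.exp ((x - y) * A₂) * β))
      ((-k * (A₁ * α * Real.exp ((z - y) * A₁) + A₂ * β * Real.exp ((z - y) * A₂))
        + α * p₁ * Real.exp ((z - y) * A₁) ^ 2 + β * r₁ * Real.exp ((z - y) * A₂) ^ 2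
        + Real.exp ((z - y) * A₁) * Real.exp ((z - y) * A₂) *
          (p₁ * β + r₁ * α + (A₁ - A₂) * (p₀ * β - r₀ * α)
            + (A₁ - A₂) * (z - y) * (p₁ * β - r₁ * α))) /
        (Real.exp ((z - y) * A₁) * α + Real.exp ((z - y) * A₂) * β) ^ 2) z := by
  have h1 := (((hasDerivAt_exp_mul_affine y A₁ p₀ p₁ z).const_add k).add
    (hasDerivAt_exp_mul_affine y A₂ r₀ r₁ z))
  have h2 := (hasDerivAt_exp_mul_affine y A₁ α 0 z).add (hasDerivAt_exp_mul_affine y A₂ β 0 z)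
  simp only [zero_mul, add_zero, zero_add] at h2
  refine (h1.div h2 hd).congr_deriv ?_
  congr 1
  simp only [Pi.add_apply]
  ring

end Core

/-! ### Factorization of `C₀` at an optimal threshold. -/

section Numerator

variable {μ σ q a c y t : ℝ}

lemma C0_eq (hσ : 0 < σ) (hq : 0 < q) {A w l u e F F₁ : ℝ}
    (hA : A = theta1 μ σ q c) (hw : w = -theta2 μ σ q c)
    (hl : l = theta1 μ σ q (a * c)) (hu : u = -theta2 μ σ q (a * c))
    (hF₁ : F₁ = Real.exp (y * l)) (hF : F = Real.exp (-(y * u))) (he : F = e * F₁)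
    (hopt : coreOpt a w l u e F = 0)
    (hd : 0 < Real.exp (t * A) * coreAlpha w l u e + Real.exp (-(t * w)) * coreBeta A l u e) :
    C0 μ σ q a y (y + t) c = Real.exp (t * A) * Real.exp (-(t * w)) /
      (Real.exp (t * A) * coreAlpha w l u e + Real.exp (-(t * w)) * coreBeta A l u e) ^ 2
      * coreNum a (c * (2 / σ ^ 2)) A w l u e F y t := by
  set s : ℝ := 2 / σ ^ 2 with hs
  have hA0 : 0 < A := hA ▸ theta1_pos hσ hq c
  have hw0 : 0 < w := by rw [hw]; linarith [theta2_neg (μ := μ) hσ hq c]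
  have hl0 : 0 < l := hl ▸ theta1_pos hσ hq _
  have hu0 : 0 < u := by rw [hu]; linarith [theta2_neg (μ := μ) hσ hq (a * c)]
  have hΔ : A + w ≠ 0 := by positivity
  have hΛ : l + u ≠ 0 := by positivity
  have hF₁0 : 0 < F₁ := hF₁ ▸ Real.exp_pos _
  have hw' : theta2 μ σ q c = -w := by rw [hw]; ring
  have hu' : theta2 μ σ q (a * c) = -u := by rw [hu]; ring
  have hA' : theta1' μ σ q c = s * A / (A + w) := by
    rw [theta1'_eq hσ hq, ← hA, hw']; ring
  have hB' : theta2' μ σ q c = s * w / (A + w) := by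
    rw [theta2'_eq hσ hq, ← hA, hw']; ring
  have hL' : theta1' μ σ q (a * c) = s * l / (l + u) := by
    rw [theta1'_eq hσ hq, ← hl, hu']; ring
  have hM' : theta2' μ σ q (a * c) = s * u / (l + u) := by
    rw [theta2'_eq hσ hq, ← hl, hu']; ring
  have hFe : Real.exp (y * -u) = F := by rw [hF]; ring_nf
  set A₁' := s * A / (A + w) with hA₁'
  set A₂' := s * w / (A + w) with hA₂'
  set L₁' := s * l / (l + u) with hL₁'
  set L₂' := s * u / (l + u) with hL₂'
  have hb11 : b11 μ σ q a y c = F₁ * coreB11 A w l u e := by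
    simp only [b11, ← hA, ← hl, hw', hu', ← hF₁, hFe]
    unfold coreB11
    rw [he]; ring
  have hb01 : b01 μ σ q a y c
      = c * (A + w) * (a * F * u * (u + A - w) - (1 - a + a * F) * w * A) := by
    simp only [b01, ← hA, hw', hu', hFe]
    ring
  have hdF : ∀ x, dFun μ σ q a y x c
      = Real.exp ((x - y) * A) * (F₁ * coreAlpha w l u e)
        + Real.exp ((x - y) * -w) * (F₁ * coreBeta A l u e) := by
    intro x
    simp only [dFun, ← hA, ← hl, hw', hu', ← hF₁, hFe]
    unfold coreAlpha coreBeta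
    rw [he]; ring
  have hb00 : ∀ x, b00 μ σ q a y x c = -(A + w) ^ 2
      + Real.exp ((x - y) * A) * (((A + w) * (-corePi a w u F - c * (1 - a + a * F) * A₂'
          + a ^ 2 * c * F * L₂' * (1 + y * (w - u))) + c * (A₁' - A₂') * corePi a w u F)
          + -(c * (A + w) * corePi a w u F * A₁') * (x - y))
      + Real.exp ((x - y) * -w) * (((A + w) * (coreRho a A u F + c * (1 - a + a * F) * A₁'
            - a ^ 2 * c * F * L₂' * (1 + y * (-u - A)))
          - c * (A₁' - A₂') * coreRho a A u F)
          + (c * (A + w) * coreRho a A u F * A₂') * (x - y)) := by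
    intro x
    simp only [b00, ← hA, hw', hu', hFe, hA', hB', hM']
    unfold corePi coreRho
    ring
  have hb10 : ∀ x, b10 μ σ q a y x c = 0
      + Real.exp ((x - y) * A) * (((A + w) * ((F₁ - F) * A₂' - a * F₁ * L₁' * (1 + y * (l + w))
          + a * F * L₂' * (1 + y * (w - u))) + (A₁' - A₂') * (F₁ * coreAlpha w l u e))
          + -((A + w) * A₁' * (F₁ * coreAlpha w l u e)) * (x - y))
      + Real.exp ((x - y) * -w) * ((-((A + w) * ((F₁ - F) * A₁'
            - a * F₁ * L₁' * (1 + y * (l - A)) + a * F * L₂' * (1 + y * (-u - A))))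
          + (A₁' - A₂') * (F₁ * coreBeta A l u e))
          + -((A + w) * A₂' * (F₁ * coreBeta A l u e)) * (x - y)) := by
    intro x
    simp only [b10, ← hA, ← hl, hw', hu', ← hF₁, hFe, hA', hB', hL', hM']
    have h1 : F₁ * coreAlpha w l u e = F₁ * (l + w) + F * (u - w) := by
      rw [he]; unfold coreAlpha; ring
    have h2 : F₁ * coreBeta A l u e = F₁ * (A - l) - F * (A + u) := by
      rw [he]; unfold coreBeta; ring
    rw [h1, h2]
    ring
  have hd' : Real.exp ((y + t - y) * A) * (F₁ * coreAlpha w l u e)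
      + Real.exp ((y + t - y) * -w) * (F₁ * coreBeta A l u e) ≠ 0 := by
    have : 0 < F₁ * (Real.exp (t * A) * coreAlpha w l u e
      + Real.exp (-(t * w)) * coreBeta A l u e) := mul_pos hF₁0 hd
    rw [add_sub_cancel_left, mul_neg]
    linarith
  simp only [C0, hdF, hb00, hb10, hb11, hb01]
  rw [(hasDerivAt_expPoly_div _ _ _ _ _ _ _ _ _ _ _ hd').deriv,
    (hasDerivAt_expPoly_div _ _ _ _ _ _ _ _ _ _ _ hd').deriv]
  have i1 := slope_identity (a := a) (s := s) (y := y) hΛ hΔ he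
  have i2 := pay_identity (a := a) (c := c) (s := s) (y := y) hΛ hΔ he
  have i3 := opt_identity (a := a) (A := A) (w := w) (l := l) (u := u) (c := c) (s := s) he
  have i4 := eta_identity (a := a) (l := l) (u := u) (c := c) (s := s) hΔ he
  -- Optimality removes the `E₁²` contribution, including its share of the terms linear in `t`.
  rw [hopt, mul_zero] at i3
  rw [← hA₁', ← hA₂', ← hL₁', ← hL₂'] at i1
  rw [← hA₁', ← hA₂', ← hL₂'] at i2
  rw [← hA₁'] at i3
  rw [← hA₂'] at i4
  have hEw : Real.exp (w * t) * Real.exp (-(t * w)) = 1 := by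
    rw [← Real.exp_add]; ring_nf; exact Real.exp_zero
  have hEA : Real.exp (-(A * t)) * Real.exp (t * A) = 1 := by
    rw [← Real.exp_add]; ring_nf; exact Real.exp_zero
  have hEw2 : Real.exp (-(w * t)) = Real.exp (-(t * w)) := by ring_nf
  rw [add_sub_cancel_left, mul_neg]
  unfold coreNum coreKappa coreK1 coreB01
  rw [hEw2]
  -- From here on only `W E₂ = 1`, `V E₁ = 1` and the four identities matter; with all other
  -- quantities as atoms the goal is a polynomial identity.
  generalize Real.exp (w * t) = W at *
  generalize Real.exp (-(t * w)) = E₂ at *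
  generalize Real.exp (-(A * t)) = V at *
  generalize Real.exp (t * A) = E₁ at *
  generalize (A + w) * (-corePi a w u F - c * (1 - a + a * F) * A₂'
          + a ^ 2 * c * F * L₂' * (1 + y * (w - u))) + c * (A₁' - A₂') * corePi a w u F = p₀ at *
  generalize (A + w) * (coreRho a A u F + c * (1 - a + a * F) * A₁'
            - a ^ 2 * c * F * L₂' * (1 + y * (-u - A)))
          - c * (A₁' - A₂') * coreRho a A u F = r₀ at *
  generalize (A + w) * ((F₁ - F) * A₂' - a * F₁ * L₁' * (1 + y * (l + w))
          + a * F * L₂' * (1 + y * (w - u))) + (A₁' - A₂') * (F₁ * coreAlpha w l u e) = s₀ at *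
  generalize -((A + w) * ((F₁ - F) * A₁'
            - a * F₁ * L₁' * (1 + y * (l - A)) + a * F * L₂' * (1 + y * (-u - A))))
          + (A₁' - A₂') * (F₁ * coreBeta A l u e) = u₀ at *
  generalize c * (A + w) * corePi a w u F * A₁' = p₁ at *
  generalize c * (A + w) * coreRho a A u F * A₂' = r₁ at *
  generalize coreEta a (c * s) A w l u e F = η at *
  generalize corePay a (c * s) A w l u e F y = π₀ at *
  generalize coreSlope a A w l u e y = s₁ at *
  generalize coreAlpha w l u e = α at *
  generalize coreBeta A l u e = β at *
  generalize coreB11 A w l u e = b at *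
  generalize hB : a * F * u * (u + A - w) - (1 - a + a * F) * w * A = B at *
  have hD : E₁ * (F₁ * α) + E₂ * (F₁ * β) = F₁ * (E₁ * α + E₂ * β) := by ring
  rw [hD, ← mul_div_assoc, ← mul_div_assoc, ← sub_div, mul_pow, div_mul_eq_mul_div,
    div_eq_div_iff (by positivity) (by positivity)]
  linear_combination (E₁ * α + E₂ * β) ^ 2 * ((F₁ * α * E₁ ^ 2 + E₁ * E₂ * F₁ * β
      + E₁ * E₂ * (A + w) * t * F₁ * β) * i3
    + (F₁ * β * E₂ ^ 2 + E₁ * E₂ * F₁ * α - E₁ * E₂ * (A + w) * t * F₁ * α) * i4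
    + E₁ * E₂ * (A + w) * (F₁ * b) * i2 - E₁ * E₂ * (A + w) * (c * (A + w) * B) * i1
    - F₁ ^ 2 * E₁ * (A + w) ^ 2 * b * A * α * hEw
    - F₁ ^ 2 * E₂ * β * (η * E₂ - w * (A + w) ^ 2 * b) * hEA)

end Numerator

/-! ### The optimal threshold: dependence of the value on `b`. -/

section Threshold

/-- The optimality condition as a function of the threshold `b`. -/
def optFun (a w l u b : ℝ) : ℝ :=
  coreOpt a w l u (Real.exp (-((l + u) * b))) (Real.exp (-(u * b)))

/-- In this form the coefficients of `F` and `e` are both positive when `w < u`, and both are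
decaying exponentials in `b`; strict monotonicity of `optFun` is then immediate. -/
lemma coreOpt_eq (a w l u e F : ℝ) :
    coreOpt a w l u e F = a * F * (u - w) * (l + w) * (l + u)
      - (1 - a) * w * ((l + w) * l - e * u * (u - w)) := by
  unfold coreOpt corePi coreAlpha
  ring

lemma optFun_strictAnti {a w l u : ℝ} (ha0 : 0 < a) (ha1 : a < 1) (hw : 0 < w) (hl : 0 < l)
    (huw : w < u) : StrictAnti (optFun a w l u) := by
  intro b b' hb
  have hu : 0 < u := hw.trans huw
  simp only [optFun, coreOpt_eq]
  have h1 : Real.exp (-(u * b')) < Real.exp (-(u * b)) := by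
    apply Real.exp_lt_exp.2; nlinarith
  have h2 : Real.exp (-((l + u) * b')) < Real.exp (-((l + u) * b)) := by
    apply Real.exp_lt_exp.2; nlinarith
  have h3 : 0 < a * (u - w) * (l + w) * (l + u) := by
    have : 0 < u - w := by linarith
    positivity
  have h4 : 0 < (1 - a) * w * u * (u - w) := by
    have : 0 < u - w := by linarith
    have : 0 < 1 - a := by linarith
    positivity
  nlinarith [mul_lt_mul_of_pos_left h1 h3, mul_lt_mul_of_pos_left h2 h4]

lemma W0_hasDerivAt (μ σ q a c b : ℝ) :
    HasDerivAt (fun x => W0 μ σ q a x c)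
      ((theta1 μ σ q (a * c) * Real.exp (theta1 μ σ q (a * c) * b)
        - theta2 μ σ q (a * c) * Real.exp (theta2 μ σ q (a * c) * b)) /
        Real.sqrt ((μ - a * c) ^ 2 + 2 * q * σ ^ 2)) b := by
  have h := fun k : ℝ => ((hasDerivAt_id b).const_mul k).exp
  have h1 := ((h (theta1 μ σ q (a * c))).sub (h (theta2 μ σ q (a * c)))).div_const
    (Real.sqrt ((μ - a * c) ^ 2 + 2 * q * σ ^ 2))
  refine h1.congr_deriv ?_
  simp only [id]
  ring

variable {μ σ q a c : ℝ}

lemma W0_pos (hσ : 0 < σ) (hq : 0 < q) {x : ℝ} (hx : 0 < x) : 0 < W0 μ σ q a x c := by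
  unfold W0
  apply div_pos _ (Real.sqrt_pos.2 (by positivity))
  have h := theta2_lt_theta1 (μ := μ) hσ hq (a * c)
  rw [sub_pos]
  apply Real.exp_lt_exp.2
  exact mul_lt_mul_of_pos_right h hx

/-- The last conjunct clears the denominator of `B`; it is what makes the derivative of `D` collapse
to a multiple of that of `B`. -/
lemma coeffB_hasDerivAt (hσ : 0 < σ) (hq : 0 < q) (hac : a * c < c) (b : ℝ) :
    ∃ m : ℝ, 0 < m ∧ HasDerivAt (coeffB μ σ q a c)
      (c * m * optFun a (-theta2 μ σ q c) (theta1 μ σ q (a * c)) (-theta2 μ σ q (a * c)) b) b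
      ∧ coeffB μ σ q a c b *
        (deriv (fun x => W0 μ σ q a x c) b - theta2 μ σ q c * W0 μ σ q a b c)
        = (1 / q) * (a * c * Real.exp (theta2 μ σ q (a * c) * b)
            * (theta2 μ σ q (a * c) - theta2 μ σ q c) - (1 - a) * c * theta2 μ σ q c) := by
  have hw0 := theta2_neg (μ := μ) hσ hq c
  have hl0 := theta1_pos (μ := μ) hσ hq (a * c)
  have hu0 := theta2_strictMono (μ := μ) hσ hq hac
  have hR : 0 < Real.sqrt ((μ - a * c) ^ 2 + 2 * q * σ ^ 2) := Real.sqrt_pos.2 (by positivity)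
  have hM : (fun b => deriv (fun x => W0 μ σ q a x c) b - theta2 μ σ q c * W0 μ σ q a b c)
      = fun b => ((theta1 μ σ q (a * c) - theta2 μ σ q c) * Real.exp (theta1 μ σ q (a * c) * b)
        - (theta2 μ σ q (a * c) - theta2 μ σ q c) * Real.exp (theta2 μ σ q (a * c) * b)) /
        Real.sqrt ((μ - a * c) ^ 2 + 2 * q * σ ^ 2) := by
    funext b
    rw [(W0_hasDerivAt μ σ q a c b).deriv, W0]
    ring
  have hMb := congrFun hM b
  have hB : coeffB μ σ q a c = fun b => (1 / q) *
      ((a * c * Real.exp (theta2 μ σ q (a * c) * b) * (theta2 μ σ q (a * c) - theta2 μ σ q c)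
        - (1 - a) * c * theta2 μ σ q c) /
      (((theta1 μ σ q (a * c) - theta2 μ σ q c) * Real.exp (theta1 μ σ q (a * c) * b)
        - (theta2 μ σ q (a * c) - theta2 μ σ q c) * Real.exp (theta2 μ σ q (a * c) * b)) /
        Real.sqrt ((μ - a * c) ^ 2 + 2 * q * σ ^ 2))) := by
    funext b
    rw [← congrFun hM b, coeffB]
  rw [hMb, hB]
  simp only [optFun, coreOpt_eq]
  generalize theta2 μ σ q (a * c) = L₂ at *
  generalize theta1 μ σ q (a * c) = L₁ at *
  generalize theta2 μ σ q c = A₂ at *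
  generalize Real.sqrt ((μ - a * c) ^ 2 + 2 * q * σ ^ 2) = R at *
  have hMpos : 0 < (L₁ - A₂) * Real.exp (L₁ * b) - (L₂ - A₂) * Real.exp (L₂ * b) := by
    have h1 : 0 < (L₁ - A₂) * Real.exp (L₁ * b) :=
      mul_pos (by linarith) (Real.exp_pos _)
    have h2 : 0 < (A₂ - L₂) * Real.exp (L₂ * b) :=
      mul_pos (by linarith) (Real.exp_pos _)
    linarith
  have he := fun k : ℝ => ((hasDerivAt_id b).const_mul k).exp
  have hN := (((he L₂).const_mul (a * c)).mul_const (L₂ - A₂)).sub_const ((1 - a) * c * A₂)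
  have hD := (((he L₁).const_mul (L₁ - A₂)).sub ((he L₂).const_mul (L₂ - A₂))).div_const R
  have hne : ((L₁ - A₂) * Real.exp (L₁ * b) - (L₂ - A₂) * Real.exp (L₂ * b)) / R ≠ 0 :=
    (div_pos hMpos hR).ne'
  have hQ := (hN.div hD hne).const_mul (1 / q)
  refine ⟨1 / q * Real.exp (L₁ * b) * R /
    ((L₁ - A₂) * Real.exp (L₁ * b) - (L₂ - A₂) * Real.exp (L₂ * b)) ^ 2, by positivity,
    hQ.congr_deriv ?_, ?_⟩
  · have h1 : Real.exp (-((L₁ + -L₂) * b)) = Real.exp (L₂ * b) / Real.exp (L₁ * b) := by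
      rw [← Real.exp_sub]; ring_nf
    have h2 : Real.exp (-(-L₂ * b)) = Real.exp (L₂ * b) := by ring_nf
    rw [h1, h2]
    simp only [id, Pi.sub_apply]
    have h3 := Real.exp_pos (L₁ * b)
    generalize Real.exp (L₁ * b) = F₁ at *
    generalize Real.exp (L₂ * b) = F₂ at *
    have hM' := hMpos.ne'
    field_simp
    ring
  · rw [mul_assoc, div_mul_cancel₀ _ hne]

/-- Differentiating `D` with `B` held fixed gives zero by the defining relation of `B`, so `D' = B'
W₀ e^{-θ₂(c) b}`. The factor `W₀` vanishes at `b = 0`, hence positivity of `m` only for `0 < b`. -/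
lemma coeffD_hasDerivAt (hσ : 0 < σ) (hq : 0 < q) (hac : a * c < c) (b : ℝ) :
    ∃ m : ℝ, (0 < b → 0 < m) ∧ HasDerivAt (coeffD μ σ q a c)
      (c * m * optFun a (-theta2 μ σ q c) (theta1 μ σ q (a * c)) (-theta2 μ σ q (a * c)) b) b := by
  obtain ⟨m, hm, hB, hBM⟩ := coeffB_hasDerivAt (μ := μ) hσ hq hac b
  refine ⟨m * (W0 μ σ q a b c * Real.exp (-(theta2 μ σ q c * b))), fun h =>
    mul_pos hm (mul_pos (W0_pos hσ hq h) (Real.exp_pos _)), ?_⟩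
  have he := fun k : ℝ => ((hasDerivAt_id b).const_mul k).exp
  have he' := ((hasDerivAt_id b).const_mul (theta2 μ σ q c)).neg.exp
  have hW := (W0_hasDerivAt μ σ q a c b).differentiableAt.hasDerivAt
  have h1 := (((hB.mul he').mul hW).sub
    ((he (theta2 μ σ q (a * c) - theta2 μ σ q c)).const_mul (a * c / q))).sub
    (he'.const_mul ((1 - a) * c / q))
  refine h1.congr_deriv ?_
  simp only [id, Pi.mul_apply, Pi.neg_apply]
  have h2 : Real.exp ((theta2 μ σ q (a * c) - theta2 μ σ q c) * b)
      = Real.exp (theta2 μ σ q (a * c) * b) * Real.exp (-(theta2 μ σ q c * b)) := by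
    rw [← Real.exp_add]; ring_nf
  rw [h2]
  linear_combination Real.exp (-(theta2 μ σ q c * b)) * hBM

/-- The two branches agree at `b = x`, so that point may be counted with either one. -/
lemma value_at_threshold (x : ℝ) :
    c / q + coeffD μ σ q a c x * Real.exp (theta2 μ σ q c * x)
      = coeffB μ σ q a c x * W0 μ σ q a x c
        + a * c / q * (1 - Real.exp (theta2 μ σ q (a * c) * x)) := by
  have h1 : Real.exp (-(theta2 μ σ q c * x)) * Real.exp (theta2 μ σ q c * x) = 1 := by
    rw [← Real.exp_add]; simp
  have h2 : Real.exp ((theta2 μ σ q (a * c) - theta2 μ σ q c) * x)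
      * Real.exp (theta2 μ σ q c * x) = Real.exp (theta2 μ σ q (a * c) * x) := by
    rw [← Real.exp_add]; ring_nf
  unfold coeffD
  linear_combination (coeffB μ σ q a c x * W0 μ σ q a x c - (1 - a) * c / q) * h1
    - a * c / q * h2

lemma refractingValue_of_le {x b : ℝ} (h : b ≤ x) : refractingValue μ σ q a x c b
    = c / q + coeffD μ σ q a c b * Real.exp (theta2 μ σ q c * x) := by
  rw [refractingValue, if_neg h.not_gt]

lemma refractingValue_of_ge {x b : ℝ} (h : x ≤ b) : refractingValue μ σ q a x c b
    = coeffB μ σ q a c b * W0 μ σ q a x c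
      + a * c / q * (1 - Real.exp (theta2 μ σ q (a * c) * x)) := by
  rcases h.lt_or_eq with h | rfl
  · rw [refractingValue, if_pos h]
  · rw [refractingValue_of_le le_rfl, value_at_threshold]

lemma argmaxThreshold_eq (hσ : 0 < σ) (hq : 0 < q) (ha0 : 0 < a) (ha1 : a < 1) (hc : 0 < c)
    {b₀ : ℝ} (hb₀ : 0 < b₀)
    (h : optFun a (-theta2 μ σ q c) (theta1 μ σ q (a * c)) (-theta2 μ σ q (a * c)) b₀ = 0)
    {x : ℝ} (hx : 0 < x) : argmaxThreshold μ σ q a x c = {b₀} := by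
  have hac : a * c < c := by nlinarith
  have hw0 := theta2_neg (μ := μ) hσ hq c
  have hl0 := theta1_pos (μ := μ) hσ hq (a * c)
  have hu0 := theta2_strictMono (μ := μ) hσ hq hac
  have hanti := optFun_strictAnti ha0 ha1 (neg_pos.2 hw0) hl0 (neg_lt_neg hu0)
  set g := optFun a (-theta2 μ σ q c) (theta1 μ σ q (a * c)) (-theta2 μ σ q (a * c)) with hg
  have hgpos : ∀ b, b < b₀ → 0 < g b := fun b hb => h ▸ hanti hb
  have hgneg : ∀ b, b₀ < b → g b < 0 := fun b hb => h ▸ hanti hb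
  have hBc : ContinuousOn (coeffB μ σ q a c) (Set.Ici 0) := fun b hb => by
    obtain ⟨m, -, hB, -⟩ := coeffB_hasDerivAt (μ := μ) hσ hq hac b
    exact hB.continuousAt.continuousWithinAt
  have hDc : ContinuousOn (coeffD μ σ q a c) (Set.Ici 0) := fun b hb => by
    obtain ⟨m, -, hB⟩ := coeffD_hasDerivAt (μ := μ) hσ hq hac b
    exact hB.continuousAt.continuousWithinAt
  have hB1 : StrictMonoOn (coeffB μ σ q a c) (Set.Icc 0 b₀) := by
    apply strictMonoOn_of_deriv_pos (convex_Icc _ _) (hBc.mono Set.Icc_subset_Ici_self)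
    intro b hb
    rw [interior_Icc] at hb
    obtain ⟨m, hm, hB, -⟩ := coeffB_hasDerivAt (μ := μ) hσ hq hac b
    rw [hB.deriv]
    exact mul_pos (mul_pos hc hm) (hgpos b hb.2)
  have hD1 : StrictMonoOn (coeffD μ σ q a c) (Set.Icc 0 b₀) := by
    apply strictMonoOn_of_deriv_pos (convex_Icc _ _) (hDc.mono Set.Icc_subset_Ici_self)
    intro b hb
    rw [interior_Icc] at hb
    obtain ⟨m, hm, hB⟩ := coeffD_hasDerivAt (μ := μ) hσ hq hac b
    rw [hB.deriv]
    exact mul_pos (mul_pos hc (hm hb.1)) (hgpos b hb.2)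
  have hsub : Set.Ici b₀ ⊆ Set.Ici 0 := Set.Ici_subset_Ici.2 hb₀.le
  have hB2 : StrictAntiOn (coeffB μ σ q a c) (Set.Ici b₀) := by
    apply strictAntiOn_of_deriv_neg (convex_Ici _) (hBc.mono hsub)
    intro b hb
    rw [interior_Ici] at hb
    obtain ⟨m, hm, hB, -⟩ := coeffB_hasDerivAt (μ := μ) hσ hq hac b
    rw [hB.deriv]
    exact mul_neg_of_pos_of_neg (mul_pos hc hm) (hgneg b hb)
  have hD2 : StrictAntiOn (coeffD μ σ q a c) (Set.Ici b₀) := by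
    apply strictAntiOn_of_deriv_neg (convex_Ici _) (hDc.mono hsub)
    intro b hb
    rw [interior_Ici] at hb
    obtain ⟨m, hm, hB⟩ := coeffD_hasDerivAt (μ := μ) hσ hq hac b
    rw [hB.deriv]
    exact mul_neg_of_pos_of_neg (mul_pos hc (hm (hb₀.trans hb))) (hgneg b hb)
  have hW := W0_pos (μ := μ) (a := a) (c := c) hσ hq hx
  have hE := Real.exp_pos (theta2 μ σ q c * x)
  -- For `b ≤ x` the dependence on `b` is through `D`, for `b ≥ x` through `B`; an interval that
  -- contains `x` is split there.
  have key1 : ∀ b b', b < b' → 0 ≤ b → b' ≤ b₀ →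
      refractingValue μ σ q a x c b < refractingValue μ σ q a x c b' := by
    have low : ∀ b b', b < b' → 0 ≤ b → b' ≤ b₀ → b' ≤ x →
        refractingValue μ σ q a x c b < refractingValue μ σ q a x c b' := by
      intro b b' h1 h2 h3 h4
      rw [refractingValue_of_le h4, refractingValue_of_le (h1.le.trans h4)]
      have := mul_lt_mul_of_pos_right (hD1 ⟨h2, h1.le.trans h3⟩ ⟨h2.trans h1.le, h3⟩ h1) hE
      linarith
    have high : ∀ b b', b < b' → 0 ≤ b → b' ≤ b₀ → x ≤ b →
        refractingValue μ σ q a x c b < refractingValue μ σ q a x c b' := by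
      intro b b' h1 h2 h3 h4
      rw [refractingValue_of_ge h4, refractingValue_of_ge (h4.trans h1.le)]
      have := mul_lt_mul_of_pos_right (hB1 ⟨h2, h1.le.trans h3⟩ ⟨h2.trans h1.le, h3⟩ h1) hW
      linarith
    intro b b' h1 h2 h3
    rcases le_or_gt b' x with h4 | h4
    · exact low b b' h1 h2 h3 h4
    rcases le_or_gt x b with h5 | h5
    · exact high b b' h1 h2 h3 h5
    · exact (low b x h5 h2 (h4.le.trans h3) le_rfl).trans (high x b' h4 hx.le h3 le_rfl)
  have key2 : ∀ b b', b < b' → b₀ ≤ b →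
      refractingValue μ σ q a x c b' < refractingValue μ σ q a x c b := by
    have low : ∀ b b', b < b' → b₀ ≤ b → b' ≤ x →
        refractingValue μ σ q a x c b' < refractingValue μ σ q a x c b := by
      intro b b' h1 h2 h4
      rw [refractingValue_of_le h4, refractingValue_of_le (h1.le.trans h4)]
      have := mul_lt_mul_of_pos_right (hD2 h2 (h2.trans h1.le) h1) hE
      linarith
    have high : ∀ b b', b < b' → b₀ ≤ b → x ≤ b →
        refractingValue μ σ q a x c b' < refractingValue μ σ q a x c b := by
      intro b b' h1 h2 h4
      rw [refractingValue_of_ge h4, refractingValue_of_ge (h4.trans h1.le)]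
      have := mul_lt_mul_of_pos_right (hB2 h2 (h2.trans h1.le) h1) hW
      linarith
    intro b b' h1 h2
    rcases le_or_gt b' x with h4 | h4
    · exact low b b' h1 h2 h4
    rcases le_or_gt x b with h5 | h5
    · exact high b b' h1 h2 h5
    · exact (high x b' h4 (h2.trans h5.le) le_rfl).trans (low b x h5 h2 le_rfl)
  have key : ∀ b, 0 ≤ b → b ≠ b₀ →
      refractingValue μ σ q a x c b < refractingValue μ σ q a x c b₀ := by
    intro b h1 h2
    rcases h2.lt_or_gt with h3 | h3
    · exact key1 b b₀ h3 h1 le_rfl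
    · exact key2 b₀ b h3 le_rfl
  ext b
  simp only [argmaxThreshold, Set.mem_ofPred_eq, Set.mem_singleton_iff]
  constructor
  · rintro ⟨h1, h2⟩
    by_contra h3
    exact (key b h1 h3).not_ge (h2 b₀ hb₀.le)
  · rintro rfl
    refine ⟨hb₀.le, fun b' hb' => ?_⟩
    rcases eq_or_ne b' b with rfl | h3
    · exact le_rfl
    · exact (key b' hb' h3).le

end Threshold

/-! ### Calculus of third-order expansions in a small function `w`. -/

section Expansion

/-- `f = a₀ + a₁ w + a₂ w² + a₃ w³ + O(w⁴)` along the filter `L`. -/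
def HasExp (L : Filter ℝ) (w f : ℝ → ℝ) (a₀ a₁ a₂ a₃ : ℝ) : Prop :=
  (fun c => f c - (a₀ + a₁ * w c + a₂ * w c ^ 2 + a₃ * w c ^ 3)) =O[L] fun c => w c ^ 4

namespace HasExp

variable {L : Filter ℝ} {w f g h : ℝ → ℝ} {a₀ a₁ a₂ a₃ b₀ b₁ b₂ b₃ c₀ c₁ c₂ c₃ : ℝ}

lemma of_eq (hf : HasExp L w f a₀ a₁ a₂ a₃) (h₀ : a₀ = b₀) (h₁ : a₁ = b₁) (h₂ : a₂ = b₂)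
    (h₃ : a₃ = b₃) : HasExp L w f b₀ b₁ b₂ b₃ := by
  subst h₀ h₁ h₂ h₃; exact hf

lemma congr (hf : HasExp L w f a₀ a₁ a₂ a₃) (h : ∀ᶠ c in L, g c = f c) :
    HasExp L w g a₀ a₁ a₂ a₃ := by
  refine IsBigO.congr' hf ?_ EventuallyEq.rfl
  filter_upwards [h] with c hc
  rw [hc]

lemma of_exact (h : ∀ c, f c = a₀ + a₁ * w c + a₂ * w c ^ 2 + a₃ * w c ^ 3) :
    HasExp L w f a₀ a₁ a₂ a₃ := by
  unfold HasExp
  simp only [h, sub_self]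
  exact isBigO_zero _ _

lemma const (x : ℝ) : HasExp L w (fun _ => x) x 0 0 0 := of_exact fun c => by ring

lemma id : HasExp L w w 0 1 0 0 := of_exact fun c => by ring

lemma sq : HasExp L w (fun c => w c ^ 2) 0 0 1 0 := of_exact fun c => by ring

lemma add (hf : HasExp L w f a₀ a₁ a₂ a₃) (hg : HasExp L w g b₀ b₁ b₂ b₃) :
    HasExp L w (fun c => f c + g c) (a₀ + b₀) (a₁ + b₁) (a₂ + b₂) (a₃ + b₃) := by
  refine (IsBigO.add hf hg).congr_left fun c => ?_
  ring

lemma neg (hf : HasExp L w f a₀ a₁ a₂ a₃) :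
    HasExp L w (fun c => -f c) (-a₀) (-a₁) (-a₂) (-a₃) := by
  refine (IsBigO.neg_left hf).congr_left fun c => ?_
  ring

lemma sub (hf : HasExp L w f a₀ a₁ a₂ a₃) (hg : HasExp L w g b₀ b₁ b₂ b₃) :
    HasExp L w (fun c => f c - g c) (a₀ - b₀) (a₁ - b₁) (a₂ - b₂) (a₃ - b₃) := by
  refine (IsBigO.sub hf hg).congr_left fun c => ?_
  ring

lemma isBigO_one (hw : Tendsto w L (𝓝 0)) (hf : HasExp L w f a₀ a₁ a₂ a₃) :
    f =O[L] fun _ => (1 : ℝ) := by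
  have hw1 : w =O[L] fun _ => (1 : ℝ) := hw.isBigO_one ℝ
  have hp : ∀ i : ℕ, (fun c => w c ^ i) =O[L] fun _ => (1 : ℝ) := fun i => by
    simpa using hw1.pow i
  have h1 : f =O[L] fun _ => (1 : ℝ) := by
    have := (IsBigO.trans hf (hp 4)).add ((((isBigO_const_const a₀ (one_ne_zero' ℝ) L).add
      ((hp 1).const_mul_left a₁)).add ((hp 2).const_mul_left a₂)).add
      ((hp 3).const_mul_left a₃))
    refine this.congr_left fun c => ?_
    ring
  exact h1

lemma mul (hw : Tendsto w L (𝓝 0)) (hf : HasExp L w f a₀ a₁ a₂ a₃)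
    (hg : HasExp L w g b₀ b₁ b₂ b₃) :
    HasExp L w (fun c => f c * g c) (a₀ * b₀) (a₀ * b₁ + a₁ * b₀) (a₀ * b₂ + a₁ * b₁ + a₂ * b₀)
      (a₀ * b₃ + a₁ * b₂ + a₂ * b₁ + a₃ * b₀) := by
  have hg1 := hg.isBigO_one hw
  have hp : (fun c => a₀ + a₁ * w c + a₂ * w c ^ 2 + a₃ * w c ^ 3) =O[L] fun _ => (1 : ℝ) :=
    isBigO_one (a₀ := a₀) (a₁ := a₁) (a₂ := a₂) (a₃ := a₃) hw (of_exact fun c => rfl)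
  -- The degree 4, 5 and 6 part of the product of the two cubic polynomials, with `w⁴` taken out.
  have hr : (fun c => (a₁ * b₃ + a₂ * b₂ + a₃ * b₁) + (a₂ * b₃ + a₃ * b₂) * w c
      + a₃ * b₃ * w c ^ 2) =O[L] fun _ => (1 : ℝ) :=
    isBigO_one (a₀ := a₁ * b₃ + a₂ * b₂ + a₃ * b₁) (a₁ := a₂ * b₃ + a₃ * b₂) (a₂ := a₃ * b₃)
      (a₃ := 0) hw (of_exact fun c => by ring)
  have h1 := IsBigO.mul hf hg1
  have h2 := hp.mul hg
  have h3 := hr.mul (isBigO_refl (fun c => w c ^ 4) L)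
  simp only [mul_one, one_mul] at h1 h2 h3
  refine ((h1.add h2).add h3).congr_left fun c => ?_
  ring

lemma tendsto (hw : Tendsto w L (𝓝 0)) (hf : HasExp L w f a₀ a₁ a₂ a₃) :
    Tendsto f L (𝓝 a₀) := by
  have h0 : Tendsto (fun c => w c ^ 4) L (𝓝 0) := by simpa using hw.pow 4
  have h1 := IsBigO.trans_tendsto hf h0
  have h2 : Tendsto (fun c => a₀ + a₁ * w c + a₂ * w c ^ 2 + a₃ * w c ^ 3) L
      (𝓝 (a₀ + a₁ * 0 + a₂ * 0 ^ 2 + a₃ * 0 ^ 3)) :=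
    ((tendsto_const_nhds.add (hw.const_mul a₁)).add ((hw.pow 2).const_mul a₂)).add
      ((hw.pow 3).const_mul a₃)
  have h3 := h1.add h2
  simpa using h3

/-- Division of expansions: if `g f = h` then the expansion of `f` is the formal quotient. -/
lemma of_mul (hw : Tendsto w L (𝓝 0)) (hg : HasExp L w g b₀ b₁ b₂ b₃)
    (hh : HasExp L w h c₀ c₁ c₂ c₃) (hb : b₀ ≠ 0) (hmul : ∀ᶠ c in L, g c * f c = h c)
    (h₀ : b₀ * a₀ = c₀) (h₁ : b₀ * a₁ + b₁ * a₀ = c₁) (h₂ : b₀ * a₂ + b₁ * a₁ + b₂ * a₀ = c₂)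
    (h₃ : b₀ * a₃ + b₁ * a₂ + b₂ * a₁ + b₃ * a₀ = c₃) : HasExp L w f a₀ a₁ a₂ a₃ := by
  have hp : HasExp L w (fun c => a₀ + a₁ * w c + a₂ * w c ^ 2 + a₃ * w c ^ 3) a₀ a₁ a₂ a₃ :=
    of_exact fun c => rfl
  have h1 := (hh.sub ((hg.mul hw hp).of_eq h₀ h₁ h₂ h₃)).of_eq (sub_self _) (sub_self _)
    (sub_self _) (sub_self _)
  have h2 : (fun c => (g c)⁻¹) =O[L] fun _ => (1 : ℝ) :=
    ((hg.tendsto hw).inv₀ hb).isBigO_one ℝ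
  have h3 := h2.mul h1
  simp only [one_mul] at h3
  refine IsBigO.congr' h3 ?_ EventuallyEq.rfl
  filter_upwards [hmul, (hg.tendsto hw).eventually_ne hb] with c hc hc'
  rw [← hc]
  field_simp
  ring

lemma isBigO_id (hw : Tendsto w L (𝓝 0)) (hf : HasExp L w f 0 a₁ a₂ a₃) : f =O[L] w := by
  have hq : (fun c => a₁ + a₂ * w c + a₃ * w c ^ 2) =O[L] fun _ => (1 : ℝ) :=
    isBigO_one (a₀ := a₁) (a₁ := a₂) (a₂ := a₃) (a₃ := 0) hw (of_exact fun c => by ring)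
  have hw3 : (fun c => w c ^ 3) =O[L] fun _ => (1 : ℝ) := by
    simpa using (hw.isBigO_one ℝ).pow 3
  have h1 : (fun c => w c ^ 4) =O[L] w := by
    have := (isBigO_refl w L).mul hw3
    simp only [mul_one] at this
    refine this.congr_left fun c => ?_
    ring
  have h2 := (isBigO_refl w L).mul hq
  simp only [mul_one] at h2
  refine ((IsBigO.trans hf h1).add h2).congr_left fun c => ?_
  ring

/-- A zero constant term makes `f = O(w)`, so the fourth-order Taylor remainder is `O(w⁴)`; `log`
works the same way around `1`. -/
lemma exp (hw : Tendsto w L (𝓝 0)) (hf : HasExp L w f 0 a₁ a₂ a₃) :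
    HasExp L w (fun c => Real.exp (f c)) 1 a₁ (a₂ + a₁ ^ 2 / 2) (a₃ + a₁ * a₂ + a₁ ^ 3 / 6) := by
  have h1 : HasExp L w (fun c => 1 + f c + 1 / 2 * (f c * f c) + 1 / 6 * (f c * f c * f c))
      1 a₁ (a₂ + a₁ ^ 2 / 2) (a₃ + a₁ * a₂ + a₁ ^ 3 / 6) :=
    ((((const 1).add hf).add ((const (1 / 2)).mul hw (hf.mul hw hf))).add
      ((const (1 / 6)).mul hw ((hf.mul hw hf).mul hw hf))).of_eq
      (by ring) (by ring) (by ring) (by ring)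
  have h2 : (fun c => Real.exp (f c) - (1 + f c + 1 / 2 * (f c * f c)
      + 1 / 6 * (f c * f c * f c))) =O[L] fun c => w c ^ 4 := by
    have h3 := (Real.exp_sub_sum_range_isBigO_pow 4).comp_tendsto (hf.tendsto hw)
    refine (h3.trans ((hf.isBigO_id hw).pow 4)).congr_left fun c => ?_
    simp only [Function.comp_apply, Finset.sum_range_succ, Finset.sum_range_zero, Nat.factorial]
    push_cast
    ring
  refine (h2.add h1).congr_left fun c => ?_
  ring

lemma log (hw : Tendsto w L (𝓝 0)) (hf : HasExp L w f 1 a₁ a₂ a₃) :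
    HasExp L w (fun c => Real.log (f c)) 0 a₁ (a₂ - a₁ ^ 2 / 2)
      (a₃ - a₁ * a₂ + a₁ ^ 3 / 3) := by
  have hx : HasExp L w (fun c => 1 - f c) 0 (-a₁) (-a₂) (-a₃) :=
    ((const 1).sub hf).of_eq (by ring) (by ring) (by ring) (by ring)
  have h1 : HasExp L w (fun c => -((1 - f c) + 1 / 2 * ((1 - f c) * (1 - f c))
      + 1 / 3 * ((1 - f c) * (1 - f c) * (1 - f c))))
      0 a₁ (a₂ - a₁ ^ 2 / 2) (a₃ - a₁ * a₂ + a₁ ^ 3 / 3) :=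
    ((hx.add ((const (1 / 2)).mul hw (hx.mul hw hx))).add
      ((const (1 / 3)).mul hw ((hx.mul hw hx).mul hw hx))).neg.of_eq
      (by ring) (by ring) (by ring) (by ring)
  have h2 : (fun c => Real.log (f c) + ((1 - f c) + 1 / 2 * ((1 - f c) * (1 - f c))
      + 1 / 3 * ((1 - f c) * (1 - f c) * (1 - f c)))) =O[L] fun c => (1 - f c) ^ 4 := by
    have hlim := hx.tendsto hw
    refine IsBigO.of_bound 2 ?_
    have hev : ∀ᶠ c in L, |1 - f c| < 1 / 2 := by
      have := hlim.abs
      rw [abs_zero] at this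
      exact this.eventually_lt_const (by norm_num)
    filter_upwards [hev] with c hc
    have h3 := Real.abs_log_sub_add_sum_range_le (x := 1 - f c) (by linarith) 3
    simp only [Finset.sum_range_succ, Finset.sum_range_zero, sub_sub_cancel] at h3
    have h4 : |1 - f c| ^ (3 + 1) / (1 - |1 - f c|) ≤ 2 * |1 - f c| ^ 4 := by
      rw [div_le_iff₀ (by linarith)]
      have : 0 ≤ |1 - f c| ^ 4 := by positivity
      norm_num
      nlinarith
    rw [Real.norm_eq_abs, Real.norm_eq_abs, abs_pow]
    refine le_trans (le_of_eq ?_) (h3.trans h4)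
    congr 1
    push_cast
    ring
  refine ((h2.trans ((hx.isBigO_id hw).pow 4)).add h1).congr_left fun c => ?_
  ring

end HasExp

end Expansion

/-! ### Expansions of the coefficients of the profile. -/

section CoreExpansion

/-- Under the substitution `A = p/w`, `l = pn/w`, `u = wm`, `e = w²ε`, `y = Y/w`, each core
coefficient becomes a negative power of `w` times a polynomial expression in `w` and the scaled
quantities, with `g = 1/G` as an additional variable. The factor `w²` in `e` absorbs the product `y
(l + u) = YG/w²` in the slope term. -/
lemma core_scaling {a K p w n m F Y ε A C l u e y G g D α β b P ρ Cw Q η X Z S Ψ B : ℝ}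
    (hw : w ≠ 0) (hG : G ≠ 0) (hgG : g = 1 / G)
    (hA : A = p / w) (hC : C = (K * p * w + p - w ^ 2) / w) (hl : l = p * n / w)
    (hu : u = w * m) (he : e = w ^ 2 * ε) (hy : y = Y / w)
    (hP : P = 1 - a + a * F) (hGd : G = p * n + w ^ 2 * m) (hD : D = p + w ^ 2)
    (hα : α = p * n + w ^ 2 + e * w ^ 2 * (m - 1))
    (hβ : β = p - p * n - e * (p + w ^ 2 * m))
    (hb : b = D * ((p - p * n) * (p * n + w ^ 2) + e * w ^ 2 * (m - 1) * (w ^ 2 * m + p)))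
    (hρ : ρ = P * p + a * F * (w ^ 2 * m))
    (hCw : Cw = K * p * w + p - w ^ 2)
    (hQ : Q = p * n + e * w ^ 2 * m)
    (hη : η = Cw * D * (w ^ 2 * (a * F * m * (w ^ 2 * m + p)) * β
      + ρ * ((p - p * n) * (p * n) + e * (w ^ 2 * m) * (p + w ^ 2 * m))))
    (hX : X = P * Q + a * F * (w ^ 2 * m) * (1 - e))
    (hZ : Z = Q * (p - w ^ 2) + 2 * p * w ^ 2 * (1 - e))
    (hS : S = (1 - e) * Z - a * (D * D) * g * (p * n * (1 - e - ε * Y * G)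
      - w ^ 2 * m * (e * (1 - e) - ε * Y * G)))
    (hΨ : Ψ = Cw * (p - w ^ 2) * X - D * D * X - Cw * P * Z
      + a * a * Cw * (D * D) * F * m * g * (w ^ 2 * (1 - e) - Y * G))
    (hB : B = Cw * D * (a * F * m * (w ^ 2 * m + p - w ^ 2) - P * p)) :
    coreAlpha w l u e = α / w ∧ coreBeta A l u e = β / w ∧ coreB11 A w l u e = b / w ^ 3 ∧
      coreEta a C A w l u e F = η / w ^ 4 ∧
      coreK1 A w l u e = D * D * b * p * α / w ^ 7 ∧
      coreKappa a C A w l u e F y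
        = (w ^ 2 * η * α + D * (b * Ψ - w ^ 2 * B * S)) / w ^ 7 := by
  have hΔ : A + w = D / w := by rw [hA, hD]; field_simp
  have hΛ : l + u = G / w := by rw [hl, hu, hGd]; field_simp
  have eα : coreAlpha w l u e = α / w := by
    unfold coreAlpha; rw [hα, hl, hu]; field_simp
  have eβ : coreBeta A l u e = β / w := by
    unfold coreBeta; rw [hβ, hA, hl, hu]; field_simp
  have eb : coreB11 A w l u e = b / w ^ 3 := by
    unfold coreB11; rw [hΔ, hb, hA, hl, hu]; field_simp
  have eρ : coreRho a A u F = ρ / w := by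
    unfold coreRho; rw [hρ, hP, hA, hu]; field_simp
  have eη : coreEta a C A w l u e F = η / w ^ 4 := by
    unfold coreEta; rw [hΔ, eβ, eρ, hη, hCw, hC, hA, hl, hu]; field_simp
  have eX : coreX a l u e F = X / w := by
    unfold coreX; rw [hX, hQ, hP, hl, hu]; field_simp
  have eS : coreSlope a A w l u e y = S / w ^ 2 := by
    unfold coreSlope
    rw [hΔ, hΛ, hS, hZ, hQ, hgG, hy, hA, hl, hu, he]
    field_simp
  have eB : coreB01 a C A w u F = B / w ^ 2 := by
    unfold coreB01; rw [hΔ, hB, hCw, hP, hC, hA, hu]; field_simp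
  have eΨ : corePay a C A w l u e F y = Ψ / w ^ 3 := by
    unfold corePay
    rw [hΔ, hΛ, eX, hΨ, hZ, hQ, hP, hCw, hC, hgG, hy, hA, hl, hu]
    field_simp
    ring
  refine ⟨eα, eβ, eb, eη, ?_, ?_⟩
  · unfold coreK1; rw [hΔ, eb, eα, hA]; field_simp
  · unfold coreKappa; rw [hΔ, eη, eα, eb, eΨ, eB, eS]; field_simp

set_option maxHeartbeats 2000000 in
-- Third order is needed because in `κ + e^{wt} - λt` the orders `0` and `1` cancel: the limit of
-- the zero is read off at order `w²`, its first correction at order `w³`. Every intermediate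
-- quantity is expanded by the calculus above, and the two quotients are checked by formal division.
lemma core_expansions {L : Filter ℝ} {w n m F Y ε A C l u e y : ℝ → ℝ} {a K p : ℝ}
    (ha0 : 0 < a) (ha1 : a < 1) (hp : 0 < p) (hw : Tendsto w L (𝓝 0))
    (hw0 : ∀ᶠ c in L, 0 < w c)
    (hn : HasExp L w n a (-(K) + a * K) (1 / (a * p) - a / p) (K / (a ^ 2 * p) - K / (a * p)))
    (hm : HasExp L w m (1 / a) (K / a ^ 2 - K / a) (-(1 / (a ^ 3 * p)) + K ^ 2 / a ^ 3 -
        2 * K ^ 2 / a ^ 2 + 1 / (a * p) + K ^ 2 / a) (-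
      (3 * K / (a ^ 4 * p)) + K ^ 3 / a ^ 4 + 3 * K / (a ^ 3 * p) - 3 * K ^ 3 / a ^ 3
          + 2 * K / (a ^ 2 * p) + 3 * K ^ 3 / a ^ 2 - 2 * K / (a * p) - K ^ 3 / a))
    (hF : HasExp L w F 1 (-(K / a)) (1 / (a * p) + K ^ 2 / a) (-(2 * K / (a * p)) - K ^ 3 / a))
    (hY : HasExp L w Y 0 K (-(K ^ 2 / (2 * a)) - 1 / p) (K / (a ^ 2 * p) - K ^ 3 / (6 *
        a ^ 2) + K ^ 3 / (2 * a)))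
    (hε : HasExp L w ε 0 0 0 0)
    (hgeom : ∀ᶠ c in L, A c = p / w c ∧ C c = (K * p * w c + p - w c ^ 2) / w c ∧
      l c = p * n c / w c ∧ u c = w c * m c ∧ e c = w c ^ 2 * ε c ∧ y c = Y c / w c) :
    HasExp L w (fun c => coreEta a (C c) (A c) (w c) (l c) (u c) (e c) (F c) /
      ((A c + w c) * A c * coreB11 (A c) (w c) (l c) (u c) (e c))) 0 1 0 0 ∧
    HasExp L w (fun c => coreKappa a (C c) (A c) (w c) (l c) (u c) (e c) (F c) (y c) /
      coreK1 (A c) (w c) (l c) (u c) (e c)) (-1) 0 (-(K ^ 2 / (2 * a)))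
      (2 * K / (a ^ 2 * p) - K ^ 3 / (3 * a ^ 2) + K ^ 3 / a) ∧
    Tendsto (fun c => coreBeta (A c) (l c) (u c) (e c) /
      (A c * coreAlpha (w c) (l c) (u c) (e c)) / w c) L (𝓝 ((p - a * p) / (p * (a * p)))) := by
  have hw1 : HasExp L w w 0 1 0 0 := HasExp.id
  have hw2 : HasExp L w (fun c => w c ^ 2) 0 0 1 0 := HasExp.sq
  obtain ⟨P, P_def⟩ : ∃ f : ℝ → ℝ, f = fun c => 1 - a + a * F c := ⟨_, rfl⟩
  have hP : HasExp L w P 1 (-(K)) (1 / p + K ^ 2) (-(2 * K / p) - K ^ 3) := by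
    rw [P_def]
    refine (((HasExp.const 1).sub (HasExp.const a)).add ((HasExp.const a).mul hw
        hF)).of_eq ?_ ?_ ?_ ?_ <;> (try field_simp) <;> ring
  obtain ⟨G, G_def⟩ : ∃ f : ℝ → ℝ, f = fun c => p * n c + w c ^ 2 * m c := ⟨_, rfl⟩
  have hG : HasExp L w G (a * p) (-(K * p) + a * K * p) (2 / a - a) (2 * K / a ^ 2 - 2 * K
      / a) := by
    rw [G_def]
    refine (((HasExp.const p).mul hw hn).add (hw2.mul hw hm)).of_eq ?_ ?_ ?_ ?_ <;> (try
        field_simp) <;> ring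
  have hG0 : ∀ᶠ c in L, G c ≠ 0 := (hG.tendsto hw).eventually_ne (by positivity)
  obtain ⟨g, g_def⟩ : ∃ f : ℝ → ℝ, f = fun c => 1 / G c := ⟨_, rfl⟩
  have hg : HasExp L w g (1 / (a * p)) (K / (a ^ 2 * p) - K / (a * p)) (-(2 / (a ^ 3 * p ^
      2)) + K ^ 2 / (a ^ 3 * p) - 2 * K ^ 2 / (a ^ 2 * p) + 1 / (a * p ^ 2) + K ^ 2 / (a *
      p)) (-(6 * K / (a ^ 4 * p ^ 2)) + K ^ 3 / (a ^ 4 * p) + 6 * K / (a ^ 3 * p ^ 2) - 3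
      * K ^ 3 / (a ^ 3 * p) + 2 * K / (a ^ 2 * p ^ 2) + 3 * K ^ 3 / (a ^ 2 * p) - 2 * K /
      (a * p ^ 2) - K ^ 3 / (a * p)) := by
    refine HasExp.of_mul hw hG (HasExp.const 1) (by positivity) ?_ ?_ ?_ ?_ ?_
    · filter_upwards [hG0] with c hc
      rw [g_def]
      exact mul_one_div_cancel hc
    all_goals (try field_simp) <;> ring
  obtain ⟨D, D_def⟩ : ∃ f : ℝ → ℝ, f = fun c => p + w c ^ 2 := ⟨_, rfl⟩
  have hD : HasExp L w D p 0 1 0 := by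
    rw [D_def]
    refine ((HasExp.const p).add hw2).of_eq ?_ ?_ ?_ ?_ <;> (try field_simp) <;> ring
  have he : HasExp L w e 0 0 0 0 := by
    have h0 := (hw2.mul hw hε).of_eq (b₀ := 0) (b₁ := 0) (b₂ := 0) (b₃ := 0)
      (by ring) (by ring) (by ring) (by ring)
    refine h0.congr ?_
    filter_upwards [hgeom] with c hc
    exact hc.2.2.2.2.1
  obtain ⟨α, α_def⟩ : ∃ f : ℝ → ℝ, f = fun c => p * n c + w c ^ 2 + (e c * w c ^ 2) * (m c
      - 1) := ⟨_, rfl⟩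
  have hα : HasExp L w α (a * p) (-(K * p) + a * K * p) (1 / a + 1 - a) (K / a ^ 2 - K / a) := by
    rw [α_def]
    refine ((((HasExp.const p).mul hw hn).add hw2).add ((he.mul hw hw2).mul hw (hm.sub
        (HasExp.const 1)))).of_eq ?_ ?_ ?_ ?_ <;> (try field_simp) <;> ring
  obtain ⟨β, β_def⟩ : ∃ f : ℝ → ℝ, f = fun c => p - (p * n c) - (e c * (p + w c ^ 2 * m
      c)) := ⟨_, rfl⟩
  have hβ : HasExp L w β (p - a * p) (K * p - a * K * p) (-(1 / a) + a) (-(K / a ^ 2) + K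
      / a) := by
    rw [β_def]
    refine (((HasExp.const p).sub ((HasExp.const p).mul hw hn)).sub (he.mul hw
        ((HasExp.const p).add (hw2.mul hw hm)))).of_eq ?_ ?_ ?_ ?_ <;> (try field_simp)
        <;> ring
  obtain ⟨b, b_def⟩ : ∃ f : ℝ → ℝ, f = fun c => D c * ((p - (p * n c)) * (p * n c + w c ^
      2) + ((e c * w c ^ 2) * (m c - 1)) * (w c ^ 2 * m c + p)) := ⟨_, rfl⟩
  have hb : HasExp L w b (a * p ^ 3 - a ^ 2 * p ^ 3) (-(K * p ^ 3) + 3 * a * K * p ^ 3 - 2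
      * a ^ 2 * K * p ^ 3) (p ^ 2 / a - p ^ 2 - K ^ 2 * p ^ 3 - a * p ^ 2 + 2 * a * K ^ 2
      * p ^ 3 + a ^ 2 * p ^ 2 - a ^ 2 * K ^ 2 * p ^ 3) (K * p ^ 2 / a ^ 2 - K * p ^ 2 / a)
      := by
    rw [b_def]
    refine (hD.mul hw ((((HasExp.const p).sub ((HasExp.const p).mul hw hn)).mul hw
        (((HasExp.const p).mul hw hn).add hw2)).add (((he.mul hw hw2).mul hw (hm.sub
        (HasExp.const 1))).mul hw ((hw2.mul hw hm).add (HasExp.const p))))).of_eq ?_ ?_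
        ?_ ?_ <;> (try field_simp) <;> ring
  obtain ⟨ρ, ρ_def⟩ : ∃ f : ℝ → ℝ, f = fun c => P c * p + (a * F c) * (w c ^ 2 * m c) := ⟨_, rfl⟩
  have hρ : HasExp L w ρ p (-(K * p)) (2 + K ^ 2 * p) (-(3 * K) - K ^ 3 * p) := by
    rw [ρ_def]
    refine ((hP.mul hw (HasExp.const p)).add (((HasExp.const a).mul hw hF).mul hw
        (hw2.mul hw hm))).of_eq ?_ ?_ ?_ ?_ <;> (try field_simp) <;> ring
  obtain ⟨Cw, Cw_def⟩ : ∃ f : ℝ → ℝ, f = fun c => (K * p) * w c + p - w c ^ 2 := ⟨_, rfl⟩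
  have hCw : HasExp L w Cw p (K * p) (-(1)) 0 := by
    rw [Cw_def]
    refine (((((HasExp.const K).mul hw (HasExp.const p)).mul hw hw1).add (HasExp.const
        p)).sub hw2).of_eq ?_ ?_ ?_ ?_ <;> (try field_simp) <;> ring
  obtain ⟨Q, Q_def⟩ : ∃ f : ℝ → ℝ, f = fun c => p * n c + (e c * w c ^ 2) * m c := ⟨_, rfl⟩
  have hQ : HasExp L w Q (a * p) (-(K * p) + a * K * p) (1 / a - a) (K / a ^ 2 - K / a) := by
    rw [Q_def]
    refine (((HasExp.const p).mul hw hn).add ((he.mul hw hw2).mul hw hm)).of_eq ?_ ?_ ?_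
        ?_ <;> (try field_simp) <;> ring
  obtain ⟨η, η_def⟩ : ∃ f : ℝ → ℝ, f = fun c => (Cw c * D c) * ((w c ^ 2 * (((a * F c) * m
      c) * (w c ^ 2 * m c + p))) * β c + ρ c * ((p - (p * n c)) * (p * n c) + (e c * (w c
      ^ 2 * m c)) * (p + w c ^ 2 * m c))) := ⟨_, rfl⟩
  have hη : HasExp L w η (a * p ^ 5 - a ^ 2 * p ^ 5) (-(K * p ^ 5) + 3 * a * K * p ^ 5 - 2
      * a ^ 2 * K * p ^ 5) (p ^ 4 / a - p ^ 4 - K ^ 2 * p ^ 5 + 2 * a * K ^ 2 * p ^ 5 - a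
      ^ 2 * K ^ 2 * p ^ 5) (K * p ^ 4 / a ^ 2 - K * p ^ 4 / a - K * p ^ 4 + 3 * a * K * p
      ^ 4 - 2 * a ^ 2 * K * p ^ 4) := by
    rw [η_def]
    refine ((hCw.mul hw hD).mul hw (((hw2.mul hw ((((HasExp.const a).mul hw hF).mul hw
        hm).mul hw ((hw2.mul hw hm).add (HasExp.const p)))).mul hw hβ).add (hρ.mul hw
        ((((HasExp.const p).sub ((HasExp.const p).mul hw hn)).mul hw ((HasExp.const
        p).mul hw hn)).add ((he.mul hw (hw2.mul hw hm)).mul hw ((HasExp.const p).add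
        (hw2.mul hw hm))))))).of_eq ?_ ?_ ?_ ?_ <;> (try field_simp) <;> ring
  obtain ⟨X, X_def⟩ : ∃ f : ℝ → ℝ, f = fun c => P c * Q c + ((a * F c) * (w c ^ 2 * m c))
      * (1 - e c) := ⟨_, rfl⟩
  have hX : HasExp L w X (a * p) (-(K * p)) (1 / a + 1 + K ^ 2 * p) (K / a ^ 2 - 2 * K / a
      - 2 * K - K ^ 3 * p) := by
    rw [X_def]
    refine ((hP.mul hw hQ).add ((((HasExp.const a).mul hw hF).mul hw (hw2.mul hw
        hm)).mul hw ((HasExp.const 1).sub he))).of_eq ?_ ?_ ?_ ?_ <;> (try field_simp)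
        <;> ring
  obtain ⟨Z, Z_def⟩ : ∃ f : ℝ → ℝ, f = fun c => Q c * (p - w c ^ 2) + ((2 * p) * w c ^ 2)
      * (1 - e c) := ⟨_, rfl⟩
  have hZ : HasExp L w Z (a * p ^ 2) (-(K * p ^ 2) + a * K * p ^ 2) (p / a + 2 * p - 2 * a
      * p) (K * p / a ^ 2 - K * p / a + K * p - a * K * p) := by
    rw [Z_def]
    refine ((hQ.mul hw ((HasExp.const p).sub hw2)).add ((((HasExp.const 2).mul hw
        (HasExp.const p)).mul hw hw2).mul hw ((HasExp.const 1).sub he))).of_eq ?_ ?_ ?_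
        ?_ <;> (try field_simp) <;> ring
  obtain ⟨S, S_def⟩ : ∃ f : ℝ → ℝ, f = fun c => (1 - e c) * Z c - (((a * (D c * D c)) * g
      c) * ((p * n c) * (1 - e c - ((ε c * Y c) * G c)) - ((w c ^ 2 * m c) * (e c * (1 - e
      c) - ((ε c * Y c) * G c))))) := ⟨_, rfl⟩
  have hS : HasExp L w S 0 (-(K * p ^ 2) + a * K * p ^ 2) (2 * p / a + 2 * p - 4 * a * p)
      (3 * K * p / a ^ 2 - 3 * K * p / a + K * p - a * K * p) := by
    rw [S_def]
    refine ((((HasExp.const 1).sub he).mul hw hZ).sub ((((HasExp.const a).mul hw (hD.mul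
        hw hD)).mul hw hg).mul hw ((((HasExp.const p).mul hw hn).mul hw (((HasExp.const
        1).sub he).sub ((hε.mul hw hY).mul hw hG))).sub ((hw2.mul hw hm).mul hw ((he.mul
        hw ((HasExp.const 1).sub he)).sub ((hε.mul hw hY).mul hw hG)))))).of_eq ?_ ?_ ?_
        ?_ <;> (try field_simp) <;> ring
  obtain ⟨Ψ, Ψ_def⟩ : ∃ f : ℝ → ℝ, f = fun c => (Cw c * (p - w c ^ 2)) * X c - ((D c * D
      c) * X c) - ((Cw c * P c) * Z c) + ((((((a * a) * Cw c) * (D c * D c)) * F c) * m c)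
      * g c) * (w c ^ 2 * (1 - e c) - (Y c * G c)) := ⟨_, rfl⟩
  have hΨ : HasExp L w Ψ (-(a * p ^ 3)) (K * p ^ 3 - a * K * p ^ 3) (-(p ^ 2 / a) - p ^ 2
      - K ^ 2 * p ^ 3 / 2 - a * p ^ 2) (-(K * p ^ 2 / a ^ 2) + 3 * K * p ^ 2 / a + K ^ 3 *
      p ^ 3 / (6 * a) + 2 * K * p ^ 2 + K ^ 3 * p ^ 3 / 2 - 2 * a * K * p ^ 2) := by
    rw [Ψ_def]
    refine (((((hCw.mul hw ((HasExp.const p).sub hw2)).mul hw hX).sub ((hD.mul hw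
        hD).mul hw hX)).sub ((hCw.mul hw hP).mul hw hZ)).add ((((((((HasExp.const a).mul
        hw (HasExp.const a)).mul hw hCw).mul hw (hD.mul hw hD)).mul hw hF).mul hw
        hm).mul hw hg).mul hw ((hw2.mul hw ((HasExp.const 1).sub he)).sub (hY.mul hw
        hG)))).of_eq ?_ ?_ ?_ ?_ <;> (try field_simp) <;> ring
  obtain ⟨B, B_def⟩ : ∃ f : ℝ → ℝ, f = fun c => (Cw c * D c) * (((a * F c) * m c) * (w c ^
      2 * m c + p - w c ^ 2) - (P c * p)) := ⟨_, rfl⟩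
  have hB : HasExp L w B 0 0 (-(p ^ 2 / a ^ 2) + 2 * p ^ 2 / a - p ^ 2) (-(2 * K * p ^ 2 /
      a ^ 3) + 4 * K * p ^ 2 / a ^ 2 - 2 * K * p ^ 2 / a) := by
    rw [B_def]
    refine ((hCw.mul hw hD).mul hw (((((HasExp.const a).mul hw hF).mul hw hm).mul hw
        (((hw2.mul hw hm).add (HasExp.const p)).sub hw2)).sub (hP.mul hw (HasExp.const
        p)))).of_eq ?_ ?_ ?_ ?_ <;> (try field_simp) <;> ring
  obtain ⟨N, N_def⟩ : ∃ f : ℝ → ℝ, f = fun c => (w c ^ 2 * η c) * α c + D c * (b c * Ψ c -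
      ((w c ^ 2 * B c) * S c)) := ⟨_, rfl⟩
  have hN : HasExp L w N (-(a ^ 2 * p ^ 7) + a ^ 3 * p ^ 7) (2 * a * K * p ^ 7 - 5 * a ^ 2
      * K * p ^ 7 + 3 * a ^ 3 * K * p ^ 7) (-(2 * p ^ 6) - K ^ 2 * p ^ 7 + a * p ^ 6 + 9 *
      a * K ^ 2 * p ^ 7 / 2 + a ^ 2 * p ^ 6 - 13 * a ^ 2 * K ^ 2 * p ^ 7 / 2 + 3 * a ^ 3 *
      K ^ 2 * p ^ 7) (K * p ^ 6 - K ^ 3 * p ^ 7 / 3 - a * K * p ^ 6 + 11 * a * K ^ 3 * p ^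
      7 / 6 - 3 * a ^ 2 * K * p ^ 6 - 5 * a ^ 2 * K ^ 3 * p ^ 7 / 2 + 3 * a ^ 3 * K * p ^
      6 + a ^ 3 * K ^ 3 * p ^ 7) := by
    rw [N_def]
    refine (((hw2.mul hw hη).mul hw hα).add (hD.mul hw ((hb.mul hw hΨ).sub ((hw2.mul hw
        hB).mul hw hS)))).of_eq ?_ ?_ ?_ ?_ <;> (try field_simp) <;> ring
  obtain ⟨K1, K1_def⟩ : ∃ f : ℝ → ℝ, f = fun c => (((D c * D c) * b c) * p) * α c := ⟨_, rfl⟩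
  have hK1 : HasExp L w K1 (a ^ 2 * p ^ 7 - a ^ 3 * p ^ 7) (-(2 * a * K * p ^ 7) + 5 * a ^
      2 * K * p ^ 7 - 3 * a ^ 3 * K * p ^ 7) (2 * p ^ 6 + K ^ 2 * p ^ 7 - a * p ^ 6 - 5 *
      a * K ^ 2 * p ^ 7 - a ^ 2 * p ^ 6 + 7 * a ^ 2 * K ^ 2 * p ^ 7 - 3 * a ^ 3 * K ^ 2 *
      p ^ 7) (K * p ^ 6 + K ^ 3 * p ^ 7 - a * K * p ^ 6 - 3 * a * K ^ 3 * p ^ 7 + 3 * a ^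
      2 * K * p ^ 6 + 3 * a ^ 2 * K ^ 3 * p ^ 7 - 3 * a ^ 3 * K * p ^ 6 - a ^ 3 * K ^ 3 *
      p ^ 7) := by
    rw [K1_def]
    refine ((((hD.mul hw hD).mul hw hb).mul hw (HasExp.const p)).mul hw hα).of_eq ?_ ?_
        ?_ ?_ <;> (try field_simp) <;> ring
  -- The expansions of `η` and of `D p b` have the same four coefficients, so the quotient `λ = w η
  -- / (D p b)` is `w` up to `O(w⁴)`.
  obtain ⟨Ln, Ln_def⟩ : ∃ f : ℝ → ℝ, f = fun c => w c * η c := ⟨_, rfl⟩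
  have hLn : HasExp L w Ln 0 (a * p ^ 5 - a ^ 2 * p ^ 5) (-(K * p ^ 5) + 3 * a * K * p ^ 5
      - 2 * a ^ 2 * K * p ^ 5) (p ^ 4 / a - p ^ 4 - K ^ 2 * p ^ 5 + 2 * a * K ^ 2 * p ^ 5
      - a ^ 2 * K ^ 2 * p ^ 5) := by
    rw [Ln_def]
    refine (hw1.mul hw hη).of_eq ?_ ?_ ?_ ?_ <;> (try field_simp) <;> ring
  obtain ⟨Ld, Ld_def⟩ : ∃ f : ℝ → ℝ, f = fun c => (D c * p) * b c := ⟨_, rfl⟩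
  have hLd : HasExp L w Ld (a * p ^ 5 - a ^ 2 * p ^ 5) (-(K * p ^ 5) + 3 * a * K * p ^ 5 -
      2 * a ^ 2 * K * p ^ 5) (p ^ 4 / a - p ^ 4 - K ^ 2 * p ^ 5 + 2 * a * K ^ 2 * p ^ 5 -
      a ^ 2 * K ^ 2 * p ^ 5) (K * p ^ 4 / a ^ 2 - K * p ^ 4 / a - K * p ^ 4 + 3 * a * K *
      p ^ 4 - 2 * a ^ 2 * K * p ^ 4) := by
    rw [Ld_def]
    refine ((hD.mul hw (HasExp.const p)).mul hw hb).of_eq ?_ ?_ ?_ ?_ <;> (try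
        field_simp) <;> ring

  have hb0 : 0 < a * p ^ 3 - a ^ 2 * p ^ 3 := by
    have : 0 < a * p ^ 3 * (1 - a) := mul_pos (by positivity) (by linarith)
    linarith
  have hα1 : ∀ᶠ c in L, α c ≠ 0 := (hα.tendsto hw).eventually_ne (by positivity)
  have hb1 : ∀ᶠ c in L, b c ≠ 0 := (hb.tendsto hw).eventually_ne hb0.ne'
  have hD1 : ∀ᶠ c in L, D c ≠ 0 := (hD.tendsto hw).eventually_ne hp.ne'
  have hlink : ∀ᶠ c in L, coreAlpha (w c) (l c) (u c) (e c) = α c / w c ∧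
      coreBeta (A c) (l c) (u c) (e c) = β c / w c ∧
      coreB11 (A c) (w c) (l c) (u c) (e c) = b c / w c ^ 3 ∧
      coreEta a (C c) (A c) (w c) (l c) (u c) (e c) (F c) = η c / w c ^ 4 ∧
      coreK1 (A c) (w c) (l c) (u c) (e c) = K1 c / w c ^ 7 ∧
      coreKappa a (C c) (A c) (w c) (l c) (u c) (e c) (F c) (y c) = N c / w c ^ 7 := by
    filter_upwards [hgeom, hw0, hG0] with c hc hwc hGc
    obtain ⟨h1, h2, h3, h4, h5, h6⟩ := hc
    rw [K1_def, N_def]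
    exact core_scaling hwc.ne' hGc (congrFun g_def c) h1 h2 h3 h4 h5 h6 (congrFun P_def c)
      (congrFun G_def c) (congrFun D_def c) (congrFun α_def c) (congrFun β_def c)
      (congrFun b_def c) (congrFun ρ_def c) (congrFun Cw_def c) (congrFun Q_def c)
      (congrFun η_def c) (congrFun X_def c) (congrFun Z_def c) (congrFun S_def c)
      (congrFun Ψ_def c) (congrFun B_def c)
  refine ⟨?_, ?_, ?_⟩
  · refine HasExp.of_mul hw hLd hLn ?_ ?_ ?_ ?_ ?_ ?_
    · have : 0 < a * p ^ 5 * (1 - a) := mul_pos (by positivity) (by linarith)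
      linarith
    · filter_upwards [hlink, hgeom, hw0, hb1, hD1] with c h1 h2 h3 h4 h5
      have h6 : A c + w c = D c / w c := by rw [h2.1, D_def]; field_simp
      rw [h6, h1.2.2.1, h1.2.2.2.1, h2.1, Ld_def, Ln_def]
      field_simp
    all_goals ring
  · refine HasExp.of_mul hw hK1 hN ?_ ?_ ?_ ?_ ?_ ?_
    · have : 0 < a ^ 2 * p ^ 7 * (1 - a) := mul_pos (by positivity) (by linarith)
      linarith
    · filter_upwards [hlink, hw0, hb1, hD1, hα1] with c h1 h3 h4 h5 h6
      rw [h1.2.2.2.2.1, h1.2.2.2.2.2]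
      have : K1 c ≠ 0 := by
        rw [K1_def]
        exact mul_ne_zero (mul_ne_zero (mul_ne_zero (mul_ne_zero h5 h5) h4) hp.ne') h6
      field_simp
    all_goals (try field_simp) <;> ring
  · have h1 := (hβ.tendsto hw).div ((hα.tendsto hw).const_mul p)
      (by positivity : p * (a * p) ≠ 0)
    refine h1.congr' ?_
    filter_upwards [hlink, hgeom, hw0, hα1] with c h2 h3 h4 h5
    rw [h2.1, h2.2.1, h3.1]
    simp only [Pi.div_apply]
    field_simp

end CoreExpansion

/-! ### Sign, convexity and unique zero of the profile. -/

section Profile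

/-- The numerator of `C₀` at distance `t` from the threshold, up to a positive factor. -/
def profile (w A κ lam γ lam' t : ℝ) : ℝ :=
  Real.exp (w * t) + κ - lam * t + γ * Real.exp (-(A * t)) * (lam' * Real.exp (-(w * t)) - w)

lemma coreNum_eq_mul_profile {a C A w l u e F y t : ℝ} (hA : A ≠ 0) (hΔ : A + w ≠ 0)
    (hα : coreAlpha w l u e ≠ 0) (hb : coreB11 A w l u e ≠ 0) :
    coreNum a C A w l u e F y t = coreK1 A w l u e *
      profile w A (coreKappa a C A w l u e F y / coreK1 A w l u e)
        (coreEta a C A w l u e F / ((A + w) * A * coreB11 A w l u e))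
        (coreBeta A l u e / (A * coreAlpha w l u e))
        (coreEta a C A w l u e F / ((A + w) ^ 2 * coreB11 A w l u e)) t := by
  unfold coreNum profile coreK1
  field_simp

lemma profile_hasDerivAt (w A κ lam γ lam' t : ℝ) :
    HasDerivAt (profile w A κ lam γ lam')
      (w * Real.exp (w * t) - lam - γ * lam' * (A + w) * Real.exp (-((A + w) * t))
        + γ * w * A * Real.exp (-(A * t))) t := by
  have he := fun k : ℝ => ((hasDerivAt_id t).const_mul k).exp
  have hn := fun k : ℝ => ((hasDerivAt_id t).const_mul k).neg.exp
  have h := (((he w).add_const κ).sub ((hasDerivAt_id t).const_mul lam)).add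
    (((hn A).const_mul γ).mul (((hn w).const_mul lam').sub_const w))
  refine h.congr_deriv ?_
  have : Real.exp (-((A + w) * t)) = Real.exp (-(A * t)) * Real.exp (-(w * t)) := by
    rw [← Real.exp_add]; ring_nf
  rw [this]
  simp only [id, Pi.neg_apply]
  ring

/-- The only negative term of the second derivative is `-γ w A² e^{-At}`. The hypothesis bounds its
size by `w²` from `δ` on, and `w² e^{wt} ≥ w²` absorbs it. -/
lemma profile_convexOn {w A κ lam γ lam' δ : ℝ} (hw : 0 < w) (hγ : 0 ≤ γ) (hlam' : 0 ≤ lam')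
    (hA : 0 ≤ A) (hδ : 0 ≤ δ) (h : γ * A ^ 2 * Real.exp (-(A * δ)) ≤ w) :
    ConvexOn ℝ (Set.Ici δ) (profile w A κ lam γ lam') := by
  have hd : deriv (profile w A κ lam γ lam') = fun t => w * Real.exp (w * t) - lam
      - γ * lam' * (A + w) * Real.exp (-((A + w) * t)) + γ * w * A * Real.exp (-(A * t)) :=
    funext fun t => (profile_hasDerivAt w A κ lam γ lam' t).deriv
  have hd2 : ∀ t, HasDerivAt (deriv (profile w A κ lam γ lam'))
      (w ^ 2 * Real.exp (w * t) + γ * lam' * (A + w) ^ 2 * Real.exp (-((A + w) * t))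
        - γ * w * A ^ 2 * Real.exp (-(A * t))) t := by
    intro t
    rw [hd]
    have he := fun k : ℝ => ((hasDerivAt_id t).const_mul k).exp
    have hn := fun k : ℝ => ((hasDerivAt_id t).const_mul k).neg.exp
    have h1 := ((((he w).const_mul w).sub_const lam).sub
      ((hn (A + w)).const_mul (γ * lam' * (A + w)))).add ((hn A).const_mul (γ * w * A))
    refine h1.congr_deriv ?_
    simp only [id, Pi.neg_apply]
    ring
  refine convexOn_of_deriv2_nonneg' (convex_Ici _)
    (fun t _ => (profile_hasDerivAt w A κ lam γ lam' t).differentiableAt.differentiableWithinAt)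
    (fun t _ => (hd2 t).differentiableAt.differentiableWithinAt) ?_
  intro t ht
  have ht' : δ ≤ t := ht
  rw [Function.iterate_succ_apply, Function.iterate_one, (hd2 t).deriv]
  have h1 : 1 ≤ Real.exp (w * t) := Real.one_le_exp (mul_nonneg hw.le (hδ.trans ht'))
  have h2 : Real.exp (-(A * t)) ≤ Real.exp (-(A * δ)) :=
    Real.exp_le_exp.2 (neg_le_neg (mul_le_mul_of_nonneg_left ht' hA))
  have h3 : γ * A ^ 2 * Real.exp (-(A * t)) ≤ w :=
    (mul_le_mul_of_nonneg_left h2 (by positivity)).trans h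
  have h4 : 0 ≤ γ * lam' * (A + w) ^ 2 * Real.exp (-((A + w) * t)) := by positivity
  have h5 : w * (γ * A ^ 2 * Real.exp (-(A * t))) ≤ w * w := mul_le_mul_of_nonneg_left h3 hw.le
  have h6 : w ^ 2 * 1 ≤ w ^ 2 * Real.exp (w * t) := mul_le_mul_of_nonneg_left h1 (by positivity)
  nlinarith

/-- A continuous function on `(0, ∞)` that is negative up to `δ`, convex from `δ` on and
positive somewhere has exactly one zero, with quantitative control. -/
lemma existsUnique_zero_of_convexOn {f : ℝ → ℝ} {δ T m : ℝ} (hδ : 0 < δ) (hδT : δ < T)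
    (hf : Continuous f) (hneg : ∀ t, 0 < t → t ≤ δ → f t < 0) (hconv : ConvexOn ℝ (Set.Ici δ) f)
    (hm : 0 < m) (hfδ : f δ ≤ -m) (hT : 0 < f T) :
    ∃ t₀, δ < t₀ ∧ t₀ < T ∧ f t₀ = 0 ∧ (∀ t, 0 < t → f t = 0 → t = t₀) ∧
      ∀ s, δ ≤ s → m * |t₀ - s| ≤ T * |f s| := by
  obtain ⟨t₀, ht₀, h0⟩ := intermediate_value_Ioo hδT.le hf.continuousOn
    (show (0 : ℝ) ∈ Set.Ioo (f δ) (f T) from ⟨by linarith, hT⟩)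
  -- Convexity on the three points `δ`, `t`, `s`: the chord from `(δ, f δ)` has drop at least `m` at
  -- its left end, so a small value at `s` forces `s` close to the zero `t`.
  have hbound : ∀ t, δ < t → f t = 0 → ∀ s, δ ≤ s → m * |t - s| ≤ t * |f s| := by
    intro t ht hft s hs
    rcases lt_trichotomy t s with h | h | h
    · have h1 := hconv.2 (Set.mem_Ici.2 le_rfl) (Set.mem_Ici.2 hs)
        (show (0 : ℝ) ≤ (s - t) / (s - δ) from div_nonneg (by linarith) (by linarith))
        (show (0 : ℝ) ≤ (t - δ) / (s - δ) from div_nonneg (by linarith) (by linarith))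
        (by have : s - δ ≠ 0 := by linarith
            field_simp; ring)
      have hne : s - δ ≠ 0 := by linarith
      have h2 : (s - t) / (s - δ) * δ + (t - δ) / (s - δ) * s = t := by field_simp; ring
      simp only [smul_eq_mul, h2, hft] at h1
      have h3 : (s - t) / (s - δ) * f δ + (t - δ) / (s - δ) * f s
        = ((s - t) * f δ + (t - δ) * f s) / (s - δ) := by ring
      rw [h3, le_div_iff₀ (by linarith), zero_mul] at h1
      rw [abs_of_neg (by linarith)]
      have h4 : f s ≤ |f s| := le_abs_self _
      have h5 : (s - t) * f δ ≤ (s - t) * -m := mul_le_mul_of_nonneg_left hfδ (by linarith)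
      have h6 : (t - δ) * f s ≤ (t - δ) * |f s| := mul_le_mul_of_nonneg_left h4 (by linarith)
      have h7 : 0 ≤ δ * |f s| := mul_nonneg hδ.le (abs_nonneg _)
      nlinarith
    · subst h
      rw [sub_self, abs_zero, mul_zero]
      exact mul_nonneg (by linarith) (abs_nonneg _)
    · have h1 := hconv.2 (Set.mem_Ici.2 le_rfl) (Set.mem_Ici.2 ht.le)
        (show (0 : ℝ) ≤ (t - s) / (t - δ) from div_nonneg (by linarith) (by linarith))
        (show (0 : ℝ) ≤ (s - δ) / (t - δ) from div_nonneg (by linarith) (by linarith))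
        (by have : t - δ ≠ 0 := by linarith
            field_simp; ring)
      have hne : t - δ ≠ 0 := by linarith
      have h2 : (t - s) / (t - δ) * δ + (s - δ) / (t - δ) * t = s := by field_simp; ring
      simp only [smul_eq_mul, h2, hft, mul_zero, add_zero] at h1
      rw [div_mul_eq_mul_div, le_div_iff₀ (by linarith)] at h1
      rw [abs_of_pos (by linarith)]
      have h4 : -f s ≤ |f s| := neg_le_abs _
      have h5 : (t - s) * f δ ≤ (t - s) * -m := mul_le_mul_of_nonneg_left hfδ (by linarith)
      have h6 : -f s * (t - δ) ≤ |f s| * (t - δ) := mul_le_mul_of_nonneg_right h4 (by linarith)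
      have h7 : 0 ≤ δ * |f s| := mul_nonneg hδ.le (abs_nonneg _)
      nlinarith
  refine ⟨t₀, ht₀.1, ht₀.2, h0, ?_, ?_⟩
  · intro t ht hft
    have h1 : δ < t := by
      by_contra h
      exact (hneg t ht (not_lt.1 h)).ne hft
    -- Uniqueness is the same estimate with a second zero in place of `s`.
    have h2 := hbound t₀ ht₀.1 h0 t h1.le
    rw [hft, abs_zero, mul_zero] at h2
    have h3 : |t₀ - t| ≤ 0 := by
      by_contra h
      exact (mul_pos hm (not_le.1 h)).not_ge h2
    have := abs_eq_zero.1 (le_antisymm h3 (abs_nonneg _))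
    linarith
  · intro s hs
    exact (hbound t₀ ht₀.1 h0 s hs).trans (mul_le_mul_of_nonneg_right ht₀.2.le (abs_nonneg _))

/-- `x^N e^{-x}` is bounded near infinity; take `x = κ / w`. -/
lemma exp_neg_div_isBigO_pow {L : Filter ℝ} {w g : ℝ → ℝ} (hw : Tendsto w L (𝓝 0))
    (hw0 : ∀ᶠ c in L, 0 < w c) {κ : ℝ} (hκ : 0 < κ) (hg : ∀ᶠ c in L, κ / w c ≤ g c) (N : ℕ) :
    (fun c => Real.exp (-g c)) =O[L] fun c => w c ^ N := by
  have h1 : Tendsto (fun c => (w c)⁻¹) L atTop :=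
    (tendsto_inv_nhdsGT_zero).comp (tendsto_nhdsWithin_iff.2 ⟨hw, hw0⟩)
  have h2 : Tendsto (fun c => κ * (w c)⁻¹) L atTop := h1.const_mul_atTop hκ
  have h3 := ((Real.tendsto_pow_mul_exp_neg_atTop_nhds_zero N).comp h2).isBigO_one ℝ
  have h4 := (h3.mul (isBigO_refl (fun c => w c ^ N) L)).const_mul_left ((κ ^ N)⁻¹)
  simp only [one_mul] at h4
  refine IsBigO.trans (IsBigO.of_bound 1 ?_) h4
  filter_upwards [hw0, hg] with c hc hgc
  have h5 : (κ ^ N)⁻¹ * ((fun x : ℝ => x ^ N * Real.exp (-x)) ∘ (fun c => κ * (w c)⁻¹)) c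
      * w c ^ N = Real.exp (-(κ / w c)) := by
    simp only [Function.comp_apply, mul_pow, inv_pow, div_eq_mul_inv]
    field_simp
  rw [← mul_assoc, h5, one_mul, Real.norm_eq_abs, Real.norm_eq_abs, abs_of_pos (Real.exp_pos _),
    abs_of_pos (Real.exp_pos _)]
  exact Real.exp_le_exp.2 (neg_le_neg hgc)

lemma HasExp.abs_le {L : Filter ℝ} {w f : ℝ → ℝ} {a₂ a₃ : ℝ} (hw : Tendsto w L (𝓝 0))
    (hf : HasExp L w f 0 0 a₂ a₃) {ε : ℝ} (hε : 0 < ε) :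
    ∀ᶠ c in L, |f c - a₂ * w c ^ 2| ≤ ε * w c ^ 2 := by
  have h1 : (fun c => f c - a₂ * w c ^ 2) =O[L] fun c => w c ^ 3 := by
    have h2 : (fun c => w c ^ 4) =O[L] fun c => w c ^ 3 := by
      have := (hw.isBigO_one ℝ).mul (isBigO_refl (fun c => w c ^ 3) L)
      simp only [one_mul] at this
      refine this.congr_left fun c => ?_
      ring
    refine ((IsBigO.trans hf h2).add
      ((isBigO_refl (fun c => w c ^ 3) L).const_mul_left a₃)).congr_left fun c => ?_
    ring
  have h3 : (fun c => w c ^ 3) =o[L] fun c => w c ^ 2 := by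
    have h4 : w =o[L] fun _ => (1 : ℝ) := (isLittleO_one_iff ℝ).2 hw
    have := h4.mul_isBigO (isBigO_refl (fun c => w c ^ 2) L)
    simp only [one_mul] at this
    refine this.congr_left fun c => ?_
    ring
  filter_upwards [(h1.trans_isLittleO h3).bound hε] with c hc
  rwa [Real.norm_eq_abs, Real.norm_eq_abs, abs_of_nonneg (sq_nonneg (w c))] at hc

/-- Sign pattern of the profile when its coefficients have the limiting behaviour that
corresponds to large dividend rates. -/
lemma profile_eventually {L : Filter ℝ} {w A κ lam γ lam' : ℝ → ℝ} {p M m₁ g₀ δ T : ℝ}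
    (hw : Tendsto w L (𝓝 0)) (hw0 : ∀ᶠ c in L, 0 < w c) (hp : 0 < p)
    (hδ : 0 < δ) (hδM : 2 * δ ^ 2 = M) (hT : 0 < T) (hTM : 4 * M ≤ T ^ 2)
    (hA : ∀ᶠ c in L, A c = p / w c)
    (hκ : HasExp L w κ (-1) 0 (-M) m₁) (hlam : HasExp L w lam 0 1 0 0)
    (hγ : Tendsto (fun c => γ c / w c) L (𝓝 g₀)) (hg₀ : 0 < g₀)
    (hlam' : ∀ᶠ c in L, 0 ≤ lam' c ∧ lam' c ≤ lam c) :
    ∀ᶠ c in L,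
      (∀ t, 0 < t → t ≤ δ →
        profile (w c) (A c) (κ c) (lam c) (γ c) (lam' c) t ≤ -(M / 4 * w c ^ 2)) ∧
      ConvexOn ℝ (Set.Ici δ) (profile (w c) (A c) (κ c) (lam c) (γ c) (lam' c)) ∧
      0 < profile (w c) (A c) (κ c) (lam c) (γ c) (lam' c) T := by
  have hM : 0 < M := by rw [← hδM]; positivity
  have hw1 : HasExp L w w 0 1 0 0 := HasExp.id
  have hE1 := HasExp.abs_le hw ((hκ.add (HasExp.const 1)).of_eq (b₀ := 0) (b₁ := 0) (b₂ := -M)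
    (b₃ := m₁) (by ring) (by ring) (by ring) (by ring)) (ε := M / 16) (by positivity)
  -- The tolerance is chosen so that `|λ - w| (δ + T + 1) ≤ M w² / 16`, which covers the drift up to
  -- `δ`, the drift at `T` and the boundary layer at once.
  have hE2 := HasExp.abs_le hw ((hlam.sub hw1).of_eq (b₀ := 0) (b₁ := 0) (b₂ := 0) (b₃ := 0)
    (by ring) (by ring) (by ring) (by ring)) (ε := M / (16 * (δ + T + 1))) (by positivity)
  have hγ1 : Tendsto γ L (𝓝 0) := by
    have h1 := hγ.mul hw
    rw [mul_zero] at h1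
    refine h1.congr' ?_
    filter_upwards [hw0] with c hc
    field_simp
  have hinv : Tendsto (fun c => p * (w c)⁻¹) L atTop :=
    ((tendsto_inv_nhdsGT_zero).comp (tendsto_nhdsWithin_iff.2 ⟨hw, hw0⟩)).const_mul_atTop hp
  have hsq : Tendsto (fun c => (p * (w c)⁻¹ * δ) ^ 2 * Real.exp (-(p * (w c)⁻¹ * δ))) L (𝓝 0) :=
    (Real.tendsto_pow_mul_exp_neg_atTop_nhds_zero 2).comp (hinv.atTop_mul_const hδ)
  -- With `γ ≤ 2 g₀ w` this is exactly what `profile_convexOn` requires at `δ`.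
  have hsmall : ∀ᶠ c in L, (p * (w c)⁻¹ * δ) ^ 2 * Real.exp (-(p * (w c)⁻¹ * δ))
      < δ ^ 2 / (2 * g₀) := hsq.eventually_lt_const (by positivity)
  filter_upwards [hw0, hA, hE1, hE2, hlam', hsmall,
    hγ.eventually_lt_const (show g₀ < 2 * g₀ by linarith),
    hγ.eventually_const_lt hg₀, hγ1.eventually_lt_const (show (0 : ℝ) < 1 by norm_num),
    hγ1.eventually_lt_const (show (0 : ℝ) < M * p * T / 16 by positivity),
    hw.eventually_lt_const (show (0 : ℝ) < 1 / δ by positivity)]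
    with c hwc hAc h1 h2 h3 h4 h5 h6 h7 h8 h9
  have hγ0 : 0 < γ c := by
    have := mul_pos h6 hwc
    rwa [div_mul_cancel₀ _ hwc.ne'] at this
  have hγw : γ c ≤ 2 * g₀ * w c := ((div_lt_iff₀ hwc).1 h5).le
  have hA0 : 0 < A c := by rw [hAc]; positivity
  have hw2 : 0 < w c ^ 2 := by positivity
  have hk := abs_le.1 h1
  have hS : |lam c - w c| * δ + |lam c - w c| * T + |lam c - w c| * 1 ≤ M / 16 * w c ^ 2 := by
    rw [zero_mul, sub_zero] at h2
    have := mul_le_mul_of_nonneg_right h2 (show 0 ≤ δ + T + 1 by positivity)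
    rw [← mul_add, ← mul_add]
    refine this.trans (le_of_eq ?_)
    field_simp
  have habs := abs_nonneg (lam c - w c)
  refine ⟨?_, ?_, ?_⟩
  · intro t ht0 ht
    have hwt : 0 < w c * t := mul_pos hwc ht0
    have hwt1 : w c * t ≤ 1 := by
      have : w c * δ < 1 := (lt_div_iff₀ hδ).1 h9
      have := mul_le_mul_of_nonneg_left ht hwc.le
      linarith
    have e1 : Real.exp (w c * t) ≤ 1 + w c * t + (w c * t) ^ 2 := by
      have := (abs_le.1 (Real.abs_exp_sub_one_sub_id_le (x := w c * t)
        (by rw [abs_of_pos hwt]; exact hwt1))).2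
      linarith
    -- This is where `2δ² = M` enters: up to `δ` the quadratic growth uses at most half of the
    -- deficit `M w²` contained in `κ`.
    have e2 : (w c * t) ^ 2 ≤ M / 2 * w c ^ 2 := by
      have : t ^ 2 ≤ δ ^ 2 := pow_le_pow_left₀ ht0.le ht 2
      calc (w c * t) ^ 2 = w c ^ 2 * t ^ 2 := by ring
        _ ≤ w c ^ 2 * δ ^ 2 := mul_le_mul_of_nonneg_left this hw2.le
        _ = M / 2 * w c ^ 2 := by rw [← hδM]; ring
    have e3 : (w c - lam c) * t ≤ |lam c - w c| * δ := by
      have i1 : w c - lam c ≤ |lam c - w c| := by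
        rw [abs_sub_comm]; exact le_abs_self _
      calc (w c - lam c) * t ≤ |lam c - w c| * t := mul_le_mul_of_nonneg_right i1 ht0.le
        _ ≤ |lam c - w c| * δ := mul_le_mul_of_nonneg_left ht habs
    -- Near `t = 0` the boundary layer is not exponentially small. It is harmless since `λ' ≤ λ`
    -- bounds the bracket by `λ - w`, which is of higher order.
    have e4 : γ c * Real.exp (-(A c * t)) * (lam' c * Real.exp (-(w c * t)) - w c)
        ≤ |lam c - w c| := by
      have i1 : lam' c * Real.exp (-(w c * t)) ≤ lam c := by
        have : Real.exp (-(w c * t)) ≤ 1 := Real.exp_le_one_iff.2 (by linarith)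
        calc lam' c * Real.exp (-(w c * t)) ≤ lam' c * 1 :=
              mul_le_mul_of_nonneg_left this h3.1
          _ ≤ lam c := by linarith [h3.2]
      have i2 : lam' c * Real.exp (-(w c * t)) - w c ≤ |lam c - w c| :=
        le_trans (by linarith) (le_abs_self _)
      have i3 : Real.exp (-(A c * t)) ≤ 1 :=
        Real.exp_le_one_iff.2 (by have := mul_pos hA0 ht0; linarith)
      have i4 : γ c * Real.exp (-(A c * t)) ≤ 1 := by
        have := Real.exp_pos (-(A c * t))
        nlinarith
      have i5 : 0 ≤ γ c * Real.exp (-(A c * t)) := by positivity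
      calc _ ≤ γ c * Real.exp (-(A c * t)) * |lam c - w c| := mul_le_mul_of_nonneg_left i2 i5
        _ ≤ 1 * |lam c - w c| := mul_le_mul_of_nonneg_right i4 habs
        _ = _ := one_mul _
    unfold profile
    have e5 : 0 ≤ |lam c - w c| * T := mul_nonneg habs hT.le
    have e6 : 0 < M * w c ^ 2 := mul_pos hM hw2
    linarith [hk.2]
  · refine profile_convexOn hwc hγ0.le h3.1 hA0.le hδ.le ?_
    have i1 : A c = p * (w c)⁻¹ := by rw [hAc, div_eq_mul_inv]
    rw [i1]
    rw [lt_div_iff₀ (by positivity)] at h4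
    have i2 : 0 < δ ^ 2 := by positivity
    have i3 : (p * (w c)⁻¹) ^ 2 * Real.exp (-(p * (w c)⁻¹ * δ)) * (2 * g₀) ≤ 1 := by
      by_contra hcon
      have := mul_lt_mul_of_pos_left (not_le.1 hcon) i2
      nlinarith
    have i4 : 0 ≤ (p * (w c)⁻¹) ^ 2 * Real.exp (-(p * (w c)⁻¹ * δ)) := by positivity
    calc γ c * (p * (w c)⁻¹) ^ 2 * Real.exp (-(p * (w c)⁻¹ * δ))
        = γ c * ((p * (w c)⁻¹) ^ 2 * Real.exp (-(p * (w c)⁻¹ * δ))) := by ring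
      _ ≤ 2 * g₀ * w c * ((p * (w c)⁻¹) ^ 2 * Real.exp (-(p * (w c)⁻¹ * δ))) :=
          mul_le_mul_of_nonneg_right hγw i4
      _ = w c * ((p * (w c)⁻¹) ^ 2 * Real.exp (-(p * (w c)⁻¹ * δ)) * (2 * g₀)) := by ring
      _ ≤ w c * 1 := mul_le_mul_of_nonneg_left i3 hwc.le
      _ = w c := mul_one _
  · have e1 : 1 + w c * T + (w c * T) ^ 2 / 2 ≤ Real.exp (w c * T) :=
      Real.quadratic_le_exp_of_nonneg (by positivity)
    have e2 : -(|lam c - w c| * T) ≤ (w c - lam c) * T := by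
      have i1 : -|lam c - w c| ≤ w c - lam c := by
        have := le_abs_self (lam c - w c)
        linarith
      have := mul_le_mul_of_nonneg_right i1 hT.le
      linarith
    have e3 : γ c * Real.exp (-(A c * T)) * w c ≤ M / 16 * w c ^ 2 := by
      have i1 : Real.exp (-(A c * T)) ≤ w c / (p * T) := by
        have i2 : A c * T ≤ Real.exp (A c * T) := by
          have := Real.add_one_le_exp (A c * T)
          linarith
        rw [Real.exp_neg, inv_eq_one_div, div_le_div_iff₀ (Real.exp_pos _) (by positivity)]
        have i3 : w c * (A c * T) = p * T := by rw [hAc]; field_simp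
        have := mul_le_mul_of_nonneg_left i2 hwc.le
        linarith
      calc γ c * Real.exp (-(A c * T)) * w c ≤ (M * p * T / 16) * (w c / (p * T)) * w c := by
            gcongr
        _ = M / 16 * w c ^ 2 := by field_simp
    have e4 : 0 ≤ γ c * Real.exp (-(A c * T)) * (lam' c * Real.exp (-(w c * T))) :=
      mul_nonneg (by positivity) (mul_nonneg h3.1 (Real.exp_pos _).le)
    -- `T² ≥ 4M` makes the quadratic gain at `T` at least twice the deficit `M w²`.
    have e5 : 2 * M * w c ^ 2 ≤ (w c * T) ^ 2 / 2 := by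
      have := mul_le_mul_of_nonneg_right hTM hw2.le
      linarith
    have e6 : 0 ≤ |lam c - w c| * δ := mul_nonneg habs hδ.le
    have e7 : 0 < M * w c ^ 2 := mul_pos hM hw2
    unfold profile
    linarith [hk.1]

end Profile

/-! ### Expansions of the root ratios and of the optimal threshold. -/

section Asymptotics

lemma coreOpt_scaling {a p w n m l u e F : ℝ} (hw : w ≠ 0) (hl : l = p * n / w) (hu : u = w * m) :
    w * coreOpt a w l u e F = a * F * (m - 1) * (p * n + w ^ 2) * (p * n + w ^ 2 * m)
      - (1 - a) * ((p * n + w ^ 2) * (p * n) - e * w ^ 4 * m * (m - 1)) := by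
  rw [coreOpt_eq, hl, hu]
  field_simp

variable {L : Filter ℝ} {w n m l u F e y Y : ℝ → ℝ} {a K p : ℝ}

/-- Bootstrap: `n` appears on the right only as `w²/n`, so knowing `1/n` up to `O(w²)` gives `n` up
to `O(w⁴)`. The relation itself first gives `n` up to `O(w²)`, hence `1/n` to the same order. -/
lemma hasExp_ratio (ha0 : 0 < a) (hp : 0 < p) (hw : Tendsto w L (𝓝 0))
    (hlim : Tendsto n L (𝓝 a))
    (hrel : ∀ᶠ c in L, p * n c = a * p - (1 - a) * (K * p) * w c + w c ^ 2 / n c - a * w c ^ 2) :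
    HasExp L w n a (-K + a * K) (1 / (a * p) - a / p) (K / (a ^ 2 * p) - K / (a * p)) := by
  have hn0 : ∀ᶠ c in L, n c ≠ 0 := hlim.eventually_ne ha0.ne'
  have hinv : (fun c => (n c)⁻¹) =O[L] fun _ => (1 : ℝ) :=
    (hlim.inv₀ ha0.ne').isBigO_one ℝ
  have hw1 : w =O[L] fun _ => (1 : ℝ) := hw.isBigO_one ℝ
  have h2 : (fun c => n c - a + (1 - a) * K * w c) =O[L] fun c => w c ^ 2 := by
    have h := ((hinv.sub (isBigO_const_const a (one_ne_zero' ℝ) L)).const_mul_left (1 / p)).mul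
      (isBigO_refl (fun c => w c ^ 2) L)
    simp only [one_mul] at h
    refine IsBigO.congr' h ?_ EventuallyEq.rfl
    filter_upwards [hrel, hn0] with c hc hc0
    have : n c = (a * p - (1 - a) * (K * p) * w c + w c ^ 2 / n c - a * w c ^ 2) / p := by
      rw [← hc]; field_simp
    have h3 : n c - a + (1 - a) * K * w c = (w c ^ 2 / n c - a * w c ^ 2) / p := by
      rw [eq_div_iff hp.ne']
      linear_combination hc
    rw [h3]
    field_simp
  have h1 : (fun c => n c - a) =O[L] w := by
    have h3 : (fun c => w c ^ 2) =O[L] w := by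
      have := hw1.mul (isBigO_refl w L)
      simp only [one_mul] at this
      refine this.congr_left fun c => ?_
      ring
    refine ((h2.trans h3).sub ((isBigO_refl w L).const_mul_left ((1 - a) * K))).congr_left
      fun c => ?_
    ring
  have h3 : (fun c => (n c)⁻¹ - (1 / a + (1 - a) * K / a ^ 2 * w c)) =O[L] fun c => w c ^ 2 := by
    have h4 := (h1.pow 2).mul hinv
    simp only [mul_one] at h4
    refine IsBigO.congr' ((h4.const_mul_left (1 / a ^ 2)).sub (h2.const_mul_left (1 / a ^ 2))) ?_
      EventuallyEq.rfl
    filter_upwards [hn0] with c hc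
    field_simp
    ring
  have h4 := (h3.mul (isBigO_refl (fun c => w c ^ 2) L)).const_mul_left (1 / p)
  have h5 : (fun c => w c ^ 2 * w c ^ 2) = fun c => w c ^ 4 := by
    funext c; ring
  rw [h5] at h4
  refine IsBigO.congr' h4 ?_ EventuallyEq.rfl
  filter_upwards [hrel, hn0] with c hc hc0
  rw [div_eq_mul_inv] at hc
  generalize (n c)⁻¹ = i at *
  have h6 : n c = a - (1 - a) * K * w c + (w c ^ 2 * i - a * w c ^ 2) / p := by
    apply mul_left_cancel₀ hp.ne'
    rw [hc]
    field_simp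
    ring
  rw [h6]
  field_simp
  ring

lemma hasExp_ratio_inv (ha0 : 0 < a) (hp : 0 < p) (hw : Tendsto w L (𝓝 0))
    (hn : HasExp L w n a (-K + a * K) (1 / (a * p) - a / p) (K / (a ^ 2 * p) - K / (a * p)))
    (hm : ∀ᶠ c in L, n c * m c = 1) :
    HasExp L w m (1 / a) (K / a ^ 2 - K / a) (-(1 / (a ^ 3 * p)) + K ^ 2 / a ^ 3 - 2 * K ^ 2 / a ^ 2 + 1 / (a * p) + K ^ 2 / a) (-(3 * K / (a ^ 4 * p)) + K ^ 3 / a ^ 4 + 3 * K / (a ^ 3 * p) - 3 * K ^ 3 / a ^ 3 + 2 * K / (a ^ 2 * p) + 3 * K ^ 3 / a ^ 2 - 2 * K / (a * p) - K ^ 3 / a) := by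
  refine HasExp.of_mul hw hn (HasExp.const 1) ha0.ne' hm ?_ ?_ ?_ ?_
  all_goals (try field_simp) <;> ring

/-- The leading coefficient has the sign of `K - b`, which locates the zero of the optimality
condition near `K`. -/
lemma hasExp_optFun (hp : 0 < p) (ha0 : 0 < a) (hw : Tendsto w L (𝓝 0))
    (hw0 : ∀ᶠ c in L, 0 < w c)
    (hn : HasExp L w n a (-K + a * K) (1 / (a * p) - a / p) (K / (a ^ 2 * p) - K / (a * p)))
    (hm : HasExp L w m (1 / a) (K / a ^ 2 - K / a) (-(1 / (a ^ 3 * p)) + K ^ 2 / a ^ 3 - 2 * K ^ 2 / a ^ 2 + 1 / (a * p) + K ^ 2 / a) (-(3 * K / (a ^ 4 * p)) + K ^ 3 / a ^ 4 + 3 * K / (a ^ 3 * p) - 3 * K ^ 3 / a ^ 3 + 2 * K / (a ^ 2 * p) + 3 * K ^ 3 / a ^ 2 - 2 * K / (a * p) - K ^ 3 / a))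
    (hl : ∀ᶠ c in L, l c = p * n c / w c) (hu : ∀ᶠ c in L, u c = w c * m c) {b : ℝ} (hb : 0 < b) :
    ∃ a₂ a₃, HasExp L w (fun c => w c * optFun a (w c) (l c) (u c) b) 0
      (a * p ^ 2 * (1 - a) * (K - b)) a₂ a₃ := by
  have hw1 : HasExp L w w 0 1 0 0 := HasExp.id
  have hw2 : HasExp L w (fun c => w c ^ 2) 0 0 1 0 := HasExp.sq
  have hF := ((((hw1.mul hw hm).mul hw (HasExp.const b)).neg).of_eq (b₀ := 0) (by ring) rfl rfl
    rfl).exp hw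
  have hm0 := hm.tendsto hw
  have hn0 := hn.tendsto hw
  have hE : HasExp L w (fun c => Real.exp (-((l c + u c) * b)) * w c ^ 4 * m c * (m c - 1))
      0 0 0 0 := by
    have h1 : (fun c => Real.exp (-((l c + u c) * b))) =O[L] fun _ => (1 : ℝ) := by
      refine IsBigO.of_bound 1 ?_
      filter_upwards [hl, hu, hw0, hm0.eventually_const_lt (show 0 < 1 / a by positivity),
        hn0.eventually_const_lt ha0] with c h1 h2 h3 h4 h5
      rw [Real.norm_eq_abs, abs_of_pos (Real.exp_pos _), norm_one, mul_one, Real.exp_le_one_iff,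
        h1, h2, neg_nonpos]
      positivity
    have h2 := (h1.mul ((hm0.mul (hm0.sub_const 1)).isBigO_one ℝ)).mul
      (isBigO_refl (fun c => w c ^ 4) L)
    simp only [one_mul] at h2
    refine h2.congr_left fun c => ?_
    ring
  have hpn := ((HasExp.const p).mul hw hn).add hw2
  have hG := ((HasExp.const p).mul hw hn).add (hw2.mul hw hm)
  have h1 := (((((HasExp.const a).mul hw hF).mul hw (hm.sub (HasExp.const 1))).mul hw hpn).mul
    hw hG).sub ((HasExp.const (1 - a)).mul hw ((hpn.mul hw ((HasExp.const p).mul hw hn)).sub hE))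
  refine ⟨_, _, (h1.of_eq ?_ ?_ rfl rfl).congr ?_⟩
  · field_simp
    ring
  · field_simp
    ring
  · filter_upwards [hl, hu, hw0] with c h1 h2 h3
    rw [optFun, coreOpt_scaling h3.ne' h1 h2, h2]

lemma HasExp.eventually_pos {f : ℝ → ℝ} {a₁ a₂ a₃ : ℝ} (hw : Tendsto w L (𝓝 0))
    (hw0 : ∀ᶠ c in L, 0 < w c) (hf : HasExp L w f 0 a₁ a₂ a₃) (h : 0 < a₁) :
    ∀ᶠ c in L, 0 < f c := by
  have h1 : HasExp L w (fun c => w c * (a₁ + a₂ * w c + a₃ * w c ^ 2)) 0 a₁ a₂ a₃ :=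
    HasExp.of_exact fun c => by ring
  have h2 := (hf.sub h1).of_eq (b₀ := 0) (b₁ := 0) (b₂ := 0) (b₃ := 0) (by ring) (by ring)
    (by ring) (by ring)
  have h3 : (fun c => f c - w c * (a₁ + a₂ * w c + a₃ * w c ^ 2)) =o[L] w := by
    have h4 : (fun c => w c ^ 4) =o[L] w := by
      have h5 : (fun c => w c ^ 3) =o[L] fun _ => (1 : ℝ) :=
        (isLittleO_one_iff ℝ).2 (by simpa using hw.pow 3)
      have := (isBigO_refl w L).mul_isLittleO h5
      simp only [mul_one] at this
      refine this.congr_left fun c => ?_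
      ring
    refine IsBigO.trans_isLittleO (g := fun c => w c ^ 4) ?_ h4
    refine IsBigO.congr_left h2 fun c => ?_
    ring
  have h4 : Tendsto (fun c => a₁ + a₂ * w c + a₃ * w c ^ 2) L (𝓝 (a₁ + a₂ * 0 + a₃ * 0 ^ 2)) :=
    (tendsto_const_nhds.add (hw.const_mul a₂)).add ((hw.pow 2).const_mul a₃)
  filter_upwards [h3.bound (show 0 < a₁ / 4 by positivity), hw0,
    h4.eventually_const_lt (show a₁ / 2 < a₁ + a₂ * 0 + a₃ * 0 ^ 2 by linarith)] with c h5 h6 h7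
  rw [Real.norm_eq_abs, Real.norm_eq_abs, abs_of_pos h6] at h5
  have h8 := (_root_.abs_le.1 h5).1
  have h9 := mul_lt_mul_of_pos_left h7 h6
  have h10 : 0 < a₁ * w c := mul_pos h h6
  nlinarith

/-- A lower bound on `y` makes `e` smaller than any power of `w`. The optimality condition is then a
linear equation for `F = e^{-uy}` with expandable coefficients, and `y` is recovered from the
logarithm of `F`. -/
lemma threshold_expansions (hp : 0 < p) (ha0 : 0 < a) (ha1 : a < 1) (hK : 0 < K)
    (hw : Tendsto w L (𝓝 0)) (hw0 : ∀ᶠ c in L, 0 < w c)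
    (hn : HasExp L w n a (-K + a * K) (1 / (a * p) - a / p) (K / (a ^ 2 * p) - K / (a * p)))
    (hm : HasExp L w m (1 / a) (K / a ^ 2 - K / a) (-(1 / (a ^ 3 * p)) + K ^ 2 / a ^ 3 - 2 * K ^ 2 / a ^ 2 + 1 / (a * p) + K ^ 2 / a) (-(3 * K / (a ^ 4 * p)) + K ^ 3 / a ^ 4 + 3 * K / (a ^ 3 * p) - 3 * K ^ 3 / a ^ 3 + 2 * K / (a ^ 2 * p) + 3 * K ^ 3 / a ^ 2 - 2 * K / (a * p) - K ^ 3 / a))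
    (hl : ∀ᶠ c in L, l c = p * n c / w c) (hu : ∀ᶠ c in L, u c = w c * m c)
    (hy : ∀ᶠ c in L, K / 2 ≤ y c)
    (hopt : ∀ᶠ c in L, optFun a (w c) (l c) (u c) (y c) = 0) :
    HasExp L w (fun c => Real.exp (-((l c + u c) * y c)) / w c ^ 2) 0 0 0 0 ∧
    HasExp L w (fun c => Real.exp (-(u c * y c))) 1 (-(K / a)) (1 / (a * p) + K ^ 2 / a) (-(2 * K / (a * p)) - K ^ 3 / a) ∧
    HasExp L w (fun c => w c * y c) 0 K (-(K ^ 2 / (2 * a)) - 1 / p) (K / (a ^ 2 * p) - K ^ 3 / (6 * a ^ 2) + K ^ 3 / (2 * a)) := by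
  have hw1 : HasExp L w w 0 1 0 0 := HasExp.id
  have hw2 : HasExp L w (fun c => w c ^ 2) 0 0 1 0 := HasExp.sq
  have hm0 := hm.tendsto hw
  have hn0 := hn.tendsto hw
  -- Sixth order, so that `O(w⁴)` remains after division by `w²`.
  have hexp : (fun c => Real.exp (-((l c + u c) * y c))) =O[L] fun c => w c ^ 6 := by
    refine exp_neg_div_isBigO_pow hw hw0 (κ := p * (a / 2) * (K / 2)) (by positivity) ?_ 6
    filter_upwards [hl, hu, hw0, hm0.eventually_const_lt (show 0 < 1 / a by positivity),
      hn0.eventually_const_lt (show a / 2 < a by linarith), hy] with c h1 h2 h3 h4 h5 h6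
    have h7 : p * (a / 2) / w c ≤ l c + u c := by
      have h8 : p * (a / 2) / w c ≤ p * n c / w c := by gcongr
      have h9 : 0 ≤ w c * m c := by positivity
      rw [h1, h2]
      linarith
    have h8 : 0 ≤ p * (a / 2) / w c := by positivity
    calc p * (a / 2) * (K / 2) / w c = p * (a / 2) / w c * (K / 2) := by ring
      _ ≤ (l c + u c) * y c := mul_le_mul h7 h6 (by positivity) (h8.trans h7)
  have hε : HasExp L w (fun c => Real.exp (-((l c + u c) * y c)) / w c ^ 2) 0 0 0 0 := by
    have h1 := hexp.mul (isBigO_refl (fun c => (w c ^ 2)⁻¹) L)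
    refine IsBigO.congr' h1 (Eventually.of_forall fun c => ?_) ?_
    · ring
    · filter_upwards [hw0] with c hc
      field_simp
  have hE : HasExp L w (fun c => Real.exp (-((l c + u c) * y c)) * w c ^ 4 * m c * (m c - 1))
      0 0 0 0 := by
    refine ((((hε.mul hw (hw2.mul hw (hw2.mul hw hw2))).mul hw hm).mul hw
      (hm.sub (HasExp.const 1))).of_eq ?_ ?_ ?_ ?_).congr ?_
    · ring
    · ring
    · ring
    · ring
    · filter_upwards [hw0] with c hc
      field_simp
  have hpn := ((HasExp.const p).mul hw hn).add hw2
  have hG := ((HasExp.const p).mul hw hn).add (hw2.mul hw hm)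
  have hF : HasExp L w (fun c => Real.exp (-(u c * y c))) 1 (-(K / a)) (1 / (a * p) + K ^ 2 / a) (-(2 * K / (a * p)) - K ^ 3 / a) := by
    refine HasExp.of_mul hw (g := fun c => a * (m c - 1) * (p * n c + w c ^ 2)
      * (p * n c + w c ^ 2 * m c)) (h := fun c => (1 - a) * ((p * n c + w c ^ 2) * (p * n c)
        - Real.exp (-((l c + u c) * y c)) * w c ^ 4 * m c * (m c - 1)))
      (((((HasExp.const a).mul hw (hm.sub (HasExp.const 1))).mul hw hpn).mul hw hG).of_eq
        (b₀ := a ^ 2 * p ^ 2 - a ^ 3 * p ^ 2) (b₁ := -(a * K * p ^ 2) + 3 * a ^ 2 * K * p ^ 2 - 2 * a ^ 3 * K * p ^ 2) (b₂ := 2 * p - 2 * a * p - a * K ^ 2 * p ^ 2 - 2 * a ^ 2 * p + 2 * a ^ 2 * K ^ 2 * p ^ 2 + 2 * a ^ 3 * p - a ^ 3 * K ^ 2 * p ^ 2) (b₃ := 2 * K * p / a - 2 * K * p + a * K * p - 3 * a ^ 2 * K * p + 2 * a ^ 3 * K * p) ?_ ?_ ?_ ?_)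
      (((HasExp.const (1 - a)).mul hw
        ((hpn.mul hw ((HasExp.const p).mul hw hn)).sub hE)).of_eq
        (b₀ := a ^ 2 * p ^ 2 - a ^ 3 * p ^ 2) (b₁ := -(2 * a * K * p ^ 2) + 4 * a ^ 2 * K * p ^ 2 - 2 * a ^ 3 * K * p ^ 2) (b₂ := 2 * p + K ^ 2 * p ^ 2 - a * p - 3 * a * K ^ 2 * p ^ 2 - 3 * a ^ 2 * p + 3 * a ^ 2 * K ^ 2 * p ^ 2 + 2 * a ^ 3 * p - a ^ 3 * K ^ 2 * p ^ 2) (b₃ := -(K * p) + 4 * a * K * p - 5 * a ^ 2 * K * p + 2 * a ^ 3 * K * p) ?_ ?_ ?_ ?_) ?_ ?_ ?_ ?_ ?_ ?_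
    · field_simp
      ring
    · field_simp
      ring
    · field_simp
      ring
    · field_simp
      ring
    · ring
    · ring
    · field_simp
      ring
    · field_simp
      ring
    · have : 0 < a ^ 2 * p ^ 2 * (1 - a) := mul_pos (by positivity) (by linarith)
      linarith
    · filter_upwards [hl, hu, hw0, hopt] with c h1 h2 h3 h4
      have h5 := coreOpt_scaling (a := a) (p := p) (e := Real.exp (-((l c + u c) * y c)))
        (F := Real.exp (-(u c * y c))) h3.ne' h1 h2
      rw [optFun] at h4
      rw [h4, mul_zero] at h5
      linear_combination -h5
    all_goals (try field_simp) <;> ring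
  refine ⟨hε, hF, ?_⟩
  -- `m · (w y) = u y = -log F`.
  refine HasExp.of_mul hw hm (hF.log hw).neg (by positivity) ?_ ?_ ?_ ?_ ?_
  · filter_upwards [hu] with c hc
    rw [Real.log_exp, hc]
    ring
  all_goals (try field_simp) <;> ring

end Asymptotics

/-! ### Implicit functions identified by uniqueness. -/

section Smoothness

/-- A function that is locally the only zero of a smooth function of two real variables with
nonvanishing second partial derivative is smooth. -/
lemma contDiffAt_of_unique_zero {n : WithTop ℕ∞} (hn : n ≠ 0) {G : ℝ × ℝ → ℝ} {f : ℝ → ℝ}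
    {c₀ d : ℝ} {U : Set ℝ} (hG : ContDiffAt ℝ n G (c₀, f c₀))
    (hd : HasDerivAt (fun x => G (c₀, x)) d (f c₀)) (hd0 : d ≠ 0) (hU : U ∈ 𝓝 (f c₀))
    (hzero : G (c₀, f c₀) = 0)
    (huniq : ∀ᶠ c in 𝓝 c₀, ∀ x ∈ U, G (c, x) = 0 → x = f c) : ContDiffAt ℝ n f c₀ := by
  have hfd : HasFDerivAt G (fderiv ℝ G (c₀, f c₀)) (c₀, f c₀) :=
    (hG.differentiableAt hn).hasFDerivAt
  -- In one dimension the partial derivative is multiplication by `d ≠ 0`, hence invertible.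
  have h1 : fderiv ℝ G (c₀, f c₀) ∘L .inr ℝ ℝ ℝ
      = ((ContinuousLinearEquiv.unitsEquivAut ℝ (Units.mk0 d hd0) : ℝ ≃L[ℝ] ℝ) : ℝ →L[ℝ] ℝ) := by
    ext
    have h2 := (hfd.comp (f c₀) (hasFDerivAt_prodMk_right c₀ (f c₀))).hasDerivAt.unique hd
    simpa using h2
  have hinv : (fderiv ℝ G (c₀, f c₀) ∘L .inr ℝ ℝ ℝ).IsInvertible := ⟨_, h1.symm⟩
  have hψ := hG.contDiffAt_implicitFunction hn hinv
  have hself := hG.implicitFunction_apply_self hn hinv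
  have hev := hG.eventually_apply_implicitFunction hn hinv
  simp only at hψ hself hev
  refine hψ.congr_of_eventuallyEq ?_
  have hcont : ∀ᶠ c in 𝓝 c₀, hG.implicitFunction hn hinv c ∈ U := by
    apply hψ.continuousAt
    rwa [hself]
  -- The implicit branch stays in `U` near `c₀`, where `f c` is the only zero, so it equals `f`.
  filter_upwards [hev, hcont, huniq] with c h2 h3 h4
  exact (h4 _ h3 (by rw [h2, hzero])).symm

end Smoothness

/-! ### The profile at actual parameters: positivity and smooth dependence. -/

section Concrete

/-- The absolute value of the negative root. -/
def decay (μ σ q r : ℝ) : ℝ := -theta2 μ σ q r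

/-- The optimality condition of the threshold `b`. -/
def optAt (μ σ q a c b : ℝ) : ℝ :=
  optFun a (decay μ σ q c) (theta1 μ σ q (a * c)) (decay μ σ q (a * c)) b

open Classical in
/-- The positive zero of the optimality condition (and `0` if there is none). -/
def threshold (μ σ q a c : ℝ) : ℝ :=
  if h : ∃ b, 0 < b ∧ optAt μ σ q a c b = 0 then h.choose else 0

def expE (μ σ q a y c : ℝ) : ℝ :=
  Real.exp (-((theta1 μ σ q (a * c) + decay μ σ q (a * c)) * y))

def expF (μ σ q a y c : ℝ) : ℝ := Real.exp (-(decay μ σ q (a * c) * y))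

def alphaAt (μ σ q a y c : ℝ) : ℝ :=
  coreAlpha (decay μ σ q c) (theta1 μ σ q (a * c)) (decay μ σ q (a * c)) (expE μ σ q a y c)

def betaAt (μ σ q a y c : ℝ) : ℝ :=
  coreBeta (theta1 μ σ q c) (theta1 μ σ q (a * c)) (decay μ σ q (a * c)) (expE μ σ q a y c)

def b11At (μ σ q a y c : ℝ) : ℝ :=
  coreB11 (theta1 μ σ q c) (decay μ σ q c) (theta1 μ σ q (a * c)) (decay μ σ q (a * c))
    (expE μ σ q a y c)

def etaAt (μ σ q a y c : ℝ) : ℝ :=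
  coreEta a (c * (2 / σ ^ 2)) (theta1 μ σ q c) (decay μ σ q c) (theta1 μ σ q (a * c))
    (decay μ σ q (a * c)) (expE μ σ q a y c) (expF μ σ q a y c)

def K1At (μ σ q a y c : ℝ) : ℝ :=
  coreK1 (theta1 μ σ q c) (decay μ σ q c) (theta1 μ σ q (a * c)) (decay μ σ q (a * c))
    (expE μ σ q a y c)

def kappaAt (μ σ q a y c : ℝ) : ℝ :=
  coreKappa a (c * (2 / σ ^ 2)) (theta1 μ σ q c) (decay μ σ q c) (theta1 μ σ q (a * c))
    (decay μ σ q (a * c)) (expE μ σ q a y c) (expF μ σ q a y c) y / K1At μ σ q a y c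

def lamAt (μ σ q a y c : ℝ) : ℝ :=
  etaAt μ σ q a y c
    / ((theta1 μ σ q c + decay μ σ q c) * theta1 μ σ q c * b11At μ σ q a y c)

def gamAt (μ σ q a y c : ℝ) : ℝ :=
  betaAt μ σ q a y c / (theta1 μ σ q c * alphaAt μ σ q a y c)

def lamAt' (μ σ q a y c : ℝ) : ℝ :=
  etaAt μ σ q a y c / ((theta1 μ σ q c + decay μ σ q c) ^ 2 * b11At μ σ q a y c)

/-- The profile of `C₀` at distance `t` from `y`. -/
def profileAt (μ σ q a y c t : ℝ) : ℝ :=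
  profile (decay μ σ q c) (theta1 μ σ q c) (kappaAt μ σ q a y c) (lamAt μ σ q a y c)
    (gamAt μ σ q a y c) (lamAt' μ σ q a y c) t

variable {μ σ q a c y : ℝ}

lemma decay_pos (hσ : 0 < σ) (hq : 0 < q) (r : ℝ) : 0 < decay μ σ q r :=
  neg_pos.2 (theta2_neg hσ hq r)

lemma decay_lt (hσ : 0 < σ) (hq : 0 < q) (ha1 : a < 1) (hc : 0 < c) :
    decay μ σ q c < decay μ σ q (a * c) :=
  neg_lt_neg (theta2_strictMono hσ hq (by nlinarith))

lemma alphaAt_pos (hσ : 0 < σ) (hq : 0 < q) (ha1 : a < 1) (hc : 0 < c) :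
    0 < alphaAt μ σ q a y c := by
  have h1 := decay_pos (μ := μ) hσ hq c
  have h2 := decay_lt (μ := μ) hσ hq ha1 hc
  have h3 := theta1_pos (μ := μ) hσ hq (a * c)
  have h4 : 0 < expE μ σ q a y c := Real.exp_pos _
  have h5 := mul_pos h4 (sub_pos.2 h2)
  unfold alphaAt coreAlpha
  linarith

lemma b11At_pos (hσ : 0 < σ) (hq : 0 < q) (ha1 : a < 1) (hc : 0 < c) :
    0 < b11At μ σ q a y c := by
  have h1 := decay_pos (μ := μ) hσ hq c
  have h2 := sub_pos.2 (decay_lt (μ := μ) hσ hq ha1 hc)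
  have h3 := theta1_pos (μ := μ) hσ hq (a * c)
  have h4 : 0 < expE μ σ q a y c := Real.exp_pos _
  have h5 := theta1_pos (μ := μ) hσ hq c
  have h6 := sub_pos.2 (theta1_strictMono (μ := μ) hσ hq (show a * c < c by nlinarith))
  have h7 := decay_pos (μ := μ) hσ hq (a * c)
  unfold b11At coreB11
  positivity

lemma K1At_pos (hσ : 0 < σ) (hq : 0 < q) (ha1 : a < 1) (hc : 0 < c) :
    0 < K1At μ σ q a y c := by
  have h1 := decay_pos (μ := μ) hσ hq c
  have h2 := theta1_pos (μ := μ) hσ hq c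
  have h3 : 0 < coreAlpha _ _ _ _ := alphaAt_pos (μ := μ) (y := y) hσ hq ha1 hc
  have h4 : 0 < coreB11 _ _ _ _ _ := b11At_pos (μ := μ) (y := y) hσ hq ha1 hc
  unfold K1At coreK1
  positivity

lemma etaAt_nonneg (hσ : 0 < σ) (hq : 0 < q) (ha0 : 0 < a) (ha1 : a < 1) (hc : 0 < c)
    (hβ : 0 < betaAt μ σ q a y c) : 0 ≤ etaAt μ σ q a y c := by
  have h1 := decay_pos (μ := μ) hσ hq c
  have h3 := theta1_pos (μ := μ) hσ hq (a * c)
  have h4 : 0 < expE μ σ q a y c := Real.exp_pos _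
  have h4' : 0 < expF μ σ q a y c := Real.exp_pos _
  have h5 := theta1_pos (μ := μ) hσ hq c
  have h6 := sub_pos.2 (theta1_strictMono (μ := μ) hσ hq (show a * c < c by nlinarith))
  have h7 := decay_pos (μ := μ) hσ hq (a * c)
  have h8 : 0 < 1 - a + a * expF μ σ q a y c := by
    have := mul_pos ha0 h4'
    linarith
  unfold betaAt at hβ
  unfold etaAt coreEta coreRho
  positivity

/-- `λ' = λ A / (A + w)`, and `η ≥ 0` once `β > 0`. -/
lemma lamAt'_bounds (hσ : 0 < σ) (hq : 0 < q) (ha0 : 0 < a) (ha1 : a < 1) (hc : 0 < c)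
    (hβ : 0 < betaAt μ σ q a y c) :
    0 ≤ lamAt' μ σ q a y c ∧ lamAt' μ σ q a y c ≤ lamAt μ σ q a y c := by
  have h1 := decay_pos (μ := μ) hσ hq c
  have h2 := theta1_pos (μ := μ) hσ hq c
  have h3 := b11At_pos (μ := μ) (y := y) hσ hq ha1 hc
  have h4 := etaAt_nonneg (μ := μ) (y := y) hσ hq ha0 ha1 hc hβ
  refine ⟨by unfold lamAt'; positivity, ?_⟩
  unfold lamAt' lamAt
  gcongr
  nlinarith

/-- Zeros of `C₀` beyond an optimal threshold are the zeros of the profile. -/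
lemma C0_eq_zero_iff (hσ : 0 < σ) (hq : 0 < q) (ha1 : a < 1) (hc : 0 < c)
    (hβ : 0 < betaAt μ σ q a y c) (hopt : optAt μ σ q a c y = 0) (t : ℝ) :
    C0 μ σ q a y (y + t) c = 0 ↔ profileAt μ σ q a y c t = 0 := by
  have h1 := decay_pos (μ := μ) hσ hq c
  have h2 := theta1_pos (μ := μ) hσ hq c
  have hα := alphaAt_pos (μ := μ) (y := y) hσ hq ha1 hc
  have hb := b11At_pos (μ := μ) (y := y) hσ hq ha1 hc
  have hK := K1At_pos (μ := μ) (y := y) hσ hq ha1 hc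
  have he : expF μ σ q a y c = expE μ σ q a y c * Real.exp (y * theta1 μ σ q (a * c)) := by
    unfold expF expE
    rw [← Real.exp_add]
    ring_nf
  have hF : expF μ σ q a y c = Real.exp (-(y * decay μ σ q (a * c))) := by
    unfold expF
    ring_nf
  have hd : 0 < Real.exp (t * theta1 μ σ q c) * alphaAt μ σ q a y c
      + Real.exp (-(t * decay μ σ q c)) * betaAt μ σ q a y c := by positivity
  rw [C0_eq (w := decay μ σ q c) (u := decay μ σ q (a * c)) (c := c) (t := t) hσ hq rfl rfl rfl rfl rfl hF he hopt hd,
    coreNum_eq_mul_profile h2.ne' (by positivity) hα.ne' hb.ne', ← mul_assoc]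
  have hpos : Real.exp (t * theta1 μ σ q c) * Real.exp (-(t * decay μ σ q c)) /
      (Real.exp (t * theta1 μ σ q c) * alphaAt μ σ q a y c
        + Real.exp (-(t * decay μ σ q c)) * betaAt μ σ q a y c) ^ 2 * K1At μ σ q a y c ≠ 0 := by
    positivity
  exact mul_eq_zero_iff_left hpos

lemma optAt_strictAnti (hσ : 0 < σ) (hq : 0 < q) (ha0 : 0 < a) (ha1 : a < 1) (hc : 0 < c) :
    StrictAnti (optAt μ σ q a c) :=
  optFun_strictAnti ha0 ha1 (decay_pos hσ hq c) (theta1_pos hσ hq _) (decay_lt hσ hq ha1 hc)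

lemma optAt_hasDerivAt (hσ : 0 < σ) (hq : 0 < q) (ha0 : 0 < a) (ha1 : a < 1) (hc : 0 < c)
    (b : ℝ) : ∃ d, d < 0 ∧ HasDerivAt (optAt μ σ q a c) d b := by
  have hw := decay_pos (μ := μ) hσ hq c
  have hu := decay_pos (μ := μ) hσ hq (a * c)
  have hl := theta1_pos (μ := μ) hσ hq (a * c)
  have huw := sub_pos.2 (decay_lt (μ := μ) hσ hq ha1 hc)
  have h : optAt μ σ q a c = fun b =>
      coreOpt a (decay μ σ q c) (theta1 μ σ q (a * c)) (decay μ σ q (a * c))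
        (Real.exp (-((theta1 μ σ q (a * c) + decay μ σ q (a * c)) * b)))
        (Real.exp (-(decay μ σ q (a * c) * b))) := rfl
  rw [h]
  simp only [coreOpt_eq]
  generalize decay μ σ q (a * c) = u at *
  generalize decay μ σ q c = w at *
  generalize theta1 μ σ q (a * c) = l at *
  have he := fun k : ℝ => ((hasDerivAt_id b).const_mul k).neg.exp
  have h1 := ((((((he u).const_mul a).mul_const (u - w)).mul_const (l + w)).mul_const
    (l + u))).sub (((((((he (l + u)).mul_const u).mul_const (u - w)).const_sub
      ((l + w) * l)).const_mul ((1 - a) * w))))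
  refine ⟨-(u * a * Real.exp (-(u * b)) * (u - w) * (l + w) * (l + u)
    + (1 - a) * w * ((l + u) * Real.exp (-((l + u) * b)) * u * (u - w))), ?_,
    h1.congr_deriv ?_⟩
  · have : 0 < 1 - a := by linarith
    rw [neg_lt_zero]
    positivity
  · simp only [id, Pi.neg_apply]
    ring

lemma threshold_eq (hσ : 0 < σ) (hq : 0 < q) (ha0 : 0 < a) (ha1 : a < 1) (hc : 0 < c) {b : ℝ}
    (hb : 0 < b) (hopt : optAt μ σ q a c b = 0) : threshold μ σ q a c = b := by
  have h : ∃ b, 0 < b ∧ optAt μ σ q a c b = 0 := ⟨b, hb, hopt⟩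
  rw [threshold, dif_pos h]
  exact (optAt_strictAnti (μ := μ) hσ hq ha0 ha1 hc).injective (h.choose_spec.2.trans hopt.symm)

lemma contDiff_decay (hσ : 0 < σ) (hq : 0 < q) {n : WithTop ℕ∞} :
    ContDiff ℝ n (decay μ σ q) := (contDiff_theta2 hσ hq).neg

lemma contDiffAt_threshold (hσ : 0 < σ) (hq : 0 < q) (ha0 : 0 < a) (ha1 : a < 1) (hc : 0 < c)
    (hpos : 0 < threshold μ σ q a c) (hopt : optAt μ σ q a c (threshold μ σ q a c) = 0)
    {n : WithTop ℕ∞} (hn : n ≠ 0) : ContDiffAt ℝ n (threshold μ σ q a) c := by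
  obtain ⟨d, hd, hd'⟩ := optAt_hasDerivAt (μ := μ) hσ hq ha0 ha1 hc (threshold μ σ q a c)
  refine contDiffAt_of_unique_zero hn (G := fun x => optAt μ σ q a x.1 x.2) (U := Set.Ioi 0)
    ?_ hd' hd.ne (Ioi_mem_nhds hpos) hopt ?_
  · have h1 := contDiff_decay (μ := μ) hσ hq (n := n)
    have h2 := contDiff_theta1 (μ := μ) hσ hq (n := n)
    unfold optAt optFun coreOpt corePi coreAlpha
    fun_prop
  · filter_upwards [Ioi_mem_nhds hc] with c' hc' x hx h
    exact (threshold_eq hσ hq ha0 ha1 hc' hx h).symm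

lemma contDiffAt_profileAt (hσ : 0 < σ) (hq : 0 < q) (ha1 : a < 1) (hc : 0 < c)
    {n : WithTop ℕ∞} {f : ℝ → ℝ} (hf : ContDiffAt ℝ n f c) (t : ℝ) :
    ContDiffAt ℝ n (fun x : ℝ × ℝ => profileAt μ σ q a (f x.1) x.1 x.2) (c, t) := by
  have h1 := contDiff_decay (μ := μ) hσ hq (n := n)
  have h2 := contDiff_theta1 (μ := μ) hσ hq (n := n)
  have hf' : ContDiffAt ℝ n (fun x : ℝ × ℝ => f x.1) (c, t) :=
    ContDiffAt.comp (c, t) (f := Prod.fst) hf contDiffAt_fst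
  have hw := decay_pos (μ := μ) hσ hq c
  have hA := theta1_pos (μ := μ) hσ hq c
  have hu := decay_pos (μ := μ) hσ hq (a * c)
  have hl := theta1_pos (μ := μ) hσ hq (a * c)
  have hα := alphaAt_pos (μ := μ) (y := f c) hσ hq ha1 hc
  have hb := b11At_pos (μ := μ) (y := f c) hσ hq ha1 hc
  have hK := K1At_pos (μ := μ) (y := f c) hσ hq ha1 hc
  have e1 : ContDiffAt ℝ n (fun x : ℝ × ℝ => expE μ σ q a (f x.1) x.1) (c, t) := by
    unfold expE; fun_prop
  have e2 : ContDiffAt ℝ n (fun x : ℝ × ℝ => expF μ σ q a (f x.1) x.1) (c, t) := by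
    unfold expF; fun_prop
  have e3 : ContDiffAt ℝ n (fun x : ℝ × ℝ => alphaAt μ σ q a (f x.1) x.1) (c, t) := by
    unfold alphaAt coreAlpha; fun_prop
  have e4 : ContDiffAt ℝ n (fun x : ℝ × ℝ => betaAt μ σ q a (f x.1) x.1) (c, t) := by
    unfold betaAt coreBeta; fun_prop
  have e5 : ContDiffAt ℝ n (fun x : ℝ × ℝ => b11At μ σ q a (f x.1) x.1) (c, t) := by
    unfold b11At coreB11; fun_prop
  have e6 : ContDiffAt ℝ n (fun x : ℝ × ℝ => etaAt μ σ q a (f x.1) x.1) (c, t) := by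
    unfold etaAt coreEta coreBeta coreRho; fun_prop
  have e7 : ContDiffAt ℝ n (fun x : ℝ × ℝ => K1At μ σ q a (f x.1) x.1) (c, t) := by
    unfold K1At coreK1 coreAlpha coreB11; fun_prop
  have e8 : ContDiffAt ℝ n (fun x : ℝ × ℝ => lamAt μ σ q a (f x.1) x.1) (c, t) := by
    unfold lamAt
    refine ContDiffAt.div e6 (by fun_prop) ?_
    simp only
    positivity
  have e9 : ContDiffAt ℝ n (fun x : ℝ × ℝ => lamAt' μ σ q a (f x.1) x.1) (c, t) := by
    unfold lamAt'
    refine ContDiffAt.div e6 (by fun_prop) ?_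
    simp only
    positivity
  have e10 : ContDiffAt ℝ n (fun x : ℝ × ℝ => gamAt μ σ q a (f x.1) x.1) (c, t) := by
    unfold gamAt
    refine ContDiffAt.div e4 (by fun_prop) ?_
    simp only
    positivity
  -- The only reciprocal inside `coreKappa` is `1 / (l + u)`.
  have e11 : ContDiffAt ℝ n (fun x : ℝ × ℝ =>
      (theta1 μ σ q (a * x.1) + decay μ σ q (a * x.1))⁻¹) (c, t) := by
    refine ContDiffAt.inv (by fun_prop) ?_
    simp only
    positivity
  have e12 : ContDiffAt ℝ n (fun x : ℝ × ℝ => kappaAt μ σ q a (f x.1) x.1) (c, t) := by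
    unfold kappaAt
    refine ContDiffAt.div ?_ e7 hK.ne'
    unfold coreKappa coreEta coreRho coreBeta coreAlpha coreB11 corePay coreX coreB01 coreSlope
    simp only [div_eq_mul_inv]
    fun_prop
  unfold profileAt profile
  fun_prop

end Concrete

/-! ### Large dividend rates. -/

section LargeRates

variable {μ σ q a : ℝ}

lemma tendsto_theta1_atTop (hσ : 0 < σ) (hq : 0 < q) :
    Tendsto (theta1 μ σ q) atTop atTop := by
  have h1 : Tendsto (fun c : ℝ => 2 / σ ^ 2 * (c + -μ)) atTop atTop :=
    (tendsto_atTop_add_const_right _ _ tendsto_id).const_mul_atTop (by positivity)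
  refine tendsto_atTop_mono (fun c => ?_) h1
  have h2 := theta1_add_theta2 (μ := μ) (σ := σ) (q := q) c
  have h3 := theta2_neg (μ := μ) hσ hq c
  rw [← sub_eq_add_neg]
  linarith

lemma theta1_eq_div_decay (hσ : 0 < σ) (hq : 0 < q) (r : ℝ) :
    theta1 μ σ q r = 2 * q / σ ^ 2 / decay μ σ q r := by
  rw [eq_div_iff (decay_pos hσ hq r).ne', decay, mul_neg, theta1_mul_theta2 hσ hq, neg_neg]

lemma tendsto_decay (hσ : 0 < σ) (hq : 0 < q) : Tendsto (decay μ σ q) atTop (𝓝 0) := by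
  have h1 := (tendsto_theta1_atTop (μ := μ) hσ hq).inv_tendsto_atTop.const_mul (2 * q / σ ^ 2)
  rw [mul_zero] at h1
  refine h1.congr fun c => ?_
  have h2 := decay_pos (μ := μ) hσ hq c
  rw [Pi.inv_apply, theta1_eq_div_decay hσ hq]
  field_simp

/-- The sum of the roots with `A = p/w`, solved for the rate. Used at `c` and at `ac`, it eliminates
`c` and ties the two decay rates together. -/
lemma rate_eq (hσ : 0 < σ) (hq : 0 < q) (c : ℝ) : c * (2 / σ ^ 2)
    = (μ / q * (2 * q / σ ^ 2) * decay μ σ q c + 2 * q / σ ^ 2 - decay μ σ q c ^ 2)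
      / decay μ σ q c := by
  have h1 := theta1_add_theta2 (μ := μ) (σ := σ) (q := q) c
  have h2 := decay_pos (μ := μ) hσ hq c
  rw [theta1_eq_div_decay hσ hq, show theta2 μ σ q c = -decay μ σ q c by rw [decay, neg_neg]] at h1
  rw [eq_div_iff h2.ne']
  have h3 : 2 * q / σ ^ 2 / decay μ σ q c * decay μ σ q c = 2 * q / σ ^ 2 := by field_simp
  have h4 : μ / q * (2 * q / σ ^ 2) = 2 / σ ^ 2 * μ := by field_simp
  rw [h4]
  linear_combination h3 - decay μ σ q c * h1

lemma tendsto_decay_mul (hσ : 0 < σ) (hq : 0 < q) (ha0 : 0 < a) :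
    Tendsto (fun c => decay μ σ q (a * c)) atTop (𝓝 0) :=
  (tendsto_decay hσ hq).comp (tendsto_id.const_mul_atTop ha0)

lemma hasExp_decay_ratio (hσ : 0 < σ) (hq : 0 < q) (ha0 : 0 < a) :
    HasExp atTop (decay μ σ q) (fun c => decay μ σ q c / decay μ σ q (a * c))
      a (-(μ / q) + a * (μ / q)) (1 / (a * (2 * q / σ ^ 2)) - a / (2 * q / σ ^ 2))
      (μ / q / (a ^ 2 * (2 * q / σ ^ 2)) - μ / q / (a * (2 * q / σ ^ 2))) := by
  have hp : 0 < 2 * q / σ ^ 2 := by positivity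
  have hrel : ∀ c : ℝ, 2 * q / σ ^ 2 * (decay μ σ q c / decay μ σ q (a * c))
      = a * (2 * q / σ ^ 2) - (1 - a) * (μ / q * (2 * q / σ ^ 2)) * decay μ σ q c
        + decay μ σ q c * decay μ σ q (a * c) - a * decay μ σ q c ^ 2 := by
    intro c
    have h1 := rate_eq (μ := μ) hσ hq c
    have h2 := rate_eq (μ := μ) hσ hq (a * c)
    have h3 := decay_pos (μ := μ) hσ hq c
    have h4 := decay_pos (μ := μ) hσ hq (a * c)
    have h5 : a * c * (2 / σ ^ 2) = a * (c * (2 / σ ^ 2)) := by ring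
    rw [h5, h1] at h2
    generalize 2 * q / σ ^ 2 = p at *
    generalize μ / q = K at *
    generalize decay μ σ q (a * c) = u at *
    generalize decay μ σ q c = w at *
    field_simp at h2 ⊢
    linear_combination -h2
  have hw := tendsto_decay (μ := μ) hσ hq
  have hu := tendsto_decay_mul (μ := μ) hσ hq ha0
  refine hasExp_ratio ha0 hp hw ?_ ?_
  · have h1 : Tendsto (fun c => (a * (2 * q / σ ^ 2)
        - (1 - a) * (μ / q * (2 * q / σ ^ 2)) * decay μ σ q c
        + decay μ σ q c * decay μ σ q (a * c) - a * decay μ σ q c ^ 2) / (2 * q / σ ^ 2)) atTop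
        (𝓝 ((a * (2 * q / σ ^ 2) - (1 - a) * (μ / q * (2 * q / σ ^ 2)) * 0
          + 0 * 0 - a * 0 ^ 2) / (2 * q / σ ^ 2))) :=
      (((tendsto_const_nhds.sub (hw.const_mul _)).add (hw.mul hu)).sub
        ((hw.pow 2).const_mul a)).div_const _
    have h2 : (a * (2 * q / σ ^ 2) - (1 - a) * (μ / q * (2 * q / σ ^ 2)) * 0
          + 0 * 0 - a * 0 ^ 2) / (2 * q / σ ^ 2) = a := by
      field_simp
      ring
    rw [h2] at h1
    refine h1.congr fun c => ?_
    rw [← hrel c, mul_div_cancel_left₀ _ hp.ne']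
  · refine Eventually.of_forall fun c => ?_
    rw [hrel c]
    have h3 := decay_pos (μ := μ) hσ hq c
    have h4 := decay_pos (μ := μ) hσ hq (a * c)
    have h5 : decay μ σ q c ^ 2 / (decay μ σ q c / decay μ σ q (a * c))
        = decay μ σ q c * decay μ σ q (a * c) := by field_simp
    rw [h5]

lemma eventually_threshold (hμ : 0 < μ) (hσ : 0 < σ) (hq : 0 < q) (ha0 : 0 < a) (ha1 : a < 1) :
    ∀ᶠ c in atTop, μ / q / 2 ≤ threshold μ σ q a c ∧
      optAt μ σ q a c (threshold μ σ q a c) = 0 := by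
  have hp : 0 < 2 * q / σ ^ 2 := by positivity
  have hK : 0 < μ / q := by positivity
  have hw := tendsto_decay (μ := μ) hσ hq
  have hw0 : ∀ᶠ c in atTop, 0 < decay μ σ q c := Eventually.of_forall (decay_pos hσ hq)
  have hn := hasExp_decay_ratio (μ := μ) hσ hq ha0
  have hnm : ∀ c, decay μ σ q c / decay μ σ q (a * c) * (decay μ σ q (a * c) / decay μ σ q c)
      = 1 := fun c => by
    have h3 := decay_pos (μ := μ) hσ hq c
    have h4 := decay_pos (μ := μ) hσ hq (a * c)
    field_simp
  have hm := hasExp_ratio_inv ha0 hp hw hn (Eventually.of_forall hnm)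
  have hl : ∀ᶠ c in atTop, theta1 μ σ q (a * c) = 2 * q / σ ^ 2
      * (decay μ σ q c / decay μ σ q (a * c)) / decay μ σ q c := by
    refine Eventually.of_forall fun c => ?_
    have h3 := decay_pos (μ := μ) hσ hq c
    rw [theta1_eq_div_decay hσ hq]
    field_simp
  have hu : ∀ᶠ c in atTop, decay μ σ q (a * c)
      = decay μ σ q c * (decay μ σ q (a * c) / decay μ σ q c) := by
    refine Eventually.of_forall fun c => ?_
    have h3 := decay_pos (μ := μ) hσ hq c
    field_simp
  have ha : 0 < a * (2 * q / σ ^ 2) ^ 2 * (1 - a) := mul_pos (by positivity) (by linarith)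
  -- `K/2` and `2K` lie on either side of the limit `K`, so the optimality condition changes sign
  -- between them.
  obtain ⟨x₂, x₃, hx⟩ := hasExp_optFun hp ha0 hw hw0 hn hm hl hu
    (show 0 < μ / q / 2 by positivity)
  obtain ⟨y₂, y₃, hy⟩ := hasExp_optFun hp ha0 hw hw0 hn hm hl hu
    (show 0 < 2 * (μ / q) by positivity)
  have hpos := hx.eventually_pos hw hw0 (mul_pos ha (by linarith))
  have hneg := (hy.neg.of_eq neg_zero rfl rfl rfl).eventually_pos hw hw0
    (by have := mul_pos ha hK; linarith)
  filter_upwards [hpos, hneg, eventually_gt_atTop 0] with c h1 h2 h3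
  have hwc := decay_pos (μ := μ) hσ hq c
  have h4 : 0 < optAt μ σ q a c (μ / q / 2) := pos_of_mul_pos_right h1 hwc.le
  have h5 : optAt μ σ q a c (2 * (μ / q)) < 0 := by
    rw [neg_pos] at h2
    exact neg_of_mul_neg_right h2 hwc.le
  have hcont : Continuous (optAt μ σ q a c) := continuous_iff_continuousAt.2 fun b => by
    obtain ⟨d, -, hd⟩ := optAt_hasDerivAt (μ := μ) hσ hq ha0 ha1 h3 b
    exact hd.continuousAt
  obtain ⟨b, hb, hb0⟩ := intermediate_value_Icc' (show μ / q / 2 ≤ 2 * (μ / q) by linarith)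
    hcont.continuousOn (show (0 : ℝ) ∈ Set.Icc _ _ from ⟨h5.le, h4.le⟩)
  rw [threshold_eq hσ hq ha0 ha1 h3 (lt_of_lt_of_le (by positivity) hb.1) hb0]
  exact ⟨hb.1, hb0⟩

/-- Expansions at the optimal threshold as the dividend rate tends to infinity. -/
lemma expansions_at_threshold (hμ : 0 < μ) (hσ : 0 < σ) (hq : 0 < q) (ha0 : 0 < a) (ha1 : a < 1)
    {K p : ℝ} (hKd : K = μ / q) (hpd : p = 2 * q / σ ^ 2) :
    HasExp atTop (decay μ σ q) (fun c => lamAt μ σ q a (threshold μ σ q a c) c) 0 1 0 0 ∧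
    HasExp atTop (decay μ σ q) (fun c => kappaAt μ σ q a (threshold μ σ q a c) c)
      (-1) 0 (-(K ^ 2 / (2 * a))) (2 * K / (a ^ 2 * p) - K ^ 3 / (3 * a ^ 2) + K ^ 3 / a) ∧
    Tendsto (fun c => gamAt μ σ q a (threshold μ σ q a c) c / decay μ σ q c) atTop
      (𝓝 ((p - a * p) / (p * (a * p)))) ∧
    HasExp atTop (decay μ σ q) (fun c => decay μ σ q c * threshold μ σ q a c) 0 K (-(K ^ 2 / (2 * a)) - 1 / p) (K / (a ^ 2 * p) - K ^ 3 / (6 * a ^ 2) + K ^ 3 / (2 * a)) := by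
  have hp : 0 < p := by rw [hpd]; positivity
  have hK : 0 < K := by rw [hKd]; positivity
  have hw := tendsto_decay (μ := μ) hσ hq
  have hw0 : ∀ᶠ c in atTop, 0 < decay μ σ q c := Eventually.of_forall (decay_pos hσ hq)
  have hn := hasExp_decay_ratio (μ := μ) hσ hq ha0
  rw [← hpd, ← hKd] at hn
  have hnm : ∀ c, decay μ σ q c / decay μ σ q (a * c) * (decay μ σ q (a * c) / decay μ σ q c)
      = 1 := fun c => by
    have h3 := decay_pos (μ := μ) hσ hq c
    have h4 := decay_pos (μ := μ) hσ hq (a * c)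
    field_simp
  have hm := hasExp_ratio_inv ha0 hp hw hn (Eventually.of_forall hnm)
  have hl : ∀ᶠ c in atTop, theta1 μ σ q (a * c) = p
      * (decay μ σ q c / decay μ σ q (a * c)) / decay μ σ q c := by
    refine Eventually.of_forall fun c => ?_
    have h3 := decay_pos (μ := μ) hσ hq c
    rw [theta1_eq_div_decay hσ hq, hpd]
    field_simp
  have hu : ∀ᶠ c in atTop, decay μ σ q (a * c)
      = decay μ σ q c * (decay μ σ q (a * c) / decay μ σ q c) := by
    refine Eventually.of_forall fun c => ?_
    have h3 := decay_pos (μ := μ) hσ hq c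
    field_simp
  have hth := eventually_threshold (μ := μ) (a := a) hμ hσ hq ha0 ha1
  rw [← hKd] at hth
  obtain ⟨hε, hF, hY⟩ := threshold_expansions hp ha0 ha1 hK hw hw0 hn hm hl hu
    (hth.mono fun c h => h.1) (hth.mono fun c h => h.2)
  have hgeom : ∀ᶠ c in atTop, theta1 μ σ q c = p / decay μ σ q c ∧
      c * (2 / σ ^ 2) = (K * p * decay μ σ q c + p - decay μ σ q c ^ 2) / decay μ σ q c ∧
      theta1 μ σ q (a * c) = p * (decay μ σ q c / decay μ σ q (a * c)) / decay μ σ q c ∧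
      decay μ σ q (a * c) = decay μ σ q c * (decay μ σ q (a * c) / decay μ σ q c) ∧
      expE μ σ q a (threshold μ σ q a c) c = decay μ σ q c ^ 2 *
        (Real.exp (-((theta1 μ σ q (a * c) + decay μ σ q (a * c)) * threshold μ σ q a c))
          / decay μ σ q c ^ 2) ∧
      threshold μ σ q a c = decay μ σ q c * threshold μ σ q a c / decay μ σ q c := by
    filter_upwards [hl, hu, hw0] with c h1 h2 h3
    refine ⟨?_, ?_, h1, h2, ?_, ?_⟩
    · rw [theta1_eq_div_decay hσ hq, hpd]
    · rw [hpd, hKd]; exact rate_eq hσ hq c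
    · rw [expE]; field_simp
    · field_simp
  obtain ⟨r1, r2, r3⟩ := core_expansions ha0 ha1 hp hw hw0 hn hm hF hY hε hgeom
  exact ⟨r1, r2, r3, hY⟩

/-- The first-order approximation of the distance from the threshold to the zero of `C₀`. -/
def approxDist (s K p w : ℝ) : ℝ :=
  K / s + (-(2 / (s ^ 3 * p)) + K ^ 2 / (3 * s ^ 3) - K ^ 2 / (6 * s ^ 2) - K ^ 2 / s) * w

/-- All properties of the zero of the profile for a large rate `c`. -/
structure LargeRate (μ σ q a s K T c : ℝ) : Prop where
  rate_pos : 0 < c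
  threshold_pos : 0 < threshold μ σ q a c
  opt : optAt μ σ q a c (threshold μ σ q a c) = 0
  beta_pos : 0 < betaAt μ σ q a (threshold μ σ q a c) c
  approx_ge : K / (2 * s) ≤ approxDist s K (2 * q / σ ^ 2) (decay μ σ q c)
  neg : ∀ t, 0 < t → t ≤ K / (2 * s) → profileAt μ σ q a (threshold μ σ q a c) c t
    ≤ -(K ^ 2 / (2 * s ^ 2) / 4 * decay μ σ q c ^ 2)
  convex : ConvexOn ℝ (Set.Ici (K / (2 * s))) (profileAt μ σ q a (threshold μ σ q a c) c)
  pos : 0 < profileAt μ σ q a (threshold μ σ q a c) c T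

lemma eventually_largeRate (hμ : 0 < μ) (hσ : 0 < σ) (hq : 0 < q) (ha0 : 0 < a) (ha1 : a < 1)
    {s K : ℝ} (hs : 0 < s) (hsa : s ^ 2 = a) (hKd : K = μ / q) :
    ∀ᶠ c in atTop, LargeRate μ σ q a s K (2 * K / s) c := by
  have hK : 0 < K := by rw [hKd]; positivity
  have hw := tendsto_decay (μ := μ) hσ hq
  have hw0 : ∀ᶠ c in atTop, 0 < decay μ σ q c := Eventually.of_forall (decay_pos hσ hq)
  have hth := eventually_threshold (μ := μ) (a := a) hμ hσ hq ha0 ha1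
  obtain ⟨p, hpd⟩ : ∃ p : ℝ, p = 2 * q / σ ^ 2 := ⟨_, rfl⟩
  have hp : 0 < p := by rw [hpd]; positivity
  obtain ⟨hlam, hκ, hγ, -⟩ := expansions_at_threshold (μ := μ) (σ := σ) hμ hσ hq ha0 ha1 hKd hpd
  have hg₀ : 0 < (p - a * p) / (p * (a * p)) := by
    have : 0 < p * (1 - a) := mul_pos hp (by linarith)
    apply div_pos (by linarith) (by positivity)
  have hβ : ∀ᶠ c in atTop, 0 < betaAt μ σ q a (threshold μ σ q a c) c := by
    filter_upwards [hγ.eventually_const_lt hg₀, eventually_gt_atTop 0] with c h1 h2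
    have h3 := decay_pos (μ := μ) hσ hq c
    have h4 := alphaAt_pos (μ := μ) (y := threshold μ σ q a c) hσ hq ha1 h2
    have h5 := theta1_pos (μ := μ) hσ hq c
    rw [gamAt, div_div] at h1
    exact (div_pos_iff_of_pos_right (by positivity)).1 h1
  have hlam' : ∀ᶠ c in atTop, 0 ≤ lamAt' μ σ q a (threshold μ σ q a c) c ∧
      lamAt' μ σ q a (threshold μ σ q a c) c ≤ lamAt μ σ q a (threshold μ σ q a c) c := by
    filter_upwards [hβ, eventually_gt_atTop 0] with c h1 h2
    exact lamAt'_bounds hσ hq ha0 ha1 h2 h1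
  have hA : ∀ᶠ c in atTop, theta1 μ σ q c = p / decay μ σ q c :=
    Eventually.of_forall fun c => by rw [theta1_eq_div_decay hσ hq, hpd]
  -- Here `M = K²/(2a)` is read off from `κ`; `δ` and `T` are half and twice the limiting distance
  -- `K/s`.
  have hM1 : 2 * (K / (2 * s)) ^ 2 = K ^ 2 / (2 * a) := by
    rw [← hsa]; field_simp
  have hM2 : 4 * (K ^ 2 / (2 * a)) ≤ (2 * K / s) ^ 2 := by
    rw [← hsa]
    have : (2 * K / s) ^ 2 - 4 * (K ^ 2 / (2 * s ^ 2)) = 2 * (K / s) ^ 2 := by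
      field_simp; ring
    have : 0 ≤ 2 * (K / s) ^ 2 := by positivity
    linarith
  have hprof := profile_eventually hw hw0 hp (show 0 < K / (2 * s) by positivity) hM1
    (show 0 < 2 * K / s by positivity) hM2 hA hκ hlam hγ hg₀ hlam'
  have happ : Tendsto (fun c => approxDist s K (2 * q / σ ^ 2) (decay μ σ q c)) atTop
      (𝓝 (approxDist s K (2 * q / σ ^ 2) 0)) :=
    tendsto_const_nhds.add (hw.const_mul _)
  have hlt : K / (2 * s) < approxDist s K (2 * q / σ ^ 2) 0 := by
    unfold approxDist
    rw [mul_zero, add_zero]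
    gcongr
    linarith
  filter_upwards [hth, hβ, hprof, happ.eventually_const_lt hlt, eventually_gt_atTop 0]
    with c h1 h2 h3 h4 h5
  refine ⟨h5, lt_of_lt_of_le (by positivity) h1.1, h1.2, h2, h4.le, ?_, h3.2.1, h3.2.2⟩
  rw [hsa]
  exact h3.1

lemma LargeRate.exists_zero {s K T c : ℝ} (hσ : 0 < σ) (hq : 0 < q) (hs : 0 < s) (hK : 0 < K)
    (hT : K / (2 * s) < T) (h : LargeRate μ σ q a s K T c) :
    ∃ t₀, K / (2 * s) < t₀ ∧ profileAt μ σ q a (threshold μ σ q a c) c t₀ = 0 ∧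
      (∀ t, 0 < t → profileAt μ σ q a (threshold μ σ q a c) c t = 0 → t = t₀) ∧
      K ^ 2 / (2 * s ^ 2) / 4 * decay μ σ q c ^ 2
          * |t₀ - approxDist s K (2 * q / σ ^ 2) (decay μ σ q c)|
        ≤ T * |profileAt μ σ q a (threshold μ σ q a c) c
          (approxDist s K (2 * q / σ ^ 2) (decay μ σ q c))| := by
  have hw := decay_pos (μ := μ) hσ hq c
  have hδ : 0 < K / (2 * s) := by positivity
  have hm : 0 < K ^ 2 / (2 * s ^ 2) / 4 * decay μ σ q c ^ 2 := by positivity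
  have hcont : Continuous (profileAt μ σ q a (threshold μ σ q a c) c) :=
    continuous_iff_continuousAt.2 fun t => (profile_hasDerivAt _ _ _ _ _ _ t).continuousAt
  obtain ⟨t₀, h1, -, h2, h3, h4⟩ := existsUnique_zero_of_convexOn hδ hT hcont
    (fun t ht0 ht => (h.neg t ht0 ht).trans_lt (by linarith)) h.convex hm
    (h.neg _ hδ le_rfl) h.pos
  exact ⟨t₀, h1, h2, h3, h4 _ h.approx_ge⟩

/-- The profile at the approximate zero is of fourth order. -/
lemma profile_approx_isBigO (hμ : 0 < μ) (hσ : 0 < σ) (hq : 0 < q) (ha0 : 0 < a) (ha1 : a < 1)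
    {s K : ℝ} (hs : 0 < s) (hsa : s ^ 2 = a) (hKd : K = μ / q) :
    (fun c => profileAt μ σ q a (threshold μ σ q a c) c
      (approxDist s K (2 * q / σ ^ 2) (decay μ σ q c))) =O[atTop]
      fun c => decay μ σ q c ^ 4 := by
  have hK : 0 < K := by rw [hKd]; positivity
  have hw := tendsto_decay (μ := μ) hσ hq
  have hw0 : ∀ᶠ c in atTop, 0 < decay μ σ q c := Eventually.of_forall (decay_pos hσ hq)
  have hlarge := eventually_largeRate (μ := μ) (σ := σ) hμ hσ hq ha0 ha1 hs hsa hKd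
  obtain ⟨p, hpd⟩ : ∃ p : ℝ, p = 2 * q / σ ^ 2 := ⟨_, rfl⟩
  have hp : 0 < p := by rw [hpd]; positivity
  obtain ⟨hlam, hκ, hγ, -⟩ := expansions_at_threshold (μ := μ) (σ := σ) hμ hσ hq ha0 ha1 hKd hpd
  rw [← hpd]
  set τ : ℝ → ℝ := fun c => approxDist s K p (decay μ σ q c) with hτ
  have hτe : HasExp atTop (decay μ σ q) τ (K / s)
      (-(2 / (s ^ 3 * p)) + K ^ 2 / (3 * s ^ 3) - K ^ 2 / (6 * s ^ 2) - K ^ 2 / s) 0 0 :=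
    HasExp.of_exact fun c => by rw [hτ]; simp only [approxDist]; ring
  have hwτ := ((HasExp.id (L := atTop) (w := decay μ σ q)).mul hw hτe).of_eq (b₀ := 0)
    (b₁ := K / s)
    (b₂ := -(2 / (s ^ 3 * p)) + K ^ 2 / (3 * s ^ 3) - K ^ 2 / (6 * s ^ 2) - K ^ 2 / s)
    (b₃ := 0) (by ring) (by ring) (by ring) (by ring)
  -- Orders `0` and `1` cancel identically, order `2` because the leading distance is `K/s`, and
  -- order `3` by the choice of the coefficient of `w` in `approxDist`.
  have hmain := (((hwτ.exp hw).add hκ).sub (hlam.mul hw hτe)).of_eq (b₀ := 0) (b₁ := 0)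
    (b₂ := 0) (b₃ := 0) (by ring) (by ring) (by rw [← hsa]; field_simp; ring)
    (by rw [← hsa]; field_simp; ring)
  have hexp : (fun c => Real.exp (-(theta1 μ σ q c * τ c))) =O[atTop]
      fun c => decay μ σ q c ^ 4 := by
    refine exp_neg_div_isBigO_pow hw hw0 (κ := p * (K / (2 * s))) (by positivity) ?_ 4
    filter_upwards [hlarge] with c hc
    have h1 := hc.approx_ge
    rw [← hpd] at h1
    have h2 := decay_pos (μ := μ) hσ hq c
    rw [theta1_eq_div_decay hσ hq, ← hpd, mul_div_right_comm]
    exact mul_le_mul_of_nonneg_left h1 (by positivity)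
  have hγ1 : (fun c => gamAt μ σ q a (threshold μ σ q a c) c) =O[atTop] fun _ => (1 : ℝ) := by
    refine ((hγ.mul hw).isBigO_one ℝ).congr_left fun c => ?_
    have h2 := decay_pos (μ := μ) hσ hq c
    field_simp
  have hlast : (fun c => lamAt' μ σ q a (threshold μ σ q a c) c
      * Real.exp (-(decay μ σ q c * τ c)) - decay μ σ q c) =O[atTop] fun _ => (1 : ℝ) := by
    refine IsBigO.sub ?_ (hw.isBigO_one ℝ)
    refine IsBigO.trans (IsBigO.of_bound 1 ?_) (hlam.isBigO_one hw)
    filter_upwards [hlarge] with c hc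
    have h1 := lamAt'_bounds (μ := μ) hσ hq ha0 ha1 hc.rate_pos hc.beta_pos
    have h2 := hc.approx_ge
    rw [← hpd] at h2
    have h3 : 0 < τ c := lt_of_lt_of_le (by positivity) h2
    have h4 := decay_pos (μ := μ) hσ hq c
    have h5 : Real.exp (-(decay μ σ q c * τ c)) ≤ 1 :=
      Real.exp_le_one_iff.2 (by have := mul_pos h4 h3; linarith)
    have h6 := Real.exp_pos (-(decay μ σ q c * τ c))
    rw [Real.norm_eq_abs, Real.norm_eq_abs, abs_of_nonneg (mul_nonneg h1.1 h6.le),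
      abs_of_nonneg (h1.1.trans h1.2), one_mul]
    exact (mul_le_of_le_one_right h1.1 h5).trans h1.2
  have htail := (hγ1.mul hexp).mul hlast
  simp only [one_mul, mul_one] at htail
  have hmain' : (fun c => Real.exp (decay μ σ q c * τ c)
      + kappaAt μ σ q a (threshold μ σ q a c) c
      - lamAt μ σ q a (threshold μ σ q a c) c * τ c) =O[atTop] fun c => decay μ σ q c ^ 4 := by
    refine IsBigO.congr_left hmain fun c => ?_
    ring
  exact hmain'.add htail

end LargeRates

/-! ### From powers of `w` to powers of `1/c`. -/

section FinalExpansion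

lemma zero_expansion {μ σ q a s K : ℝ} {tstar : ℝ → ℝ} (hμ : 0 < μ) (hσ : 0 < σ) (hq : 0 < q)
    (ha0 : 0 < a) (ha1 : a < 1) (hs : 0 < s) (hsa : s ^ 2 = a) (hKd : K = μ / q)
    (hbound : ∀ᶠ c in atTop, K ^ 2 / (2 * s ^ 2) / 4 * decay μ σ q c ^ 2
          * |tstar c - approxDist s K (2 * q / σ ^ 2) (decay μ σ q c)|
        ≤ 2 * K / s * |profileAt μ σ q a (threshold μ σ q a c) c
          (approxDist s K (2 * q / σ ^ 2) (decay μ σ q c))|) :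
    (fun c : ℝ => threshold μ σ q a c + tstar c - (μ / q * (1 + 1 / s) +
      ((1 - 2 * s - 3 * a) * μ ^ 2 - 3 * (1 + s ^ 3 / 2) * q * σ ^ 2) /
        (3 * q * s ^ 3) * (1 / c))) =O[atTop] fun c => 1 / c ^ 2 := by
  have hK : 0 < K := by rw [hKd]; positivity
  have hw := tendsto_decay (μ := μ) hσ hq
  have hw0 := decay_pos (μ := μ) hσ hq
  obtain ⟨p, hpd⟩ : ∃ p : ℝ, p = 2 * q / σ ^ 2 := ⟨_, rfl⟩
  have hp : 0 < p := by rw [hpd]; positivity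
  obtain ⟨-, -, -, hY⟩ := expansions_at_threshold (μ := μ) (σ := σ) hμ hσ hq ha0 ha1 hKd hpd
  have hprof := profile_approx_isBigO (μ := μ) (σ := σ) hμ hσ hq ha0 ha1 hs hsa hKd
  rw [← hpd] at hprof
  simp only [← hpd] at hbound
  -- The residual `O(w⁴)` divided by the depth of order `w²`.
  have hdist : (fun c => tstar c - approxDist s K p (decay μ σ q c)) =O[atTop]
      fun c => decay μ σ q c ^ 2 := by
    have h1 := (hprof.mul (isBigO_refl (fun c => (decay μ σ q c ^ 2)⁻¹) atTop))
    have h2 : (fun c => decay μ σ q c ^ 4 * (decay μ σ q c ^ 2)⁻¹)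
        = fun c => decay μ σ q c ^ 2 := by
      funext c
      have := hw0 c
      field_simp
    rw [h2] at h1
    refine IsBigO.trans (IsBigO.of_bound (2 * K / s / (K ^ 2 / (2 * s ^ 2) / 4)) ?_) h1
    filter_upwards [hbound] with c hc
    have h3 := hw0 c
    have h4 : 0 < K ^ 2 / (2 * s ^ 2) / 4 := by positivity
    rw [norm_mul, norm_inv, norm_pow, Real.norm_eq_abs, Real.norm_eq_abs, Real.norm_eq_abs,
      abs_of_pos h3, ← mul_assoc, ← div_eq_mul_inv, le_div_iff₀ (by positivity), div_mul_eq_mul_div,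
      le_div_iff₀ h4]
    linarith
  -- The expansion is known for `w` times the threshold, so one order is lost on division.
  have hthr : (fun c => threshold μ σ q a c - (K + (-(K ^ 2 / (2 * a)) - 1 / p) * decay μ σ q c))
      =O[atTop] fun c => decay μ σ q c ^ 2 := by
    have h1 : HasExp atTop (decay μ σ q) (fun c => decay μ σ q c * (threshold μ σ q a c
        - (K + (-(K ^ 2 / (2 * a)) - 1 / p) * decay μ σ q c))) 0 0 0
        (K / (a ^ 2 * p) - K ^ 3 / (6 * a ^ 2) + K ^ 3 / (2 * a)) := by
      refine IsBigO.congr_left hY fun c => ?_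
      ring
    have h2 : (fun c => decay μ σ q c * (threshold μ σ q a c
        - (K + (-(K ^ 2 / (2 * a)) - 1 / p) * decay μ σ q c))) =O[atTop]
        fun c => decay μ σ q c ^ 3 := by
      have h3 := (isBigO_refl (fun c => decay μ σ q c ^ 3) atTop).mul (hw.isBigO_one ℝ)
      simp only [mul_one] at h3
      have h4 : (fun c => decay μ σ q c ^ 4) =O[atTop] fun c => decay μ σ q c ^ 3 :=
        h3.congr_left fun c => by ring
      refine ((IsBigO.trans h1 h4).add ((isBigO_refl (fun c => decay μ σ q c ^ 3)
        atTop).const_mul_left (K / (a ^ 2 * p) - K ^ 3 / (6 * a ^ 2)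
          + K ^ 3 / (2 * a)))).congr_left fun c => ?_
      ring
    have h3 := h2.mul (isBigO_refl (fun c => (decay μ σ q c)⁻¹) atTop)
    refine h3.congr (fun c => ?_) fun c => ?_
    · have := hw0 c
      field_simp
    · have := hw0 c
      field_simp
  have hcw : ∀ c, c * decay μ σ q c
      = σ ^ 2 / 2 * (K * p * decay μ σ q c + p - decay μ σ q c ^ 2) := fun c => by
    have h1 := rate_eq (μ := μ) hσ hq c
    rw [← hpd, ← hKd, eq_div_iff (hw0 c).ne'] at h1
    rw [← h1]
    field_simp
  have hlim : Tendsto (fun c => c * decay μ σ q c) atTop (𝓝 q) := by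
    have h1 : Tendsto (fun c => σ ^ 2 / 2 * (K * p * decay μ σ q c + p - decay μ σ q c ^ 2))
        atTop (𝓝 (σ ^ 2 / 2 * (K * p * 0 + p - 0 ^ 2))) :=
      (((hw.const_mul (K * p)).add_const p).sub (hw.pow 2)).const_mul _
    have h2 : σ ^ 2 / 2 * (K * p * 0 + p - 0 ^ 2) = q := by
      rw [hpd]; field_simp; ring
    rw [h2] at h1
    exact h1.congr fun c => (hcw c).symm
  have hw2 : (fun c => decay μ σ q c ^ 2) =O[atTop] fun c : ℝ => 1 / c ^ 2 := by
    have h1 := ((hlim.isBigO_one ℝ).pow 2).mul (isBigO_refl (fun c : ℝ => 1 / c ^ 2) atTop)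
    simp only [one_pow, one_mul] at h1
    refine IsBigO.congr' h1 ?_ EventuallyEq.rfl
    filter_upwards [eventually_gt_atTop 0] with c hc
    field_simp
  -- From `c w = q + σ²(K p w - w²)/2` one gets `w - q/c = O(w/c)`, and `1/c` is of order `w`.
  have hinv : (fun c => decay μ σ q c - q * (1 / c)) =O[atTop] fun c => decay μ σ q c ^ 2 := by
    have h1 : Tendsto (fun c => σ ^ 2 / 2 * (K * p - decay μ σ q c) * (c * decay μ σ q c)⁻¹) atTop
        (𝓝 (σ ^ 2 / 2 * (K * p - 0) * q⁻¹)) :=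
      ((hw.const_sub _).const_mul _).mul (hlim.inv₀ hq.ne')
    have h2 := (h1.isBigO_one ℝ).mul (isBigO_refl (fun c => decay μ σ q c ^ 2) atTop)
    simp only [one_mul] at h2
    refine IsBigO.congr' h2 ?_ EventuallyEq.rfl
    filter_upwards [eventually_gt_atTop 0] with c hc
    have h3 := hw0 c
    have h4 := hcw c
    have h5 : σ ^ 2 / 2 * p = q := by rw [hpd]; field_simp
    field_simp at h4 ⊢
    linear_combination -h4 - 2 * h5
  have hall := ((hthr.add hdist).add (hinv.const_mul_left
    ((-(K ^ 2 / (2 * a)) - 1 / p) + (-(2 / (s ^ 3 * p)) + K ^ 2 / (3 * s ^ 3)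
      - K ^ 2 / (6 * s ^ 2) - K ^ 2 / s)))).trans hw2
  refine hall.congr_left fun c => ?_
  have hcoef : ((1 - 2 * s - 3 * a) * μ ^ 2 - 3 * (1 + s ^ 3 / 2) * q * σ ^ 2) / (3 * q * s ^ 3)
      = ((-(K ^ 2 / (2 * a)) - 1 / p) + (-(2 / (s ^ 3 * p)) + K ^ 2 / (3 * s ^ 3)
        - K ^ 2 / (6 * s ^ 2) - K ^ 2 / s)) * q := by
    rw [hpd, hKd, ← hsa]
    field_simp
    ring
  rw [hcoef, ← hKd]
  unfold approxDist
  ring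

end FinalExpansion

end DrawdownDividends

end

/-! ### Assembly of the proposition. -/

theorem mainTheorem4 (μ σ q a : ℝ) (hμ : 0 < μ) (hσ : 0 < σ) (hq : 0 < q)
    (ha0 : 0 < a) (ha1 : a < 1) :
    ∃ c₀ : ℝ, q * σ ^ 2 / (2 * μ) < c₀ ∧ ∃ bstar zstar : ℝ → ℝ,
      (∀ c : ℝ, c₀ < c → ∀ x : ℝ, 0 < x →
        DrawdownDividends.argmaxThreshold μ σ q a x c = {bstar c}) ∧
      (∀ c : ℝ, c₀ < c →
        {z : ℝ | bstar c < z ∧ DrawdownDividends.C0 μ σ q a (bstar c) z c = 0} = {zstar c}) ∧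
      Tendsto zstar atTop (𝓝 (μ / q * (1 + 1 / Real.sqrt a))) ∧
      ContDiffOn ℝ ((⊤ : ℕ∞) : WithTop ℕ∞) zstar (Set.Ioi c₀) ∧
      (fun c : ℝ => zstar c -
          (μ / q * (1 + 1 / Real.sqrt a) +
            ((1 - 2 * Real.sqrt a - 3 * a) * μ ^ 2
                - 3 * (1 + Real.sqrt (a ^ 3) / 2) * q * σ ^ 2) /
              (3 * q * Real.sqrt (a ^ 3)) * (1 / c)))
        =O[atTop] (fun c : ℝ => 1 / c ^ 2) := by
  open DrawdownDividends in
  obtain ⟨s, hsd⟩ : ∃ s : ℝ, s = Real.sqrt a := ⟨_, rfl⟩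
  have hs : 0 < s := hsd ▸ Real.sqrt_pos.2 ha0
  have hsa : s ^ 2 = a := by rw [hsd]; exact Real.sq_sqrt ha0.le
  have hs3 : Real.sqrt (a ^ 3) = s ^ 3 := by
    rw [← hsa, show (s ^ 2) ^ 3 = (s ^ 3) ^ 2 by ring]
    exact Real.sqrt_sq (by positivity)
  rw [hs3, ← hsd]
  obtain ⟨K, hKd⟩ : ∃ K : ℝ, K = μ / q := ⟨_, rfl⟩
  have hK : 0 < K := by rw [hKd]; positivity
  have hT : K / (2 * s) < 2 * K / s := by
    rw [div_lt_div_iff₀ (by positivity) hs]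
    nlinarith [mul_pos hK hs]
  obtain ⟨c₁, hc₁⟩ := eventually_atTop.1
    (eventually_largeRate (σ := σ) hμ hσ hq ha0 ha1 hs hsa hKd)
  have hlarge : ∀ c, max c₁ (q * σ ^ 2 / (2 * μ) + 1) < c → LargeRate μ σ q a s K (2 * K / s) c :=
    fun c hc => hc₁ c ((le_max_left _ _).trans hc.le)
  -- The bound on `c` sits inside the existential so that a function on all of `ℝ` can be chosen;
  -- below the bound its value is irrelevant.
  have hex : ∀ c, ∃ t₀, max c₁ (q * σ ^ 2 / (2 * μ) + 1) < c → K / (2 * s) < t₀ ∧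
      profileAt μ σ q a (threshold μ σ q a c) c t₀ = 0 ∧
      (∀ t, 0 < t → profileAt μ σ q a (threshold μ σ q a c) c t = 0 → t = t₀) ∧
      K ^ 2 / (2 * s ^ 2) / 4 * decay μ σ q c ^ 2
          * |t₀ - approxDist s K (2 * q / σ ^ 2) (decay μ σ q c)|
        ≤ 2 * K / s * |profileAt μ σ q a (threshold μ σ q a c) c
          (approxDist s K (2 * q / σ ^ 2) (decay μ σ q c))| := by
    intro c
    by_cases hc : max c₁ (q * σ ^ 2 / (2 * μ) + 1) < c
    · obtain ⟨t₀, h⟩ := (hlarge c hc).exists_zero hσ hq hs hK hT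
      exact ⟨t₀, fun _ => h⟩
    · exact ⟨0, fun h => absurd h hc⟩
  choose tstar htstar using hex
  have hδ : 0 < K / (2 * s) := by positivity
  have hexpansion := zero_expansion (tstar := tstar) hμ hσ hq ha0 ha1 hs hsa hKd
    ((eventually_gt_atTop (max c₁ (q * σ ^ 2 / (2 * μ) + 1))).mono
      fun c hc => (htstar c hc).2.2.2)
  refine ⟨max c₁ (q * σ ^ 2 / (2 * μ) + 1),
    lt_of_lt_of_le (lt_add_one _) (le_max_right _ _), threshold μ σ q a,
    fun c => threshold μ σ q a c + tstar c, ?_, ?_, ?_, ?_, hexpansion⟩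
  · intro c hc x hx
    have h := hlarge c hc
    exact argmaxThreshold_eq hσ hq ha0 ha1 h.rate_pos h.threshold_pos h.opt hx
  · intro c hc
    have h := hlarge c hc
    obtain ⟨h1, h2, h3, -⟩ := htstar c hc
    have hiff := C0_eq_zero_iff hσ hq ha1 h.rate_pos h.beta_pos h.opt
    ext z
    simp only [Set.mem_ofPred_eq, Set.mem_singleton_iff]
    constructor
    · rintro ⟨hz, h0⟩
      have h4 := h3 (z - threshold μ σ q a c) (by linarith)
        ((hiff _).1 (by rwa [add_sub_cancel]))
      linarith
    · rintro rfl
      exact ⟨by linarith, (hiff _).2 h2⟩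
  · have h1 : Tendsto (fun c : ℝ => 1 / c ^ 2) atTop (𝓝 0) := by
      simpa using (tendsto_pow_neg_atTop (𝕜 := ℝ) (n := 2) (by norm_num))
    have h2 := hexpansion.trans_tendsto h1
    have h3 : Tendsto (fun c : ℝ => 1 / c) atTop (𝓝 0) := by
      simpa using tendsto_inv_atTop_zero (𝕜 := ℝ)
    have h4 := h2.add ((h3.const_mul (((1 - 2 * s - 3 * a) * μ ^ 2
      - 3 * (1 + s ^ 3 / 2) * q * σ ^ 2) / (3 * q * s ^ 3))).const_add (μ / q * (1 + 1 / s)))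
    simpa using h4
  · intro c hc
    have h := hlarge c hc
    obtain ⟨h1, h2, h3, -⟩ := htstar c hc
    have hb := contDiffAt_threshold hσ hq ha0 ha1 h.rate_pos h.threshold_pos h.opt
      (n := ((⊤ : ℕ∞) : WithTop ℕ∞)) (by simp)
    have hd : HasDerivAt (profileAt μ σ q a (threshold μ σ q a c) c) _ (tstar c) :=
      profile_hasDerivAt _ _ _ _ _ _ _
    -- By convexity the derivative at the zero is at least the slope of the chord from `δ`, which is
    -- positive since the profile is negative at `δ`. This is the nondegeneracy needed for the
    -- implicit function theorem.
    have hslope := h.convex.slope_le_of_hasDerivAt (Set.mem_Ici.2 le_rfl)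
      (Set.mem_Ici.2 h1.le) h1 hd
    have hneg : profileAt μ σ q a (threshold μ σ q a c) c (K / (2 * s)) < 0 := by
      have := decay_pos (μ := μ) hσ hq c
      have h4 : 0 < K ^ 2 / (2 * s ^ 2) / 4 * decay μ σ q c ^ 2 := by positivity
      exact (h.neg _ hδ le_rfl).trans_lt (by linarith)
    have hpos : 0 < slope (profileAt μ σ q a (threshold μ σ q a c) c) (K / (2 * s))
        (tstar c) := by
      rw [slope_def_field, h2]
      exact div_pos (by linarith) (by linarith)
    have ht : ContDiffAt ℝ ((⊤ : ℕ∞) : WithTop ℕ∞) tstar c := by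
      refine contDiffAt_of_unique_zero (by simp)
        (G := fun x : ℝ × ℝ => profileAt μ σ q a (threshold μ σ q a x.1) x.1 x.2)
        (contDiffAt_profileAt hσ hq ha1 h.rate_pos hb _) hd (hpos.trans_le hslope).ne'
        (Ioi_mem_nhds (hδ.trans h1)) h2 ?_
      filter_upwards [Ioi_mem_nhds hc] with c' hc' x hx h0
      exact (htstar c' hc').2.2.1 x hx h0
    exact (hb.add ht).contDiffWithinAt
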